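/- Let $G$ be a finite simple graph with $n$ vertices and let $T$ be a treedepth decomposition of $G$ that is a tree with root $r$ (this is automatic if $G$ is connected): $T$ is a rooted tree with vertex set $V(G)$ such that for every edge $uv$ of $G$ one of $u,v$ is an ancestor of the other in $T$. Let $t$ be the depth of $T$, i.e. the number of nodes on a longest root-to-leaf path. For a node $x$ let $P_x$ be the set of its proper ancestors, let $N_G[D]$ be the closed neighbourhood of $D$, and consider the following recursive procedure $\mathrm{domset}(x,P,D)$, where $P,D\subseteq P_x$. * If $x$ is a leaf of $T$: if $x\notin N_G[D]$ or $P\not\subseteq N_G[D]$, put $D:=D\cup\{x\}$. Then return $\infty$ if $P\not\subseteq N_G[D]$; otherwise return $1$ if $x\in D$ and $0$ if $x\notin D$. * Otherwise put $\mathit{result}:=\infty$ and $P:=P\cup\{x\}$. For every partition $S_1\uplus\dots\uplus S_l$ of $P$ into nonempty blocks do the following. Start with $\mathit{baseline}:=\mathit{baseline}':=0$ and, for $1\le i\le l$, empty ordered lists $L[i]$, $L'[i]$. For each child $y$ of $x$ compute $b:=\mathrm{domset}(y,\varnothing,D)$ and $b':=\mathrm{domset}(y,\varnothing,D\cup\{x\})$,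 add $b$ to $\mathit{baseline}$ and $b'$ to $\mathit{baseline}'$, and for each $i$ insert the overhead cost $c:=\mathrm{domset}(y,S_i,D)-b$ of $y$ into $L[i]$ and the overhead cost $c':=\mathrm{domset}(y,S_i,D\cup\{x\})-b'$ of $y$ into $L'[i]$, keeping only the $l$ smallest entries of each list. Let $m$ (respectively $m'$) be the minimum total cost of choosing from each list $L[i]$ (respectively $L'[i]$), $1\le i\le l$, one entry such that the chosen entries belong to pairwise distinct children ($\infty$ if there is no such choice). Put $\mathit{result}:=\min(\mathit{result},\,m+\mathit{baseline},\,m'+\mathit{baseline}'+1)$. After the last partition return $\mathit{result}$. The procedure is implemented on a unit-cost random access machine with recursive calls and with read-only access to the input (adjacency test for two vertices, parent of a node, number of children of a node, $i$-th child of a node), whose only arithmetic operations are addition, subtraction and comparison. In the implementation the sets are stored as arrays indexed by the positions on the path from the root, a child in a list is represented by a label that is not in use in the current lists, and $m,m'$ are found by trying all choices. Each command, operator and input access takes one time step, and copying an array in a call takes time proportional to its length. Space is the maximum, over all moments of the computation, of the total number of bits of all values stored in the frames of all active calls, of the return addresses and of the temporary values (the input is not counted). Then, uniformly in $G$, $T$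 and the order of the children, the call $\mathrm{domset}(r,\varnothing,\varnothing)$ terminates and returns the size of a minimum dominating set of $G$; it runs in time $t^{O(t^2)}\cdot n$ and uses $O(t^3\log t+t\log n)$ bits. Precisely, there is an absolute constant $C$ such that always the time is at most $C\,t^{C t^2}\,n$ and the space is at most $C\,(t^3\log_2 t+t\log_2 n+1)$ bits. (The outer factor $C$ in the time bound and the summand $1$ in the space bound matter only for $t=n=1$.) -/

import Mathlib

/-! Rooted forests, treedepth decompositions and dominating sets. -/

/-- A rooted forest on the vertex set `V`, given by its parent function (roots have no parent). -/
structure RootedForest (V : Type) where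
  parent : V → Option V
  acyclic : WellFounded fun u v => parent v = some u

namespace RootedForest

variable {V : Type}

/-- `u` is a proper ancestor of `v`. -/
def Ancestor (F : RootedForest V) (u v : V) : Prop :=
  Relation.TransGen (fun a b => F.parent b = some a) u v

/-- The number of vertices on the path from the root to `v`, both ends included. -/
noncomputable def depth (F : RootedForest V) (v : V) : ℕ :=
  Set.ncard {u | u = v ∨ F.Ancestor u v}

/-- The height: the number of vertices on a longest path from a root to a leaf. -/
noncomputable def height [Fintype V] (F : RootedForest V) : ℕ :=
  Finset.univ.sup F.depth

/-- Every edge of `G` joins two vertices one of which is an ancestor of the other. -/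
def IsTreedepthDecomposition (F : RootedForest V) (G : SimpleGraph V) : Prop :=
  ∀ u v, G.Adj u v → F.Ancestor u v ∨ F.Ancestor v u

/-- `F` is a tree with root `r`. -/
def IsTreeWithRoot (F : RootedForest V) (r : V) : Prop :=
  ∀ v, F.parent v = none ↔ v = r

end RootedForest

/-- Every vertex outside `S` has a neighbour in `S`. -/
def IsDominatingSet {V : Type} (G : SimpleGraph V) (S : Finset V) : Prop :=
  ∀ v, v ∈ S ∨ ∃ u ∈ S, G.Adj u v

/-- `m` is the size of a minimum dominating set of `G`. -/
def IsDominationNumber {V : Type} (G : SimpleGraph V) (m : ℕ) : Prop :=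
  IsLeast {k | ∃ S : Finset V, IsDominatingSet G S ∧ S.card = k} m

namespace Domset

/-! The read-only input: a graph, a rooted forest, and for each node an array of its children,
in any order. -/

structure Input (n : ℕ) where
  graph : SimpleGraph (Fin n)
  forest : RootedForest (Fin n)
  children : Fin n → List (Fin n)
  nodup_children : ∀ v, (children v).Nodup
  mem_children : ∀ u v, u ∈ children v ↔ forest.parent u = some v

namespace Input

variable {n : ℕ}

/-- The number of children of node `u`. -/
def degQuery (I : Input n) (u : ℕ) : ℕ :=
  if h : u < n then (I.children ⟨u, h⟩).length else 0

/-- The child of node `u` with index `i`, counted from `0`. -/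
def childQuery (I : Input n) (u i : ℕ) : ℕ :=
  if h : u < n then ((I.children ⟨u, h⟩).map Fin.val).getD i 0 else 0

/-- The parent of node `u` (`0` if there is none). -/
def parentQuery (I : Input n) (u : ℕ) : ℕ :=
  if h : u < n then ((I.forest.parent ⟨u, h⟩).map Fin.val).getD 0 else 0

open Classical in
/-- One entry of the adjacency matrix of the graph. -/
noncomputable def adjQuery (I : Input n) (u v : ℕ) : ℕ :=
  if ∃ (hu : u < n) (hv : v < n), I.graph.Adj ⟨u, hu⟩ ⟨v, hv⟩ then 1 else 0

end Input

/-! The machine model: a random access machine whose programs are structured commands with one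
recursive procedure. A call frame holds scalar variables and arrays (lists); a stored value is a
natural number or `∞`. Every command and every operator of an expression costs one time step.
Space is the number of bits of all values that are stored in all frames on the call stack, of the
return addresses and of the temporary values of the expression under evaluation. -/

/-- Names of the scalar variables of a call frame; `x` and `k` are parameters and `ret` holds the
returned value. -/
inductive Var
  | x | k | ret
  | ok | dom | u | w | p | q
  | result | more | l | i | j | h | row | row2 | ci | y
  | base | base2 | b | b2 | c | c2 | lab | used | cc | cl | tmp
  | best | sum | carry | mx
  deriving DecidableEq

instance : Fintype Var where
  elems := {.x, .k, .ret, .ok, .dom, .u, .w, .p, .q, .result, .more, .l, .i, .j, .h, .row, .row2,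
    .ci, .y, .base, .base2, .b, .b2, .c, .c2, .lab, .used, .cc, .cl, .tmp, .best, .sum, .carry, .mx}
  complete s := by cases s <;> decide

/-- Names of the arrays of a call frame; `P` and `D` are parameters. -/
inductive Arr
  | P | D | B | S | cost | label | cost2 | label2 | J
  deriving DecidableEq

instance : Fintype Arr where
  elems := {.P, .D, .B, .S, .cost, .label, .cost2, .label2, .J}
  complete a := by cases a <;> decide

/-- A call frame. -/
@[ext] structure Frame where
  scalar : Var → ℕ∞
  array : Arr → List ℕ∞

namespace Frame

/-- The frame in which every variable is `0` and every array is empty. -/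
def empty : Frame := ⟨fun _ => 0, fun _ => []⟩

def setScalar (σ : Frame) (s : Var) (v : ℕ∞) : Frame :=
  { σ with scalar := Function.update σ.scalar s v }

def setArray (σ : Frame) (a : Arr) (L : List ℕ∞) : Frame :=
  { σ with array := Function.update σ.array a L }

end Frame

/-- The bits that a stored value occupies: its binary digits (none for `∞`) and two bits for the
end mark and for telling `∞` from a number. -/
noncomputable def bits (v : ℕ∞) : ℕ := Nat.size v.toNat + 2

/-- The bits that a call frame occupies. -/
noncomputable def Frame.bits (σ : Frame) : ℕ :=
  (∑ s : Var, Domset.bits (σ.scalar s)) + ∑ a : Arr, ((σ.array a).map Domset.bits).sum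

inductive Expr
  | num (m : ℕ)
  | infty
  | var (s : Var)
  | get (a : Arr) (e : Expr)
  | len (a : Arr)
  | add (e f : Expr)
  | sub (e f : Expr)
  | eq (e f : Expr)
  | lt (e f : Expr)
  | deg (e : Expr)
  | child (e f : Expr)
  | parent (e : Expr)
  | adj (e f : Expr)

namespace Expr

open Classical in
/-- The value of an expression; comparisons yield `1` or `0`. -/
noncomputable def eval {n : ℕ} (I : Input n) (σ : Frame) : Expr → ℕ∞
  | num m => m
  | infty => ⊤
  | var s => σ.scalar s
  | get a e => (σ.array a).getD (e.eval I σ).toNat 0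
  | len a => (σ.array a).length
  | add e f => e.eval I σ + f.eval I σ
  | sub e f => e.eval I σ - f.eval I σ
  | eq e f => if e.eval I σ = f.eval I σ then 1 else 0
  | lt e f => if e.eval I σ < f.eval I σ then 1 else 0
  | deg e => I.degQuery (e.eval I σ).toNat
  | child e f => I.childQuery (e.eval I σ).toNat (f.eval I σ).toNat
  | parent e => I.parentQuery (e.eval I σ).toNat
  | adj e f => I.adjQuery (e.eval I σ).toNat (f.eval I σ).toNat

/-- The time to evaluate an expression. -/
def time : Expr → ℕ
  | num _ | infty | var _ | len _ => 1
  | get _ e | deg e | parent e => e.time + 1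
  | add e f | sub e f | eq e f | lt e f | child e f | adj e f => e.time + f.time + 1

/-- The bits of the values of all subexpressions of an expression. -/
noncomputable def space {n : ℕ} (I : Input n) (σ : Frame) : Expr → ℕ
  | num m => bits ((num m).eval I σ)
  | infty => bits (infty.eval I σ)
  | var s => bits ((var s).eval I σ)
  | len a => bits ((len a).eval I σ)
  | get a e => e.space I σ + bits ((get a e).eval I σ)
  | deg e => e.space I σ + bits ((deg e).eval I σ)
  | parent e => e.space I σ + bits ((parent e).eval I σ)
  | add e f => e.space I σ + f.space I σ + bits ((add e f).eval I σ)
  | sub e f => e.space I σ + f.space I σ + bits ((sub e f).eval I σ)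
  | eq e f => e.space I σ + f.space I σ + bits ((eq e f).eval I σ)
  | lt e f => e.space I σ + f.space I σ + bits ((lt e f).eval I σ)
  | child e f => e.space I σ + f.space I σ + bits ((child e f).eval I σ)
  | adj e f => e.space I σ + f.space I σ + bits ((adj e f).eval I σ)

end Expr

inductive Cmd
  | skip
  /-- `s := e` -/
  | assign (s : Var) (e : Expr)
  /-- make the array empty -/
  | clear (a : Arr)
  /-- append a value to the array -/
  | push (a : Arr) (e : Expr)
  /-- `a[e] := f` -/
  | store (a : Arr) (e f : Expr)
  | seq (c d : Cmd)
  | ite (e : Expr) (c d : Cmd)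
  | loop (e : Expr) (c : Cmd)
  /-- Call the procedure in a new frame, whose scalars and arrays named in the two lists are
  initialised with copies of values and arrays of the caller; store the returned value in `s`. -/
  | call (s : Var) (es : List (Var × Expr)) (as : List (Arr × Arr))

/-- The number of call sites of a command. -/
def Cmd.callSites : Cmd → ℕ
  | .seq c d | .ite _ c d => c.callSites + d.callSites
  | .loop _ c => c.callSites
  | .call _ _ _ => 1
  | _ => 0

/-- The initial frame of a call. -/
noncomputable def calleeFrame {n : ℕ} (I : Input n) (σ : Frame) (es : List (Var × Expr))
    (as : List (Arr × Arr)) : Frame :=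
  es.foldl (fun τ a => τ.setScalar a.1 (a.2.eval I σ))
    (as.foldl (fun τ a => τ.setArray a.1 (σ.array a.2)) Frame.empty)

/-- `Exec I body c σ τ T S`: the command `c`, started in the frame `σ`, halts in the frame `τ`
after `T` steps, and at most `S` bits are occupied at any moment, where `body` is the body of the
procedure and frames below `σ` on the call stack are not counted. The relation is deterministic:
the rule that applies, and with it `τ`, `T` and `S`, is determined by `c` and `σ`. -/
inductive Exec {n : ℕ} (I : Input n) (body : Cmd) : Cmd → Frame → Frame → ℕ → ℕ → Prop
  | skip (σ : Frame) : Exec I body .skip σ σ 1 σ.bits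
  | assign (σ : Frame) (s : Var) (e : Expr) :
      Exec I body (.assign s e) σ (σ.setScalar s (e.eval I σ)) (e.time + 1)
        (max (σ.bits + e.space I σ) (σ.setScalar s (e.eval I σ)).bits)
  | clear (σ : Frame) (a : Arr) : Exec I body (.clear a) σ (σ.setArray a []) 1 σ.bits
  | push (σ : Frame) (a : Arr) (e : Expr) :
      Exec I body (.push a e) σ (σ.setArray a (σ.array a ++ [e.eval I σ])) (e.time + 1)
        (max (σ.bits + e.space I σ) (σ.setArray a (σ.array a ++ [e.eval I σ])).bits)
  | store (σ : Frame) (a : Arr) (e f : Expr) :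
      Exec I body (.store a e f) σ
        (σ.setArray a ((σ.array a).set (e.eval I σ).toNat (f.eval I σ))) (e.time + f.time + 1)
        (max (σ.bits + e.space I σ + f.space I σ)
          (σ.setArray a ((σ.array a).set (e.eval I σ).toNat (f.eval I σ))).bits)
  | seq {σ σ₁ σ₂ : Frame} {c d : Cmd} {T₁ T₂ S₁ S₂ : ℕ} :
      Exec I body c σ σ₁ T₁ S₁ → Exec I body d σ₁ σ₂ T₂ S₂ →
      Exec I body (.seq c d) σ σ₂ (T₁ + T₂) (max S₁ S₂)
  | iteTrue {σ τ : Frame} {e : Expr} {c d : Cmd} {T S : ℕ} :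
      e.eval I σ ≠ 0 → Exec I body c σ τ T S →
      Exec I body (.ite e c d) σ τ (e.time + 1 + T) (max (σ.bits + e.space I σ) S)
  | iteFalse {σ τ : Frame} {e : Expr} {c d : Cmd} {T S : ℕ} :
      e.eval I σ = 0 → Exec I body d σ τ T S →
      Exec I body (.ite e c d) σ τ (e.time + 1 + T) (max (σ.bits + e.space I σ) S)
  | loopDone {σ : Frame} {e : Expr} {c : Cmd} :
      e.eval I σ = 0 →
      Exec I body (.loop e c) σ σ (e.time + 1) (σ.bits + e.space I σ)
  | loopStep {σ σ₁ σ₂ : Frame} {e : Expr} {c : Cmd} {T₁ T₂ S₁ S₂ : ℕ} :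
      e.eval I σ ≠ 0 → Exec I body c σ σ₁ T₁ S₁ → Exec I body (.loop e c) σ₁ σ₂ T₂ S₂ →
      Exec I body (.loop e c) σ σ₂ (e.time + 1 + T₁ + T₂)
        (max (σ.bits + e.space I σ) (max S₁ S₂))
  | call {σ τ : Frame} {s : Var} {es : List (Var × Expr)} {as : List (Arr × Arr)} {T S : ℕ} :
      Exec I body body (calleeFrame I σ es as) τ T S →
      Exec I body (.call s es as) σ (σ.setScalar s (τ.scalar .ret))
        ((es.map fun a => a.2.time + 1).sum + (as.map fun a => (σ.array a.2).length + 1).sum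
          + 1 + T)
        (max (σ.bits + (es.map fun a => a.2.space I σ).sum + Nat.size body.callSites + S)
          (σ.setScalar s (τ.scalar .ret)).bits)

/-! The algorithm. The procedure `domset(G, T, x, P, D)` gets a node `x`, the number `k` of its
proper ancestors and two sets `P`, `D` of proper ancestors of `x`. A node of the path from the
root to `x` is represented by its position on this path (`0` for the root, `k` for `x`), and a set
of such nodes by its 0/1-array. -/

local infixr:50 " ;; " => Cmd.seq
local infixl:65 " +ₑ " => Expr.add
local infixl:65 " -ₑ " => Expr.sub
local infix:55 " =ₑ " => Expr.eq
local infix:55 " <ₑ " => Expr.lt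
local infix:52 " ≔ " => Cmd.assign

/-- Shorthand for the expression that reads a scalar variable. -/
def v (s : Var) : Expr := .var s

/-- `for s = 0, …, e - 1 do c`. -/
def forLoop (s : Var) (e : Expr) (c : Cmd) : Cmd :=
  s ≔ .num 0 ;; .loop (v s <ₑ e) (c ;; s ≔ v s +ₑ .num 1)

/-- `ok := 1` if `P ⊆ N[D]`, and `ok := 0` otherwise. The nodes `u` and `w` walk up the path from
`x`, and `p` and `q` are their positions. -/
def checkDominated : Cmd :=
  .ok ≔ .num 1 ;; .u ≔ v .x ;; .p ≔ v .k +ₑ .num 1 ;;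
  .loop (.num 0 <ₑ v .p) (
    .p ≔ v .p -ₑ .num 1 ;;
    .ite (.get .P (v .p)) (
      .dom ≔ .num 0 ;; .w ≔ v .x ;; .q ≔ v .k +ₑ .num 1 ;;
      .loop (.num 0 <ₑ v .q) (
        .q ≔ v .q -ₑ .num 1 ;;
        .ite (.get .D (v .q)) (
          .ite (v .u =ₑ v .w) (.dom ≔ .num 1) .skip ;;
          .ite (.adj (v .u) (v .w)) (.dom ≔ .num 1) .skip) .skip ;;
        .w ≔ .parent (v .w)) ;;
      .ite (v .dom) .skip (.ok ≔ .num 0)) .skip ;;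
    .u ≔ .parent (v .u))

/-- The case of a leaf `x`. -/
def leafCase : Cmd :=
  .push .D (.num 0) ;; .push .P (.num 1) ;; checkDominated ;;
  .ite (v .ok) .skip (.store .D (v .k) (.num 1)) ;;
  .store .P (v .k) (.num 0) ;; checkDominated ;;
  .ite (v .ok) (.ite (.get .D (v .k)) (.ret ≔ .num 1) (.ret ≔ .num 0)) (.ret ≔ .infty)

/-! A partition of `P` into `l` blocks is an array `B` that maps the elements of `P` to their
blocks `1, …, l` and all other positions to `0`, where the blocks are numbered in the order of
their first elements. -/

/-- The partition with the single block `P`, which is the first one in lexicographic order. -/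
def firstPartition : Cmd :=
  .clear .B ;; forLoop .p (v .k +ₑ .num 1) (.push .B (.get .P (v .p)))

/-- Replace `B` by its successor in the lexicographic order of the partitions of `P`; `more := 0`
if there is none. The last element of `P` whose block number does not exceed those of all elements
before it is moved to the next block, and all elements after it are moved to block `1`. -/
def nextPartition : Cmd :=
  .more ≔ .num 0 ;; .p ≔ v .k +ₑ .num 1 ;;
  .loop (.num 0 <ₑ v .p) (
    .p ≔ v .p -ₑ .num 1 ;;
    .ite (.get .P (v .p)) (
      .mx ≔ .num 0 ;;
      forLoop .q (v .p)
        (.ite (v .mx <ₑ .get .B (v .q)) (.mx ≔ .get .B (v .q)) .skip) ;;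
      .ite (v .mx <ₑ .get .B (v .p))
        (.store .B (v .p) (.num 1))
        (.store .B (v .p) (.get .B (v .p) +ₑ .num 1) ;; .more ≔ .num 1 ;; .p ≔ .num 0)) .skip)

/-- `l` is the number of blocks of `B`. -/
def countBlocks : Cmd :=
  .l ≔ .num 0 ;;
  forLoop .p (v .k +ₑ .num 1)
    (.ite (v .l <ₑ .get .B (v .p)) (.l ≔ .get .B (v .p)) .skip)

/-! A table with `l` rows of `l` entries, one row per block, is stored row by row in two arrays, one
for the overhead costs and one for the labels of the children. A row is ordered by cost and filled
up with entries of cost `∞`. -/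

/-- Make the table empty. -/
def initTable (tc tl : Arr) : Cmd :=
  .clear tc ;; .clear tl ;;
  forLoop .i (v .l) (forLoop .j (v .l) (.push tc .infty ;; .push tl (.num 0)))

/-- `lab` is the least label that does not occur in the two tables. -/
def freshLabel : Cmd :=
  .lab ≔ .num 0 ;; .used ≔ .num 1 ;;
  .loop (v .used) (
    .used ≔ .num 0 ;;
    forLoop .j (.len .label) (
      .ite (.get .label (v .j) =ₑ v .lab) (.used ≔ .num 1) .skip ;;
      .ite (.get .label2 (v .j) =ₑ v .lab) (.used ≔ .num 1) .skip) ;;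
    .ite (v .used) (.lab ≔ v .lab +ₑ .num 1) .skip)

/-- Insert the value of `cost` with the label `lab` into the ordered row of the table that starts
at index `row`, and keep only the smallest `l` entries. -/
def insertEntry (tc tl : Arr) (cost : Var) : Cmd :=
  .cc ≔ v cost ;; .cl ≔ v .lab ;;
  forLoop .j (v .l) (
    .ite (v .cc <ₑ .get tc (v .row +ₑ v .j)) (
      .tmp ≔ .get tc (v .row +ₑ v .j) ;; .store tc (v .row +ₑ v .j) (v .cc) ;; .cc ≔ v .tmp ;;
      .tmp ≔ .get tl (v .row +ₑ v .j) ;; .store tl (v .row +ₑ v .j) (v .cl) ;; .cl ≔ v .tmp)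
      .skip)

/-- `best` is the least cost of dominating all blocks from pairwise distinct children, where block
number `i + 1` uses entry number `J[i]` of row `i` of the table. All choices of `J` are tried. -/
def findMinSolution (tc tl : Arr) : Cmd :=
  .best ≔ .infty ;;
  .clear .J ;; forLoop .i (v .l) (.push .J (.num 0)) ;;
  .carry ≔ .num 0 ;;
  .loop (v .carry =ₑ .num 0) (
    .sum ≔ .num 0 ;; .row ≔ .num 0 ;;
    forLoop .i (v .l) (
      .sum ≔ v .sum +ₑ .get tc (v .row +ₑ .get .J (v .i)) ;;
      .row2 ≔ .num 0 ;;
      forLoop .h (v .i) (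
        .ite (.get tl (v .row2 +ₑ .get .J (v .h)) =ₑ .get tl (v .row +ₑ .get .J (v .i)))
          (.sum ≔ .infty) .skip ;;
        .row2 ≔ v .row2 +ₑ v .l) ;;
      .row ≔ v .row +ₑ v .l) ;;
    .ite (v .sum <ₑ v .best) (.best ≔ v .sum) .skip ;;
    .carry ≔ .num 1 ;; .i ≔ .num 0 ;;
    .loop (v .carry +ₑ (v .i <ₑ v .l) =ₑ .num 2) (
      .store .J (v .i) (.get .J (v .i) +ₑ .num 1) ;;
      .ite (.get .J (v .i) =ₑ v .l)
        (.store .J (v .i) (.num 0) ;; .i ≔ v .i +ₑ .num 1)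
        (.carry ≔ .num 0)))

/-- `S` is block number `e` of the partition `B` (the empty set if `e` exceeds `l`). -/
def selectBlock (e : Expr) : Cmd :=
  .clear .S ;; forLoop .p (v .k +ₑ .num 1) (.push .S (.get .B (v .p) =ₑ e))

/-- `s := domset(G, T, y, S, D)`, with `x ∈ D` if and only if `d = 1`, for a child `y` of `x`. -/
def recurse (s : Var) (d : ℕ) : Cmd :=
  .store .D (v .k) (.num d) ;;
  .call s [(.x, v .y), (.k, v .k +ₑ .num 1)] [(.P, .S), (.D, .D)]

/-- The work on one child `y` of `x`: compute the cost of dominating its subtree, and enter the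
overhead costs of the blocks into the tables. -/
def processChild : Cmd :=
  .y ≔ .child (v .x) (v .ci) ;;
  selectBlock (v .l +ₑ .num 1) ;;
  recurse .b 0 ;; .base ≔ v .base +ₑ v .b ;;
  recurse .b2 1 ;; .base2 ≔ v .base2 +ₑ v .b2 ;;
  freshLabel ;;
  .row ≔ .num 0 ;;
  forLoop .i (v .l) (
    selectBlock (v .i +ₑ .num 1) ;;
    recurse .c 0 ;; .c ≔ v .c -ₑ v .b ;;
    recurse .c2 1 ;; .c2 ≔ v .c2 -ₑ v .b2 ;;
    insertEntry .cost .label .c ;;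
    insertEntry .cost2 .label2 .c2 ;;
    .row ≔ v .row +ₑ v .l)

/-- The case of a node `x` that is not a leaf. -/
def innerCase : Cmd :=
  .result ≔ .infty ;;
  .push .P (.num 1) ;; .push .D (.num 0) ;;
  firstPartition ;; .more ≔ .num 1 ;;
  .loop (v .more) (
    countBlocks ;;
    initTable .cost .label ;; initTable .cost2 .label2 ;;
    .base ≔ .num 0 ;; .base2 ≔ .num 0 ;;
    forLoop .ci (.deg (v .x)) processChild ;;
    findMinSolution .cost .label ;;
    .ite (v .best +ₑ v .base <ₑ v .result) (.result ≔ v .best +ₑ v .base) .skip ;;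
    findMinSolution .cost2 .label2 ;;
    .ite (v .best +ₑ v .base2 +ₑ .num 1 <ₑ v .result)
      (.result ≔ v .best +ₑ v .base2 +ₑ .num 1) .skip ;;
    nextPartition) ;;
  .ret ≔ v .result

/-- The body of the procedure `domset(G, T, x, P, D)`. -/
def domset : Cmd := .ite (.deg (v .x) =ₑ .num 0) leafCase innerCase

/-- The frame of the call `domset(G, T, r, ∅, ∅)`. -/
noncomputable def initialFrame {n : ℕ} (r : Fin n) : Frame :=
  Frame.empty.setScalar .x (r : ℕ)

end Domset

/-! The mathematical core is a recursion for `domCost I x P D`, the least size of a set of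
descendants of `x` that, together with `D`, dominates the subtree of `x` and the set `P` of proper
ancestors. An optimal set for an inner node splits into its part in `{x}` and its parts in the
subtrees of the children. Edges join only ancestors and descendants, so a vertex below one child is
never dominated from below another child. Every vertex of `insert x P` can be assigned to a child
below which it is dominated (to any child, if `D` or `x` already dominates it). The fibres of this
assignment form a partition whose blocks go to pairwise distinct children, and every other child
pays only its baseline cost. Thus the optimum is a minimum over partitions, over the two decisions
about `x`, and over injective assignments of blocks to children, of the baseline plus the overheads
(`domCost_le_assignment` and `exists_assignment_le_domCost`).

For `l` blocks, the `l` cheapest children of each block suffice. If the child chosen for a block is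
not in its row, then the row is full of children that cost no more, and the other `l - 1` blocks
cannot occupy all of them (`IsTable.exists_exchange`). Labels only have to tell the children in the
current tables apart, so they are bounded by twice the table size.

The space bound rests on `domCost_le_add`: dominating `P` in addition costs at most one more vertex
per element of `P`. Finite overheads are therefore at most `k + 1`, and all array entries have
`O(log t)` bits. A frame holds a bounded number of arrays of length at most `t * t` and a bounded
number of scalars with `O(log n)` bits, and at most `t` frames are active.

For the time, all loops inside one call, except the one over the children, have at most `t ^ O(t)`
iterations, because partitions and choices are enumerated. If `β` is the resulting polynomial in
this number, a call with `d` levels below it takes at most `β ^ (d + 1)` times the size of its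
subtree (`solves_of_isPath`). The subtrees of the children are disjoint, so the size enters only
linearly.

The program is verified in a calculus of total correctness. `RunsIn` carries a time bound and a
postcondition, and bounds the space by one fixed record of `Limits` on the values in a frame. What a
command does not write is tracked syntactically by `Agree`. -/

namespace Domset

variable {n : ℕ}

/-! Frame conditions. -/

/-- Whether a command may write the scalar. -/
def Cmd.writesScalar : Cmd → Var → Bool
  | .assign s _, a => decide (s = a)
  | .call s _ _, a => decide (s = a)
  | .seq c d, a => c.writesScalar a || d.writesScalar a
  | .ite _ c d, a => c.writesScalar a || d.writesScalar a
  | .loop _ c, a => c.writesScalar a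
  | _, _ => false

/-- Whether a command may write the array. -/
def Cmd.writesArray : Cmd → Arr → Bool
  | .clear s, a => decide (s = a)
  | .push s _, a => decide (s = a)
  | .store s _ _, a => decide (s = a)
  | .seq c d, a => c.writesArray a || d.writesArray a
  | .ite _ c d, a => c.writesArray a || d.writesArray a
  | .loop _ c, a => c.writesArray a
  | _, _ => false

namespace Frame

@[simp] theorem setScalar_scalar (σ : Frame) (s s' : Var) (x : ℕ∞) :
    (σ.setScalar s x).scalar s' = if s' = s then x else σ.scalar s' := by
  simp [setScalar, Function.update_apply]

@[simp] theorem setScalar_array (σ : Frame) (s : Var) (x : ℕ∞) :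
    (σ.setScalar s x).array = σ.array := rfl

@[simp] theorem setArray_array (σ : Frame) (a a' : Arr) (x : List ℕ∞) :
    (σ.setArray a x).array a' = if a' = a then x else σ.array a' := by
  simp [setArray, Function.update_apply]

@[simp] theorem setArray_scalar (σ : Frame) (a : Arr) (x : List ℕ∞) :
    (σ.setArray a x).scalar = σ.scalar := rfl

end Frame

/-- The frames agree on everything that the command does not write. -/
structure Agree (c : Cmd) (σ τ : Frame) : Prop where
  scalar : ∀ s, c.writesScalar s = false → τ.scalar s = σ.scalar s
  array : ∀ a, c.writesArray a = false → τ.array a = σ.array a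

theorem Agree.refl (c : Cmd) (σ : Frame) : Agree c σ σ := ⟨fun _ _ => rfl, fun _ _ => rfl⟩

theorem Agree.trans {c : Cmd} {σ τ υ : Frame} (h : Agree c σ τ) (h' : Agree c τ υ) :
    Agree c σ υ :=
  ⟨fun s hs => (h'.scalar s hs).trans (h.scalar s hs),
    fun a ha => (h'.array a ha).trans (h.array a ha)⟩

theorem Agree.mono {c d : Cmd} {σ τ : Frame} (h : Agree c σ τ)
    (hs : ∀ s, d.writesScalar s = false → c.writesScalar s = false)
    (ha : ∀ a, d.writesArray a = false → c.writesArray a = false) : Agree d σ τ :=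
  ⟨fun s h' => h.scalar s (hs s h'), fun a h' => h.array a (ha a h')⟩

/-- A call counts as writing only its result variable, because the callee works in a frame of its
own. Everything else is bookkeeping over the rules of execution. -/
theorem Exec.agree {I : Input n} {body c : Cmd} {σ τ : Frame} {T S : ℕ}
    (h : Exec I body c σ τ T S) : Agree c σ τ := by
  induction h with
  | skip σ => exact .refl _ _
  | assign σ s e =>
    exact ⟨fun s' hs => by
      simp [Cmd.writesScalar] at hs; simp [Ne.symm hs], fun a _ => rfl⟩
  | clear σ a =>
    exact ⟨fun _ _ => rfl, fun a' ha => by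
      simp [Cmd.writesArray] at ha; simp [Ne.symm ha]⟩
  | push σ a e =>
    exact ⟨fun _ _ => rfl, fun a' ha => by
      simp [Cmd.writesArray] at ha; simp [Ne.symm ha]⟩
  | store σ a e f =>
    exact ⟨fun _ _ => rfl, fun a' ha => by
      simp [Cmd.writesArray] at ha; simp [Ne.symm ha]⟩
  | seq _ _ ih ih' =>
    refine Agree.trans (ih.mono ?_ ?_) (ih'.mono ?_ ?_) <;>
      simp +contextual [Cmd.writesScalar, Cmd.writesArray]
  | iteTrue _ _ ih =>
    refine ih.mono ?_ ?_ <;> simp +contextual [Cmd.writesScalar, Cmd.writesArray]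
  | iteFalse _ _ ih =>
    refine ih.mono ?_ ?_ <;> simp +contextual [Cmd.writesScalar, Cmd.writesArray]
  | loopDone _ => exact .refl _ _
  | loopStep _ _ _ ih ih' =>
    refine Agree.trans (ih.mono ?_ ?_) ih' <;>
      simp +contextual [Cmd.writesScalar, Cmd.writesArray]
  | call _ _ =>
    exact ⟨fun s' hs => by
      simp [Cmd.writesScalar] at hs; simp [Ne.symm hs], fun a _ => rfl⟩

/-! Bounds on the values in a frame. -/

/-- A bound on the bits of a frame with scalars at most `N` and arrays of length at most `L` with
entries at most `M`. -/
def frameBits (N M L : ℕ) : ℕ := 34 * (Nat.size N + 2) + 9 * (L * (Nat.size M + 2))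

/-- A bound on the bits of the temporary values of one command. -/
def exprBits (N : ℕ) : ℕ := 24 * (Nat.size (24 * N) + 2)

/-- Bounds `N` on scalars, `M` on entries and `L` on lengths of arrays, `S` on the space, and `K` on
the iterations of a loop. -/
structure Limits (n : ℕ) where
  N : ℕ
  M : ℕ
  L : ℕ
  S : ℕ
  K : ℕ
  n_le : n ≤ N
  M_le : M ≤ N
  L_le : L ≤ N
  two_le : 2 ≤ M
  space : frameBits N M L + exprBits N ≤ S

/-- All values of the frame satisfy the bounds (`∞` always does). -/
structure Frame.Fits (σ : Frame) (Λ : Limits n) : Prop where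
  scalar : ∀ s, (σ.scalar s).toNat ≤ Λ.N
  length : ∀ a, (σ.array a).length ≤ Λ.L
  array : ∀ a, ∀ x ∈ σ.array a, x.toNat ≤ Λ.M

theorem bits_le {x : ℕ∞} {N : ℕ} (h : x.toNat ≤ N) : bits x ≤ Nat.size N + 2 := by
  unfold bits; gcongr; exact Nat.size_le_size h

theorem _root_.List.sum_le_length_mul (L : List ℕ) (b : ℕ) (h : ∀ x ∈ L, x ≤ b) :
    L.sum ≤ L.length * b := by
  simpa using L.sum_le_card_nsmul b h

/-- The factors 34 and 9 in `frameBits` are the numbers of scalar and of array names. -/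
theorem Frame.Fits.bits_le {σ : Frame} {Λ : Limits n} (h : σ.Fits Λ) :
    σ.bits ≤ frameBits Λ.N Λ.M Λ.L := by
  unfold Frame.bits frameBits
  gcongr
  · calc _ ≤ ∑ _s : Var, (Nat.size Λ.N + 2) :=
          Finset.sum_le_sum fun s _ => Domset.bits_le (h.scalar s)
      _ = _ := by rw [Finset.sum_const]; rfl
  · calc _ ≤ ∑ _a : Arr, (Λ.L * (Nat.size Λ.M + 2)) := by
          refine Finset.sum_le_sum fun a _ => ?_
          refine (List.sum_le_length_mul _ (Nat.size Λ.M + 2) ?_).trans ?_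
          · simpa using fun x hx => Domset.bits_le (h.array a x hx)
          · rw [List.length_map]; exact Nat.mul_le_mul_right _ (h.length a)
      _ = _ := by rw [Finset.sum_const]; rfl

theorem Frame.Fits.setScalar {σ : Frame} {Λ : Limits n} (h : σ.Fits Λ) {s : Var} {x : ℕ∞}
    (hx : x.toNat ≤ Λ.N) : (σ.setScalar s x).Fits Λ where
  scalar s' := by rw [setScalar_scalar]; split_ifs; exacts [hx, h.scalar s']
  length := h.length
  array := h.array

theorem Frame.Fits.setArray {σ : Frame} {Λ : Limits n} (h : σ.Fits Λ) {a : Arr} {A : List ℕ∞}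
    (hl : A.length ≤ Λ.L) (hA : ∀ x ∈ A, x.toNat ≤ Λ.M) : (σ.setArray a A).Fits Λ where
  scalar := h.scalar
  length a' := by rw [setArray_array]; split_ifs; exacts [hl, h.length a']
  array a' := by rw [setArray_array]; split_ifs; exacts [hA, h.array a']

theorem Input.degQuery_le (I : Input n) (u : ℕ) : I.degQuery u ≤ n := by
  unfold Input.degQuery
  split_ifs
  · simpa using (I.nodup_children _).length_le_card
  · exact Nat.zero_le _

theorem Input.childQuery_le (I : Input n) (u i : ℕ) : I.childQuery u i ≤ n := by
  unfold Input.childQuery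
  split_ifs
  · simp only [List.getD_eq_getElem?_getD, List.getElem?_map]
    cases (I.children _)[i]? <;> simp [Fin.is_le']
  · exact Nat.zero_le _

theorem Input.parentQuery_le (I : Input n) (u : ℕ) : I.parentQuery u ≤ n := by
  unfold Input.parentQuery
  split_ifs with h
  · cases I.forest.parent ⟨u, h⟩ <;> simp [Fin.is_le']
  · exact Nat.zero_le _

theorem Input.adjQuery_le (I : Input n) (u v : ℕ) : I.adjQuery u v ≤ 1 := by
  unfold Input.adjQuery; split_ifs <;> simp

/-! ### Sizes of the values of expressions. -/

namespace Expr

/-- All numerals are at most `2`. -/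
def small : Expr → Bool
  | num m => m ≤ 2
  | infty | var _ | len _ => true
  | get _ e | deg e | parent e => e.small
  | add e f | sub e f | eq e f | lt e f | child e f | adj e f => e.small && f.small

/-- No sums except inside of comparisons and accesses. -/
def plain : Expr → Bool
  | num m => m ≤ 2
  | infty | var _ | len _ => true
  | get _ _ | deg _ | parent _ => true
  | add _ _ => false
  | sub e _ => e.plain
  | eq _ _ | lt _ _ | child _ _ | adj _ _ => true

theorem one_le_time (e : Expr) : 1 ≤ e.time := by cases e <;> simp [time]

end Expr

theorem _root_.ENat.toNat_add_le (a b : ℕ∞) : (a + b).toNat ≤ a.toNat + b.toNat := by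
  cases a <;> cases b <;> simp
  norm_cast

theorem _root_.ENat.toNat_sub_le (a b : ℕ∞) : (a - b).toNat ≤ a.toNat := by
  cases a <;> cases b <;> simp
  rw [← ENat.natCast_sub, ENat.toNat_natCast]; exact Nat.sub_le _ _

theorem Frame.Fits.getD_le {σ : Frame} {Λ : Limits n} (h : σ.Fits Λ) (a : Arr) (i : ℕ) :
    ((σ.array a).getD i 0).toNat ≤ Λ.M := by
  rw [List.getD_eq_getElem?_getD]
  cases hx : (σ.array a)[i]? with
  | none => simp
  | some x => exact h.array a x (List.mem_of_getElem? hx)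

/-- Truncated subtraction is bounded by its left operand and accesses are bounded by the frame or
the input, so only addition could leave the range. The value `∞` has `toNat` equal to `0` and never
matters. -/
theorem Frame.Fits.eval_le {σ : Frame} {Λ : Limits n} (h : σ.Fits Λ) (I : Input n) (e : Expr)
    (he : e.plain = true) : (e.eval I σ).toNat ≤ Λ.N := by
  have h2 := Λ.two_le.trans Λ.M_le
  induction e with
  | num m => simp [Expr.plain] at he; simp [Expr.eval]; omega
  | infty => simp [Expr.eval]
  | var s => exact h.scalar s
  | get a e _ => exact (h.getD_le a _).trans Λ.M_le
  | len a => simpa [Expr.eval] using (h.length a).trans Λ.L_le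
  | add e f => simp [Expr.plain] at he
  | sub e f ih _ => exact (ENat.toNat_sub_le _ _).trans (ih he)
  | eq e f | lt e f => simp only [Expr.eval]; split_ifs <;> simp <;> omega
  | deg e => simpa [Expr.eval] using (I.degQuery_le _).trans Λ.n_le
  | child e f => simpa [Expr.eval] using (I.childQuery_le _ _).trans Λ.n_le
  | parent e => simpa [Expr.eval] using (I.parentQuery_le _).trans Λ.n_le
  | adj e f => simpa [Expr.eval] using (I.adjQuery_le _ _).trans (by omega)

/-- Bounds add up at sums, and `Expr.time` counts the nodes of the expression. The hypothesis `key`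
settles every expression whose outermost operator is not arithmetic. -/
theorem Frame.Fits.eval_le_time {σ : Frame} {Λ : Limits n} (h : σ.Fits Λ) (I : Input n) (e : Expr)
    (he : e.small = true) : (e.eval I σ).toNat ≤ e.time * Λ.N := by
  have key : e.plain = true → (e.eval I σ).toNat ≤ e.time * Λ.N := fun hp =>
    (h.eval_le I e hp).trans (Nat.le_mul_of_pos_left _ e.one_le_time)
  induction e with
  | add e f ihe ihf =>
    simp only [Expr.small, Bool.and_eq_true] at he
    have h1 := ihe he.1 fun hp => (h.eval_le I e hp).trans
      (Nat.le_mul_of_pos_left _ e.one_le_time)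
    have h2 := ihf he.2 fun hp => (h.eval_le I f hp).trans
      (Nat.le_mul_of_pos_left _ f.one_le_time)
    refine (ENat.toNat_add_le _ _).trans ?_
    simp only [Expr.time]; nlinarith
  | sub e f ihe _ =>
    simp only [Expr.small, Bool.and_eq_true] at he
    have h1 := ihe he.1 fun hp => (h.eval_le I e hp).trans
      (Nat.le_mul_of_pos_left _ e.one_le_time)
    refine (ENat.toNat_sub_le _ _).trans ?_
    simp only [Expr.time]; nlinarith
  | num m => exact key (by simpa [Expr.plain, Expr.small] using he)
  | _ => exact key rfl

theorem Frame.Fits.exprSpace_le {σ : Frame} {Λ : Limits n} (h : σ.Fits Λ) (I : Input n) (e : Expr)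
    (he : e.small = true) (K : ℕ) (hK : e.time ≤ K) :
    e.space I σ ≤ e.time * (Nat.size (K * Λ.N) + 2) := by
  have key : ∀ e' : Expr, e'.small = true → e'.time ≤ K →
      Domset.bits (e'.eval I σ) ≤ Nat.size (K * Λ.N) + 2 := fun e' he' hK' =>
    Domset.bits_le ((h.eval_le_time I e' he').trans (Nat.mul_le_mul_right _ hK'))
  induction e with
  | num | infty | var | len =>
    simp only [Expr.space, Expr.time, one_mul]; exact key _ he hK
  | get a e ih | deg e ih | parent e ih =>
    have h1 := key _ he hK
    have h2 := ih he (by simp only [Expr.time] at hK; omega)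
    simp only [Expr.space, Expr.time, add_mul, one_mul] at *; omega
  | add e f ih ih' | sub e f ih ih' | eq e f ih ih' | lt e f ih ih' | child e f ih ih'
  | adj e f ih ih' =>
    have h1 := key _ he hK
    simp only [Expr.small, Bool.and_eq_true] at he
    have h2 := ih he.1 (by simp only [Expr.time] at hK; omega)
    have h3 := ih' he.2 (by simp only [Expr.time] at hK; omega)
    simp only [Expr.space, Expr.time, add_mul, one_mul] at *; omega

/-- An expression of time at most 24 has at most 24 subexpressions, each with a value of at most `24
* N`. This is what `exprBits` reserves. -/
theorem Frame.Fits.space_le {σ : Frame} {Λ : Limits n} (h : σ.Fits Λ) (I : Input n) (e : Expr)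
    (he : e.small = true) (ht : e.time ≤ 24) : σ.bits + e.space I σ ≤ Λ.S := by
  have h1 := h.bits_le
  have h2 := h.exprSpace_le I e he 24 ht
  have h3 : e.time * (Nat.size (24 * Λ.N) + 2) ≤ 24 * (Nat.size (24 * Λ.N) + 2) :=
    Nat.mul_le_mul_right _ ht
  have h4 := Λ.space
  unfold exprBits at h4; omega

theorem Frame.Fits.space_le₂ {σ : Frame} {Λ : Limits n} (h : σ.Fits Λ) (I : Input n) (e f : Expr)
    (he : e.small = true) (hf : f.small = true) (ht : e.time + f.time ≤ 24) :
    σ.bits + e.space I σ + f.space I σ ≤ Λ.S := by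
  have h1 := h.bits_le
  have h2 := h.exprSpace_le I e he 24 (by omega)
  have h2' := h.exprSpace_le I f hf 24 (by omega)
  have h3 : (e.time + f.time) * (Nat.size (24 * Λ.N) + 2) ≤ 24 * (Nat.size (24 * Λ.N) + 2) :=
    Nat.mul_le_mul_right _ ht
  have h4 := Λ.space
  rw [add_mul] at h3
  unfold exprBits at h4; omega

theorem Frame.Fits.bits_le_S {σ : Frame} {Λ : Limits n} (h : σ.Fits Λ) : σ.bits ≤ Λ.S :=
  h.bits_le.trans ((Nat.le_add_right _ _).trans Λ.space)

/-! Total correctness with a time bound. -/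

/-- Started in `σ`, the command `c` halts after at most `T` steps within the space limit, in a frame
that satisfies the bounds and the postcondition. -/
def RunsIn (I : Input n) (Λ : Limits n) (c : Cmd) (σ : Frame) (T : ℕ) (Q : Frame → Prop) : Prop :=
  ∃ τ T' S', Exec I domset c σ τ T' S' ∧ T' ≤ T ∧ S' ≤ Λ.S ∧ τ.Fits Λ ∧ Q τ

namespace RunsIn

variable {I : Input n} {Λ : Limits n} {σ : Frame} {c d : Cmd} {T T₁ T₂ : ℕ} {Q R : Frame → Prop}

/-- `Fits` and `Agree` are handed over for free, so that postconditions need not repeat what stays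
unchanged. -/
theorem mono (h : RunsIn I Λ c σ T₁ R) (hT : T₁ ≤ T)
    (hQ : ∀ τ, τ.Fits Λ → Agree c σ τ → R τ → Q τ) : RunsIn I Λ c σ T Q := by
  obtain ⟨τ, T', S', h1, h2, h3, h4, h5⟩ := h
  exact ⟨τ, T', S', h1, h2.trans hT, h3, h4, hQ τ h4 h1.agree h5⟩

theorem weaken (h : RunsIn I Λ c σ T₁ Q) (hT : T₁ ≤ T) : RunsIn I Λ c σ T Q :=
  h.mono hT fun _ _ _ h => h

theorem seq (h : RunsIn I Λ c σ T₁ R)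
    (h' : ∀ τ, τ.Fits Λ → Agree c σ τ → R τ → RunsIn I Λ d τ T₂ Q) :
    RunsIn I Λ (.seq c d) σ (T₁ + T₂) Q := by
  obtain ⟨τ, T', S', h1, h2, h3, h4, h5⟩ := h
  obtain ⟨υ, T'', S'', g1, g2, g3, g4, g5⟩ := h' τ h4 h1.agree h5
  exact ⟨υ, _, _, .seq h1 g1, add_le_add h2 g2, max_le h3 g3, g4, g5⟩

theorem skip (hσ : σ.Fits Λ) (h : Q σ) : RunsIn I Λ .skip σ 1 Q :=
  ⟨σ, _, _, .skip σ, le_rfl, hσ.bits_le_S, hσ, h⟩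

theorem assign {s : Var} {e : Expr} {x : ℕ∞} (hσ : σ.Fits Λ)
    (hx : e.eval I σ = x) (hN : x.toNat ≤ Λ.N) (h : Q (σ.setScalar s x))
    (he : e.small = true := by rfl) (ht : e.time ≤ 24 := by exact Nat.le_of_ble_eq_true rfl) :
    RunsIn I Λ (.assign s e) σ (e.time + 1) Q := by
  subst hx
  exact ⟨_, _, _, .assign σ s e, le_rfl,
    max_le (hσ.space_le I e he ht) (hσ.setScalar hN).bits_le_S, hσ.setScalar hN, h⟩

/-- The value of an expression without sums is within the bounds. -/
theorem assign' {s : Var} {e : Expr} {x : ℕ∞} (hσ : σ.Fits Λ)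
    (hx : e.eval I σ = x) (h : Q (σ.setScalar s x)) (hp : e.plain = true := by rfl)
    (he : e.small = true := by rfl) (ht : e.time ≤ 24 := by exact Nat.le_of_ble_eq_true rfl) :
    RunsIn I Λ (.assign s e) σ (e.time + 1) Q :=
  assign hσ hx (hx ▸ hσ.eval_le I e hp) h he ht

/-- The frame after the assignment is passed on literally, so straight-line code is verified by
symbolic evaluation. -/
theorem assign_seq {s : Var} {e : Expr} (x : ℕ∞) (hσ : σ.Fits Λ)
    (hx : e.eval I σ = x) (hN : x.toNat ≤ Λ.N)
    (h : (σ.setScalar s x).Fits Λ → RunsIn I Λ d (σ.setScalar s x) T Q)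
    (he : e.small = true := by rfl) (ht : e.time ≤ 24 := by exact Nat.le_of_ble_eq_true rfl) :
    RunsIn I Λ (.seq (.assign s e) d) σ (e.time + 1 + T) Q :=
  seq (R := fun τ => τ = σ.setScalar s x) (assign hσ hx hN rfl he ht)
    fun τ hτ _ e => by subst e; exact h hτ

theorem assign_seq' {s : Var} {e : Expr} (x : ℕ∞) (hσ : σ.Fits Λ)
    (hx : e.eval I σ = x)
    (h : (σ.setScalar s x).Fits Λ → RunsIn I Λ d (σ.setScalar s x) T Q)
    (hp : e.plain = true := by rfl) (he : e.small = true := by rfl)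
    (ht : e.time ≤ 24 := by exact Nat.le_of_ble_eq_true rfl) :
    RunsIn I Λ (.seq (.assign s e) d) σ (e.time + 1 + T) Q :=
  assign_seq x hσ hx (hx ▸ hσ.eval_le I e hp) h he ht

theorem clear {a : Arr} (hσ : σ.Fits Λ) (h : Q (σ.setArray a [])) :
    RunsIn I Λ (.clear a) σ 1 Q :=
  ⟨_, _, _, .clear σ a, le_rfl, hσ.bits_le_S, hσ.setArray (by simp) (by simp), h⟩

theorem clear_seq {a : Arr} (hσ : σ.Fits Λ)
    (h : (σ.setArray a []).Fits Λ → RunsIn I Λ d (σ.setArray a []) T Q) :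
    RunsIn I Λ (.seq (.clear a) d) σ (1 + T) Q :=
  seq (R := fun τ => τ = σ.setArray a []) (clear hσ rfl)
    fun τ hτ _ e => by subst e; exact h hτ

theorem push {a : Arr} {e : Expr} {A : List ℕ∞} (hσ : σ.Fits Λ)
    (hA : σ.array a ++ [e.eval I σ] = A) (hL : A.length ≤ Λ.L) (hM : (e.eval I σ).toNat ≤ Λ.M)
    (h : Q (σ.setArray a A))
    (he : e.small = true := by rfl) (ht : e.time ≤ 24 := by exact Nat.le_of_ble_eq_true rfl) :
    RunsIn I Λ (.push a e) σ (e.time + 1) Q := by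
  subst hA
  have : (σ.setArray a (σ.array a ++ [e.eval I σ])).Fits Λ := hσ.setArray hL fun x hx => by
    rcases List.mem_append.1 hx with hx | hx
    · exact hσ.array a x hx
    · rw [List.mem_singleton.1 hx]; exact hM
  exact ⟨_, _, _, .push σ a e, le_rfl, max_le (hσ.space_le I e he ht) this.bits_le_S, this, h⟩

theorem push_seq {a : Arr} {e : Expr} (A : List ℕ∞) (hσ : σ.Fits Λ)
    (hA : σ.array a ++ [e.eval I σ] = A) (hL : A.length ≤ Λ.L) (hM : (e.eval I σ).toNat ≤ Λ.M)
    (h : (σ.setArray a A).Fits Λ → RunsIn I Λ d (σ.setArray a A) T Q)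
    (he : e.small = true := by rfl) (ht : e.time ≤ 24 := by exact Nat.le_of_ble_eq_true rfl) :
    RunsIn I Λ (.seq (.push a e) d) σ (e.time + 1 + T) Q :=
  seq (R := fun τ => τ = σ.setArray a A) (push hσ hA hL hM rfl he ht)
    fun τ hτ _ e => by subst e; exact h hτ

theorem store {a : Arr} {e f : Expr} {A : List ℕ∞} (hσ : σ.Fits Λ)
    (hA : (σ.array a).set (e.eval I σ).toNat (f.eval I σ) = A) (hM : (f.eval I σ).toNat ≤ Λ.M)
    (h : Q (σ.setArray a A)) (he : e.small = true := by rfl) (hf : f.small = true := by rfl)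
    (ht : e.time + f.time ≤ 24 := by exact Nat.le_of_ble_eq_true rfl) :
    RunsIn I Λ (.store a e f) σ (e.time + f.time + 1) Q := by
  subst hA
  have : (σ.setArray a ((σ.array a).set (e.eval I σ).toNat (f.eval I σ))).Fits Λ :=
    hσ.setArray (by simpa using hσ.length a) fun x hx => by
      rcases List.mem_or_eq_of_mem_set hx with hx | hx
      · exact hσ.array a x hx
      · rw [hx]; exact hM
  exact ⟨_, _, _, .store σ a e f, le_rfl, max_le (hσ.space_le₂ I e f he hf ht) this.bits_le_S,
    this, h⟩

theorem store_seq {a : Arr} {e f : Expr} (A : List ℕ∞) (hσ : σ.Fits Λ)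
    (hA : (σ.array a).set (e.eval I σ).toNat (f.eval I σ) = A) (hM : (f.eval I σ).toNat ≤ Λ.M)
    (h : (σ.setArray a A).Fits Λ → RunsIn I Λ d (σ.setArray a A) T Q)
    (he : e.small = true := by rfl) (hf : f.small = true := by rfl)
    (ht : e.time + f.time ≤ 24 := by exact Nat.le_of_ble_eq_true rfl) :
    RunsIn I Λ (.seq (.store a e f) d) σ (e.time + f.time + 1 + T) Q :=
  seq (R := fun τ => τ = σ.setArray a A) (store hσ hA hM rfl he hf ht)
    fun τ hτ _ e => by subst e; exact h hτ

theorem ite {e : Expr} (p : Prop) (hσ : σ.Fits Λ) (hp : e.eval I σ ≠ 0 ↔ p)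
    (h₁ : p → RunsIn I Λ c σ T₁ Q) (h₂ : ¬ p → RunsIn I Λ d σ T₂ Q)
    (he : e.small = true := by rfl) (ht : e.time ≤ 24 := by exact Nat.le_of_ble_eq_true rfl) :
    RunsIn I Λ (.ite e c d) σ (e.time + 1 + max T₁ T₂) Q := by
  by_cases h : p
  · obtain ⟨τ, T', S', h1, h2, h3, h4, h5⟩ := h₁ h
    exact ⟨τ, _, _, .iteTrue (hp.2 h) h1, by omega, max_le (hσ.space_le I e he ht) h3, h4, h5⟩
  · obtain ⟨τ, T', S', h1, h2, h3, h4, h5⟩ := h₂ h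
    exact ⟨τ, _, _, .iteFalse (not_not.1 (mt hp.1 h)) h1, by omega,
      max_le (hσ.space_le I e he ht) h3, h4, h5⟩

/-- The index `m` of the invariant is the variant. It has to decrease but may jump, which covers
early exits, and it bounds the number of remaining iterations. -/
theorem loop {e : Expr} (Inv : ℕ → Frame → Prop) (m : ℕ) (hσ : σ.Fits Λ) (h0 : Inv m σ)
    (step : ∀ m τ, τ.Fits Λ → Agree c σ τ → Inv m τ →
      (e.eval I τ = 0 ∧ Q τ) ∨
        (e.eval I τ ≠ 0 ∧ RunsIn I Λ c τ T (fun τ' => ∃ m' < m, Inv m' τ')))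
    (he : e.small = true := by rfl) (ht : e.time ≤ 24 := by exact Nat.le_of_ble_eq_true rfl) :
    RunsIn I Λ (.loop e c) σ ((m + 1) * (e.time + 1 + T)) Q := by
  suffices H : ∀ m τ, τ.Fits Λ → Agree c σ τ → Inv m τ →
      RunsIn I Λ (.loop e c) τ ((m + 1) * (e.time + 1 + T)) Q from H m σ hσ (.refl _ _) h0
  intro m
  induction m using Nat.strong_induction_on with
  | _ m ih =>
    intro τ hτ hag hinv
    rcases step m τ hτ hag hinv with ⟨h1, h2⟩ | ⟨h1, τ', T', S', g1, g2, g3, g4, m', hm, hi⟩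
    · exact ⟨τ, _, _, .loopDone h1, by nlinarith, hτ.space_le I e he ht, hτ, h2⟩
    · obtain ⟨υ, T'', S'', k1, k2, k3, k4, k5⟩ := ih m' hm τ' g4 (hag.trans g1.agree) hi
      refine ⟨υ, _, _, .loopStep h1 g1 k1, ?_,
        max_le (hτ.space_le I e he ht) (max_le g3 k3), k4, k5⟩
      have : (m' + 1 + 1) * (e.time + 1 + T) ≤ (m + 1) * (e.time + 1 + T) :=
        Nat.mul_le_mul_right _ (by omega)
      nlinarith

/-- The time `Tb i` of an iteration may depend on `i`. The loop over the children needs this: their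
times have to be summed, since a uniform bound would lose the linear dependence on the size of the
subtree. -/
theorem forLoop {s : Var} {e : Expr} (m : ℕ) (Inv : ℕ → Frame → Prop) (Tb : ℕ → ℕ)
    (hσ : σ.Fits Λ) (hm : m ≤ Λ.N)
    (hm' : ∀ τ, τ.Fits Λ → Agree (Domset.forLoop s e c) σ τ → e.eval I τ = m)
    (h0 : Inv 0 (σ.setScalar s 0))
    (step : ∀ i < m, ∀ τ, τ.Fits Λ → Agree (Domset.forLoop s e c) σ τ → τ.scalar s = (i : ℕ) →
      Inv i τ → RunsIn I Λ c τ (Tb i) (fun τ' => Inv (i + 1) (τ'.setScalar s ((i + 1 : ℕ) : ℕ∞))))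
    (hs : c.writesScalar s = false := by rfl) (he : e.small = true := by rfl)
    (ht : e.time ≤ 20 := by exact Nat.le_of_ble_eq_true rfl) :
    RunsIn I Λ (Domset.forLoop s e c) σ
      (e.time + 5 + ∑ i ∈ Finset.range m, (Tb i + (e.time + 7)))
      (fun τ => τ.scalar s = (m : ℕ) ∧ Inv m τ) := by
  have hag : ∀ τ υ, Agree c τ υ → Agree (Domset.forLoop s e c) τ υ := fun τ υ h => by
    refine h.mono ?_ ?_ <;> intro <;>
      simp +contextual [Domset.forLoop, Cmd.writesScalar, Cmd.writesArray]
  have hset : ∀ τ x, Agree (Domset.forLoop s e c) τ (τ.setScalar s x) := fun τ x =>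
    ⟨fun a ha => by
      simp [Domset.forLoop, Cmd.writesScalar] at ha
      simp [Ne.symm ha.1], fun _ _ => rfl⟩
  have hts : (Expr.lt (v s) e).time = e.time + 2 := by simp [Expr.time, v]; omega
  have hsm : (Expr.lt (v s) e).small = true := by simpa [Expr.small, v] using he
  -- Induction on the number `r` of iterations left. Besides the body, an iteration costs `e.time +
  -- 3` for the test and `4` for the increment.
  suffices H : ∀ r i, i + r = m → ∀ τ, τ.Fits Λ → Agree (Domset.forLoop s e c) σ τ →
      τ.scalar s = (i : ℕ) → Inv i τ →
      RunsIn I Λ (.loop (.lt (v s) e) (.seq c (.assign s (.add (v s) (.num 1))))) τ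
        (e.time + 3 + ∑ j ∈ Finset.Ico i m, (Tb j + (e.time + 7)))
        (fun τ => τ.scalar s = (m : ℕ) ∧ Inv m τ) by
    refine (assign_seq' (0 : ℕ) hσ (by simp [Expr.eval])
      fun h => H m 0 (by simp) _ h (hset _ _) (by simp) h0).weaken ?_
    simp [Expr.time]; omega
  intro r
  induction r with
  | zero =>
    intro i hi τ hτ hst his hinv
    obtain rfl : i = m := by omega
    refine ⟨τ, _, _, .loopDone ?_, ?_, hτ.space_le I _ hsm (by omega), hτ, his, hinv⟩
    · simp [Expr.eval, v, his, hm' τ hτ hst]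
    · rw [hts]; omega
  | succ r ih =>
    intro i hi τ hτ hst his hinv
    obtain ⟨τ', T', S', g1, g2, g3, g4, g5⟩ := step i (by omega) τ hτ hst his hinv
    have his' : τ'.scalar s = (i : ℕ) := (g1.agree.scalar s hs).trans his
    have hNi : ((i + 1 : ℕ) : ℕ∞).toNat ≤ Λ.N := by rw [ENat.toNat_natCast]; omega
    have hev : (Expr.add (v s) (.num 1)).eval I τ' = ((i + 1 : ℕ) : ℕ∞) := by
      simp [Expr.eval, v, his']
    have hfit := g4.setScalar (s := s) hNi
    obtain ⟨υ, T'', S'', k1, k2, k3, k4, k5⟩ := ih (i + 1) (by omega) _ hfit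
      ((hst.trans (hag _ _ g1.agree)).trans (hset _ _)) (by simp) g5
    have hasg := Exec.assign (I := I) (body := domset) τ' s (Expr.add (v s) (.num 1))
    rw [hev] at hasg
    refine ⟨υ, _, _, .loopStep ?_ (.seq g1 hasg) k1, ?_, ?_, k4, k5⟩
    · simp [Expr.eval, v, his, hm' τ hτ hst]; omega
    · rw [hts, Finset.sum_eq_sum_Ico_succ_bot (by omega : i < m)]
      simp [Expr.time, v]; omega
    · exact max_le (hτ.space_le I _ hsm (by omega)) (max_le (max_le g3 (max_le
        (g4.space_le I _ rfl (by simp [Expr.time, v])) hfit.bits_le_S)) k3)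

end RunsIn

/-- A bound on the time of a command whose loops have at most `K` iterations and whose calls take
time at most `κ`. -/
def Cmd.cost (K κ : ℕ) : Cmd → ℕ
  | .skip | .clear _ => 1
  | .assign _ e | .push _ e => e.time + 1
  | .store _ e f => e.time + f.time + 1
  | .seq c d => c.cost K κ + d.cost K κ
  | .ite e c d => e.time + 1 + max (c.cost K κ) (d.cost K κ)
  | .loop e c => (K + 1) * (e.time + 1 + c.cost K κ)
  | .call _ _ _ => κ

/-- Total correctness with the time bound `Cmd.cost`. -/
def Runs (I : Input n) (Λ : Limits n) (κ : ℕ) (c : Cmd) (σ : Frame) (Q : Frame → Prop) : Prop :=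
  RunsIn I Λ c σ (c.cost Λ.K κ) Q

namespace Runs

variable {I : Input n} {Λ : Limits n} {σ : Frame} {c d : Cmd} {κ : ℕ} {Q R : Frame → Prop}

theorem mono (h : Runs I Λ κ c σ R) (hQ : ∀ τ, τ.Fits Λ → Agree c σ τ → R τ → Q τ) :
    Runs I Λ κ c σ Q :=
  RunsIn.mono h le_rfl hQ

theorem seq (h : Runs I Λ κ c σ R)
    (h' : ∀ τ, τ.Fits Λ → Agree c σ τ → R τ → Runs I Λ κ d τ Q) :
    Runs I Λ κ (.seq c d) σ Q :=
  RunsIn.seq h h'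

theorem skip (hσ : σ.Fits Λ) (h : Q σ) : Runs I Λ κ .skip σ Q := RunsIn.skip hσ h

theorem assign {s : Var} {e : Expr} {x : ℕ∞} (hσ : σ.Fits Λ)
    (hx : e.eval I σ = x) (hN : x.toNat ≤ Λ.N) (h : Q (σ.setScalar s x))
    (he : e.small = true := by rfl) (ht : e.time ≤ 24 := by exact Nat.le_of_ble_eq_true rfl) :
    Runs I Λ κ (.assign s e) σ Q :=
  RunsIn.assign hσ hx hN h he ht

theorem assign' {s : Var} {e : Expr} {x : ℕ∞} (hσ : σ.Fits Λ)
    (hx : e.eval I σ = x) (h : Q (σ.setScalar s x)) (hp : e.plain = true := by rfl)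
    (he : e.small = true := by rfl) (ht : e.time ≤ 24 := by exact Nat.le_of_ble_eq_true rfl) :
    Runs I Λ κ (.assign s e) σ Q :=
  RunsIn.assign' hσ hx h hp he ht

theorem assign_seq {s : Var} {e : Expr} (x : ℕ∞) (hσ : σ.Fits Λ)
    (hx : e.eval I σ = x) (hN : x.toNat ≤ Λ.N)
    (h : (σ.setScalar s x).Fits Λ → Runs I Λ κ d (σ.setScalar s x) Q)
    (he : e.small = true := by rfl) (ht : e.time ≤ 24 := by exact Nat.le_of_ble_eq_true rfl) :
    Runs I Λ κ (.seq (.assign s e) d) σ Q :=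
  RunsIn.assign_seq x hσ hx hN h he ht

theorem assign_seq' {s : Var} {e : Expr} (x : ℕ∞) (hσ : σ.Fits Λ)
    (hx : e.eval I σ = x)
    (h : (σ.setScalar s x).Fits Λ → Runs I Λ κ d (σ.setScalar s x) Q)
    (hp : e.plain = true := by rfl) (he : e.small = true := by rfl)
    (ht : e.time ≤ 24 := by exact Nat.le_of_ble_eq_true rfl) :
    Runs I Λ κ (.seq (.assign s e) d) σ Q :=
  RunsIn.assign_seq' x hσ hx h hp he ht

theorem clear_seq {a : Arr} (hσ : σ.Fits Λ)
    (h : (σ.setArray a []).Fits Λ → Runs I Λ κ d (σ.setArray a []) Q) :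
    Runs I Λ κ (.seq (.clear a) d) σ Q :=
  RunsIn.clear_seq hσ h

theorem push {a : Arr} {e : Expr} {A : List ℕ∞} (hσ : σ.Fits Λ)
    (hA : σ.array a ++ [e.eval I σ] = A) (hL : A.length ≤ Λ.L) (hM : (e.eval I σ).toNat ≤ Λ.M)
    (h : Q (σ.setArray a A))
    (he : e.small = true := by rfl) (ht : e.time ≤ 24 := by exact Nat.le_of_ble_eq_true rfl) :
    Runs I Λ κ (.push a e) σ Q :=
  RunsIn.push hσ hA hL hM h he ht

theorem push_seq {a : Arr} {e : Expr} (A : List ℕ∞) (hσ : σ.Fits Λ)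
    (hA : σ.array a ++ [e.eval I σ] = A) (hL : A.length ≤ Λ.L) (hM : (e.eval I σ).toNat ≤ Λ.M)
    (h : (σ.setArray a A).Fits Λ → Runs I Λ κ d (σ.setArray a A) Q)
    (he : e.small = true := by rfl) (ht : e.time ≤ 24 := by exact Nat.le_of_ble_eq_true rfl) :
    Runs I Λ κ (.seq (.push a e) d) σ Q :=
  RunsIn.push_seq A hσ hA hL hM h he ht

theorem store {a : Arr} {e f : Expr} {A : List ℕ∞} (hσ : σ.Fits Λ)
    (hA : (σ.array a).set (e.eval I σ).toNat (f.eval I σ) = A) (hM : (f.eval I σ).toNat ≤ Λ.M)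
    (h : Q (σ.setArray a A)) (he : e.small = true := by rfl) (hf : f.small = true := by rfl)
    (ht : e.time + f.time ≤ 24 := by exact Nat.le_of_ble_eq_true rfl) :
    Runs I Λ κ (.store a e f) σ Q :=
  RunsIn.store hσ hA hM h he hf ht

theorem store_seq {a : Arr} {e f : Expr} (A : List ℕ∞) (hσ : σ.Fits Λ)
    (hA : (σ.array a).set (e.eval I σ).toNat (f.eval I σ) = A) (hM : (f.eval I σ).toNat ≤ Λ.M)
    (h : (σ.setArray a A).Fits Λ → Runs I Λ κ d (σ.setArray a A) Q)
    (he : e.small = true := by rfl) (hf : f.small = true := by rfl)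
    (ht : e.time + f.time ≤ 24 := by exact Nat.le_of_ble_eq_true rfl) :
    Runs I Λ κ (.seq (.store a e f) d) σ Q :=
  RunsIn.store_seq A hσ hA hM h he hf ht

theorem ite {e : Expr} (p : Prop) (hσ : σ.Fits Λ) (hp : e.eval I σ ≠ 0 ↔ p)
    (h₁ : p → Runs I Λ κ c σ Q) (h₂ : ¬ p → Runs I Λ κ d σ Q)
    (he : e.small = true := by rfl) (ht : e.time ≤ 24 := by exact Nat.le_of_ble_eq_true rfl) :
    Runs I Λ κ (.ite e c d) σ Q :=
  RunsIn.ite p hσ hp h₁ h₂ he ht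

theorem loop {e : Expr} (Inv : ℕ → Frame → Prop) (m : ℕ) (hm : m ≤ Λ.K) (hσ : σ.Fits Λ)
    (h0 : Inv m σ)
    (step : ∀ m τ, τ.Fits Λ → Agree c σ τ → Inv m τ →
      (e.eval I τ = 0 ∧ Q τ) ∨
        (e.eval I τ ≠ 0 ∧ Runs I Λ κ c τ (fun τ' => ∃ m' < m, Inv m' τ')))
    (he : e.small = true := by rfl) (ht : e.time ≤ 24 := by exact Nat.le_of_ble_eq_true rfl) :
    Runs I Λ κ (.loop e c) σ Q :=
  (RunsIn.loop Inv m hσ h0 step he ht).weaken (Nat.mul_le_mul_right _ (by omega))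

theorem forLoop {s : Var} {e : Expr} (m : ℕ) (Inv : ℕ → Frame → Prop)
    (hσ : σ.Fits Λ) (hm : m ≤ Λ.N) (hK : m ≤ Λ.K)
    (hm' : ∀ τ, τ.Fits Λ → Agree (Domset.forLoop s e c) σ τ → e.eval I τ = m)
    (h0 : Inv 0 (σ.setScalar s 0))
    (step : ∀ i < m, ∀ τ, τ.Fits Λ → Agree (Domset.forLoop s e c) σ τ → τ.scalar s = (i : ℕ) →
      Inv i τ → Runs I Λ κ c τ (fun τ' => Inv (i + 1) (τ'.setScalar s ((i + 1 : ℕ) : ℕ∞))))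
    (hs : c.writesScalar s = false := by rfl) (he : e.small = true := by rfl)
    (ht : e.time ≤ 20 := by exact Nat.le_of_ble_eq_true rfl) :
    Runs I Λ κ (Domset.forLoop s e c) σ (fun τ => τ.scalar s = (m : ℕ) ∧ Inv m τ) := by
  refine (RunsIn.forLoop m Inv (fun _ => c.cost Λ.K κ) hσ hm hm' h0 step hs he ht).weaken ?_
  simp only [Domset.forLoop, Cmd.cost, Expr.time, v, Finset.sum_const, Finset.card_range,
    smul_eq_mul]
  have : m * (c.cost Λ.K κ + (e.time + 7)) ≤ Λ.K * (c.cost Λ.K κ + (e.time + 7)) :=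
    Nat.mul_le_mul_right _ hK
  nlinarith

end Runs

@[simp] theorem eval_v (I : Input n) (σ : Frame) (s : Var) : (v s).eval I σ = σ.scalar s := rfl

@[simp] theorem time_v (s : Var) : (v s).time = 1 := rfl

end Domset

namespace Domset

variable {n : ℕ}

/-! Arrays given by functions. -/

/-- The array of length `m` with the entries `f 0, …, f (m - 1)`. -/
def arr (m : ℕ) (f : ℕ → ℕ∞) : List ℕ∞ := (List.range m).map f

@[simp] theorem length_arr (m : ℕ) (f : ℕ → ℕ∞) : (arr m f).length = m := by simp [arr]

@[simp] theorem arr_zero (f : ℕ → ℕ∞) : arr 0 f = [] := rfl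

theorem arr_succ (m : ℕ) (f : ℕ → ℕ∞) : arr (m + 1) f = arr m f ++ [f m] := by
  simp [arr, List.range_succ]

theorem arr_congr {m : ℕ} {f g : ℕ → ℕ∞} (h : ∀ i < m, f i = g i) : arr m f = arr m g :=
  List.map_congr_left fun i hi => h i (List.mem_range.1 hi)

theorem getD_arr {m i : ℕ} (f : ℕ → ℕ∞) (h : i < m) : (arr m f).getD i 0 = f i := by
  simp [arr, h]

theorem set_arr (m i : ℕ) (f : ℕ → ℕ∞) (x : ℕ∞) :
    (arr m f).set i x = arr m (Function.update f i x) := by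
  refine List.ext_getElem (by simp) fun j h h' => ?_
  rw [List.getElem_set]
  simp only [arr, List.getElem_map, List.getElem_range, Function.update_apply]
  split_ifs with h1 h2 h2 <;> first | rfl | omega

theorem eq_arr {A : List ℕ∞} {m : ℕ} (h : A.length = m) : A = arr m fun i => A.getD i 0 := by
  subst h
  refine List.ext_getElem (by simp) fun j h h' => ?_
  simp [arr, h]

open Classical in
/-- The value of a comparison. -/
noncomputable def ind (p : Prop) : ℕ∞ := if p then 1 else 0

theorem ind_true {p : Prop} (h : p) : ind p = 1 := if_pos h

theorem ind_false {p : Prop} (h : ¬ p) : ind p = 0 := if_neg h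

theorem ind_ne_zero {p : Prop} : ind p ≠ 0 ↔ p := by
  unfold ind; split_ifs with h <;> simp [h]

theorem toNat_ind (p : Prop) : (ind p).toNat ≤ 1 := by
  unfold ind; split_ifs <;> simp

/-! Paths from the root, and the test for domination. -/

/-- The nodes `π 0, …, π k` form the path from a root to `x`. -/
structure IsPath (I : Input n) (x : Fin n) (k : ℕ) (π : ℕ → Fin n) : Prop where
  last : π k = x
  step : ∀ p < k, I.forest.parent (π (p + 1)) = some (π p)
  root : I.forest.parent (π 0) = none

theorem Input.parentQuery_eq (I : Input n) {u w : Fin n} (h : I.forest.parent u = some w) :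
    I.parentQuery u = w := by
  simp [Input.parentQuery, h]

theorem Input.adjQuery_eq (I : Input n) (u w : Fin n) :
    (I.adjQuery u w : ℕ∞) = ind (I.graph.Adj u w) := by
  simp only [Input.adjQuery, ind]
  by_cases h : I.graph.Adj u w <;> simp [h]

/-- The node at position `p` is dominated by the nodes at the positions in `D`. -/
def DominatedAt (I : Input n) (k : ℕ) (π : ℕ → Fin n) (D : ℕ → Prop) (p : ℕ) : Prop :=
  ∃ q ≤ k, D q ∧ (π p = π q ∨ I.graph.Adj (π p) (π q))

variable {I : Input n} {Λ : Limits n} {σ : Frame} {κ : ℕ}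

/-- Both loops walk from `x` up to the root, and their invariants say that exactly the positions
from `m` (respectively `j`) on have been examined. -/
theorem runs_checkDominated {x : Fin n} {k : ℕ} {π : ℕ → Fin n} {P D : ℕ → Prop}
    (hπ : IsPath I x k π) (hσ : σ.Fits Λ) (hx : σ.scalar .x = (x : ℕ)) (hk : σ.scalar .k = k)
    (hP : σ.array .P = arr (k + 1) fun p => ind (P p))
    (hD : σ.array .D = arr (k + 1) fun p => ind (D p)) (hN : k + 1 ≤ Λ.N) (hK : k + 1 ≤ Λ.K) :
    Runs I Λ κ checkDominated σ fun τ =>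
      τ.scalar .ok = ind (∀ p ≤ k, P p → DominatedAt I k π D p) := by
  unfold checkDominated
  refine Runs.assign_seq' 1 hσ rfl fun hσ => ?_
  refine Runs.assign_seq' (x : ℕ) hσ (by simp [hx]) fun hσ => ?_
  refine Runs.assign_seq ((k + 1 : ℕ) : ℕ∞) hσ (by simp [Expr.eval, hk])
    (by rwa [ENat.toNat_natCast])
    fun hσ => ?_
  -- The next position to examine is `m - 1`. The clause on `u` is guarded because after the root
  -- the parent query returns a meaningless default.
  refine Runs.loop (fun m τ => m ≤ k + 1 ∧ τ.scalar .p = m ∧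
    (0 < m → τ.scalar .u = (π (m - 1) : ℕ)) ∧
    τ.scalar .ok = ind (∀ p, m ≤ p → p ≤ k → P p → DominatedAt I k π D p)) (k + 1) hK hσ ?_ ?_
  · refine ⟨le_rfl, by simp, by simp [hπ.last], ?_⟩
    rw [ind_true]
    · simp
    · intro p h1 h2; omega
  · rintro m τ hτ hag ⟨hm, hp, hu, hok⟩
    have hxτ : τ.scalar .x = (x : ℕ) := by rw [hag.scalar _ rfl]; simpa using hx
    have hkτ : τ.scalar .k = k := by rw [hag.scalar _ rfl]; simpa using hk
    have hPτ : τ.array .P = _ := (hag.array _ rfl).trans hP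
    have hDτ : τ.array .D = _ := (hag.array _ rfl).trans hD
    rcases Nat.eq_zero_or_pos m with rfl | hm0
    · left
      refine ⟨by simp [Expr.eval, hp], ?_⟩
      simpa using hok
    · right
      obtain ⟨m, rfl⟩ : ∃ m', m = m' + 1 := ⟨m - 1, by omega⟩
      replace hu := hu hm0
      simp only [Nat.add_sub_cancel] at hu
      refine ⟨by simp [Expr.eval, hp], ?_⟩
      refine Runs.assign_seq' (m : ℕ) hτ ?_ fun hτ' => ?_
      · simp only [Expr.eval, eval_v, hp]
        rw [← Nat.cast_one, ← ENat.natCast_sub]; simp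
      refine Runs.seq (R := fun τ' => τ'.scalar .ok =
        ind (∀ p, m ≤ p → p ≤ k → P p → DominatedAt I k π D p)) (Runs.ite (P m) hτ' ?_ ?_ ?_) ?_
      · simp only [Expr.eval, eval_v, Frame.setScalar_array, hPτ, Frame.setScalar_scalar, if_true,
          ENat.toNat_natCast]
        rw [getD_arr _ (by omega), ind_ne_zero]
      · intro hPm
        refine Runs.assign_seq' 0 hτ' rfl fun hτ' => ?_
        refine Runs.assign_seq' (x : ℕ) hτ' (by simp [hxτ]) fun hτ' => ?_
        refine Runs.assign_seq ((k + 1 : ℕ) : ℕ∞) hτ' (by simp [Expr.eval, hkτ])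
          (by rwa [ENat.toNat_natCast]) fun hτ' => ?_
        refine Runs.seq (R := fun υ => υ.scalar .dom = ind (DominatedAt I k π D m)) ?_ ?_
        · refine Runs.loop (fun j υ => j ≤ k + 1 ∧ υ.scalar .q = j ∧
            (0 < j → υ.scalar .w = (π (j - 1) : ℕ)) ∧
            υ.scalar .dom = ind (∃ q, j ≤ q ∧ q ≤ k ∧ D q ∧
              (π m = π q ∨ I.graph.Adj (π m) (π q)))) (k + 1) hK hτ' ?_ ?_
          · refine ⟨le_rfl, by simp, by simp [hπ.last], ?_⟩
            rw [ind_false]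
            · simp
            · rintro ⟨q, h1, h2, -⟩; omega
          · rintro j υ hυ hag' ⟨hj, hq, hw, hdom⟩
            have hDυ : υ.array .D = _ := (hag'.array _ rfl).trans hDτ
            have huυ : υ.scalar .u = (π m : ℕ) := by rw [hag'.scalar _ rfl]; simpa using hu
            rcases Nat.eq_zero_or_pos j with rfl | hj0
            · left
              refine ⟨by simp [Expr.eval, hq], ?_⟩
              simpa [DominatedAt] using hdom
            · right
              obtain ⟨j, rfl⟩ : ∃ j', j = j' + 1 := ⟨j - 1, by omega⟩
              replace hw := hw hj0
              simp only [Nat.add_sub_cancel] at hw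
              refine ⟨by simp [Expr.eval, hq], ?_⟩
              refine Runs.assign_seq' (j : ℕ) hυ ?_ fun hυ' => ?_
              · simp only [Expr.eval, eval_v, hq]
                rw [← Nat.cast_one, ← ENat.natCast_sub]; simp
              have hsplit : (∃ q, j ≤ q ∧ q ≤ k ∧ D q ∧ (π m = π q ∨ I.graph.Adj (π m) (π q))) ↔
                  (D j ∧ (π m = π j ∨ I.graph.Adj (π m) (π j))) ∨ ∃ q, j + 1 ≤ q ∧ q ≤ k ∧ D q ∧
                    (π m = π q ∨ I.graph.Adj (π m) (π q)) := by
                constructor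
                · rintro ⟨q, h1, h2, h3⟩
                  rcases h1.eq_or_lt with rfl | h1
                  · exact .inl h3
                  · exact .inr ⟨q, h1, h2, h3⟩
                · rintro (h | ⟨q, h1, h2, h3⟩)
                  · exact ⟨j, le_rfl, by omega, h⟩
                  · exact ⟨q, by omega, h2, h3⟩
              refine Runs.seq (R := fun τ' => τ'.scalar .dom = ind (∃ q, j ≤ q ∧ q ≤ k ∧ D q ∧
                (π m = π q ∨ I.graph.Adj (π m) (π q)))) (Runs.ite (D j) hυ' ?_ ?_ ?_) ?_
              · simp only [Expr.eval, eval_v, Frame.setScalar_array, hDυ, Frame.setScalar_scalar,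
                  if_true, ENat.toNat_natCast]
                rw [getD_arr _ (by omega), ind_ne_zero]
              · intro hDj
                simp only [hDj, true_and] at hsplit
                refine Runs.seq (R := fun τ' => τ'.scalar .dom = ind (π m = π j ∨
                  ∃ q, j + 1 ≤ q ∧ q ≤ k ∧ D q ∧ (π m = π q ∨ I.graph.Adj (π m) (π q))))
                  (Runs.ite (π m = π j) hυ' ?_ ?_ ?_) ?_
                · simp [Expr.eval, huυ, hw, Fin.val_inj]
                · intro h
                  refine Runs.assign' hυ' (x := 1) rfl ?_
                  simp [h, ind_true]
                · intro h
                  refine Runs.skip hυ' ?_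
                  simp [h, hdom]
                · intro ω hω hag'' hR
                  refine Runs.ite (I.graph.Adj (π m) (π j)) hω ?_ ?_ ?_
                  · have h1 := hag''.scalar .u rfl
                    have h2 := hag''.scalar .w rfl
                    simp only [Frame.setScalar_scalar, reduceCtorEq, if_false] at h1 h2
                    simp only [Expr.eval, eval_v, h1, h2, huυ, hw, ENat.toNat_natCast]
                    rw [Input.adjQuery_eq, ind_ne_zero]
                  · intro h
                    refine Runs.assign' hω (x := 1) rfl ?_
                    rw [hsplit, ind_true (.inl (.inr h))]; simp
                  · intro h
                    refine Runs.skip hω ?_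
                    rw [hsplit, hR]; simp [h]
              · intro h
                refine Runs.skip hυ' ?_
                rw [hsplit]; simp [h, hdom]
              · intro ω hω hag'' hR
                refine Runs.assign' (x := (I.parentQuery (π j) : ℕ)) hω ?_ ?_
                · have h2 := hag''.scalar .w rfl
                  simp only [Frame.setScalar_scalar, reduceCtorEq, if_false] at h2
                  simp [Expr.eval, h2, hw]
                · have h2 := hag''.scalar .q rfl
                  refine ⟨j, by omega, by omega, by simpa using h2, fun h0 => ?_, by simpa using hR⟩
                  obtain ⟨j, rfl⟩ : ∃ j', j = j' + 1 := ⟨j - 1, by omega⟩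
                  simp [I.parentQuery_eq (hπ.step j (by omega))]
        · intro υ hυ hag' hR
          have h1 := hag'.scalar .ok rfl
          simp only [Frame.setScalar_scalar, reduceCtorEq, if_false] at h1
          refine Runs.ite (DominatedAt I k π D m) hυ (by simp [hR, ind_ne_zero]) ?_ ?_
          · intro h
            refine Runs.skip hυ ?_
            rw [h1, hok]
            congr 1
            refine propext ⟨fun H p hp => ?_, fun H p hp => H p (by omega)⟩
            rcases hp.eq_or_lt with rfl | hp
            · exact fun _ _ => h
            · exact H p hp
          · intro h
            refine Runs.assign' hυ (x := 0) rfl ?_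
            rw [ind_false]
            · simp
            · exact fun H => h (H m le_rfl (by omega) hPm)
      · intro hPm
        refine Runs.skip hτ' ?_
        simp only [Frame.setScalar_scalar, reduceCtorEq, if_false]
        rw [hok]
        congr 1
        refine propext ⟨fun H p hp => ?_, fun H p hp => H p (by omega)⟩
        rcases hp.eq_or_lt with rfl | hp
        · exact fun _ h => (hPm h).elim
        · exact H p hp
      · intro ω hω hag'' hR
        refine Runs.assign' (x := (I.parentQuery (π m) : ℕ)) hω ?_ ?_
        · have h2 := hag''.scalar .u rfl
          simp only [Frame.setScalar_scalar, reduceCtorEq, if_false] at h2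
          simp [Expr.eval, h2, hu]
        · have h2 := hag''.scalar .p rfl
          refine ⟨m, by omega, by omega, by simpa using h2, fun h0 => ?_, by simpa using hR⟩
          obtain ⟨j, rfl⟩ : ∃ j', m = j' + 1 := ⟨m - 1, by omega⟩
          simp [I.parentQuery_eq (hπ.step j (by omega))]

-- The first test includes `x` itself, and its failure puts `x` into `D`. The second test leaves `x`
-- out, because by then `x` is dominated in either case.
open Classical in
theorem runs_leafCase {x : Fin n} {k : ℕ} {π : ℕ → Fin n} {P D : ℕ → Prop}
    (hπ : IsPath I x k π) (hσ : σ.Fits Λ) (hx : σ.scalar .x = (x : ℕ)) (hk : σ.scalar .k = k)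
    (hP : σ.array .P = arr k fun p => ind (P p)) (hD : σ.array .D = arr k fun p => ind (D p))
    (hL : k + 1 ≤ Λ.L) (hK : k + 1 ≤ Λ.K) :
    Runs I Λ κ leafCase σ fun τ => τ.scalar .ret =
      if ∀ p ≤ k, p = k ∨ p < k ∧ P p → DominatedAt I k π (fun q => q < k ∧ D q) p then 0
      else if ∀ p ≤ k, p < k ∧ P p → DominatedAt I k π (fun q => q = k ∨ q < k ∧ D q) p then 1
      else ⊤ := by
  have hN := hL.trans Λ.L_le
  have h1M : 1 ≤ Λ.M := le_trans (by norm_num) Λ.two_le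
  -- The predicates carry no information at position `k`, hence the guards `p < k` in the extended
  -- arrays.
  have hpush : ∀ (F : ℕ → Prop), arr k (fun p => ind (F p)) ++ [0] =
      arr (k + 1) fun p => ind (p < k ∧ F p) := fun F => by
    rw [arr_succ]
    congr 1
    · exact arr_congr fun i hi => by simp [hi]
    · simp [ind]
  have hpush1 : ∀ (F : ℕ → Prop), arr k (fun p => ind (F p)) ++ [1] =
      arr (k + 1) fun p => ind (p = k ∨ p < k ∧ F p) := fun F => by
    rw [arr_succ]
    congr 1
    · exact arr_congr fun i hi => by simp [hi, hi.ne]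
    · simp [ind]
  have hset : ∀ (F : ℕ → Prop), (arr (k + 1) fun p => ind (p < k ∧ F p)).set k 1 =
      arr (k + 1) fun p => ind (p = k ∨ p < k ∧ F p) := fun F => by
    rw [set_arr]
    refine arr_congr fun i hi => ?_
    rcases (by omega : i < k ∨ i = k) with h | rfl
    · simp [h.ne]
    · simp [ind]
  have hset0 : ∀ (F : ℕ → Prop), (arr (k + 1) fun p => ind (p = k ∨ p < k ∧ F p)).set k 0 =
      arr (k + 1) fun p => ind (p < k ∧ F p) := fun F => by
    rw [set_arr]
    refine arr_congr fun i hi => ?_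
    rcases (by omega : i < k ∨ i = k) with h | rfl
    · simp [h.ne]
    · simp [ind]
  unfold leafCase
  refine Runs.push_seq (arr (k + 1) fun p => ind (p < k ∧ D p)) hσ ?_ ?_ (by simp [Expr.eval])
    fun hσ => ?_
  · simpa [Expr.eval, hD] using hpush D
  · simpa using hL
  refine Runs.push_seq (arr (k + 1) fun p => ind (p = k ∨ p < k ∧ P p)) hσ ?_ ?_
    (by simpa [Expr.eval] using h1M) fun hσ => ?_
  · simpa [Expr.eval, hP] using hpush1 P
  · simpa using hL
  refine Runs.seq (runs_checkDominated hπ hσ (by simpa using hx) (by simpa using hk) rfl rfl hN hK)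
    ?_
  intro τ hτ hag hok
  have hkτ : τ.scalar .k = k := by rw [hag.scalar _ rfl]; simpa using hk
  have hxτ : τ.scalar .x = (x : ℕ) := by rw [hag.scalar _ rfl]; simpa using hx
  have hPτ : τ.array .P = _ := hag.array _ rfl
  have hDτ : τ.array .D = _ := hag.array _ rfl
  simp only [Frame.setArray_array, reduceCtorEq, if_true, if_false] at hPτ hDτ
  set A := ∀ p ≤ k, p = k ∨ p < k ∧ P p → DominatedAt I k π (fun q => q < k ∧ D q) p with hA
  refine Runs.seq (R := fun υ => υ.array .D = arr (k + 1) fun q =>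
    ind ((¬ A ∧ q = k) ∨ q < k ∧ D q)) (Runs.ite A hτ (by simp [hok, ind_ne_zero]) ?_ ?_) ?_
  · intro h
    refine Runs.skip hτ ?_
    simp [h, hDτ]
  · intro h
    refine Runs.store hτ rfl (by simpa [Expr.eval] using h1M) ?_
    simp [h, hDτ, hkτ, Expr.eval, hset]
  intro υ hυ hag' hDυ
  have hkυ : υ.scalar .k = k := (hag'.scalar _ rfl).trans hkτ
  have hxυ : υ.scalar .x = (x : ℕ) := (hag'.scalar _ rfl).trans hxτ
  have hPυ : υ.array .P = _ := (hag'.array _ rfl).trans hPτ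
  refine Runs.store_seq (arr (k + 1) fun p => ind (p < k ∧ P p)) hυ ?_ (by simp [Expr.eval])
    fun hυ => ?_
  · simp [Expr.eval, hPυ, hkυ, hset0]
  refine Runs.seq (runs_checkDominated hπ hυ (by simpa using hxυ) (by simpa using hkυ) rfl
    (by simpa using hDυ) hN hK) ?_
  intro ω hω hag'' hok'
  have hDω : ω.array .D = _ := (hag''.array _ rfl).trans hDυ
  have hkω : ω.scalar .k = k := by rw [hag''.scalar _ rfl]; simpa using hkυ
  refine Runs.ite _ hω (by simp only [eval_v, hok', ind_ne_zero]; exact Iff.rfl) ?_ ?_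
  · intro h
    refine Runs.ite (¬ A) hω ?_ ?_ ?_
    · simp only [Expr.eval, eval_v, hDω, hkω, ENat.toNat_natCast]
      rw [getD_arr _ (by omega), ind_ne_zero]
      simp
    · intro hA'
      refine Runs.assign' hω (x := 1) rfl ?_
      rw [if_neg hA', if_pos]
      · simp
      · simpa [hA'] using h
    · intro hA'
      refine Runs.assign' hω (x := 0) rfl ?_
      rw [if_pos (not_not.1 hA')]; simp
  · intro h
    refine Runs.assign' hω (x := ⊤) rfl ?_
    by_cases hA' : A
    -- If the first test succeeded, then `D` is unchanged and the second test asks for less, so it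
    -- cannot fail.
    · exfalso
      refine h fun p hp hpP => ?_
      simpa [hA'] using hA' p hp (.inr hpP)
    · rw [if_neg hA', if_neg]
      · simp
      · simpa [hA'] using h

end Domset

namespace Domset

variable {n : ℕ}

/-! Partitions, given by the numbers of the blocks. -/

/-- The largest block number before position `p`. -/
def maxBelow (B : ℕ → ℕ) (p : ℕ) : ℕ := (Finset.range p).sup B

theorem maxBelow_succ (B : ℕ → ℕ) (p : ℕ) : maxBelow B (p + 1) = max (B p) (maxBelow B p) := by
  simp [maxBelow, Finset.range_add_one]

theorem maxBelow_congr {B C : ℕ → ℕ} {p : ℕ} (h : ∀ q < p, B q = C q) :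
    maxBelow B p = maxBelow C p :=
  Finset.sup_congr rfl fun q hq => h q (Finset.mem_range.1 hq)

theorem le_maxBelow {B : ℕ → ℕ} {p q : ℕ} (h : q < p) : B q ≤ maxBelow B p :=
  Finset.le_sup (f := B) (Finset.mem_range.2 h)

/-- `B` numbers the blocks of a partition of the set `P` of positions below `m` in the order of
their first elements, starting from `1`, and is `0` elsewhere. -/
structure IsBlocks (m : ℕ) (P : ℕ → Prop) (B : ℕ → ℕ) : Prop where
  pos : ∀ p < m, P p → 1 ≤ B p
  le : ∀ p < m, P p → B p ≤ maxBelow B p + 1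
  zero : ∀ p, ¬ (p < m ∧ P p) → B p = 0

open Classical in
/-- The partition with a single block. -/
noncomputable def oneBlock (m : ℕ) (P : ℕ → Prop) (p : ℕ) : ℕ := if p < m ∧ P p then 1 else 0

namespace IsBlocks

variable {m : ℕ} {P : ℕ → Prop} {B C : ℕ → ℕ}

theorem le_succ (h : IsBlocks m P B) (p : ℕ) : B p ≤ p + 1 := by
  induction p using Nat.strong_induction_on with
  | _ p ih =>
    by_cases hp : p < m ∧ P p
    · refine (h.le p hp.1 hp.2).trans (Nat.succ_le_succ (Finset.sup_le fun q hq => ?_))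
      have := Finset.mem_range.1 hq
      exact (ih q this).trans this
    · rw [h.zero p hp]; exact Nat.zero_le _

theorem le_m (h : IsBlocks m P B) (p : ℕ) : B p ≤ m := by
  by_cases hp : p < m ∧ P p
  · exact (h.le_succ p).trans hp.1
  · rw [h.zero p hp]; exact Nat.zero_le _

theorem maxBelow_le (h : IsBlocks m P B) (p : ℕ) : maxBelow B p ≤ p :=
  Finset.sup_le fun q hq => (h.le_succ q).trans (Finset.mem_range.1 hq)

theorem oneBlock (m : ℕ) (P : ℕ → Prop) : IsBlocks m P (oneBlock m P) where
  pos p hp hP := by simp [Domset.oneBlock, hp, hP]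
  le p hp hP := by simp [Domset.oneBlock, hp, hP]
  zero p hp := by simp only [Domset.oneBlock, if_neg hp]

/-- A new maximum exceeds the old one by exactly one, so no block number is skipped: a discrete
intermediate value argument along the prefixes. -/
theorem exists_eq (h : IsBlocks m P B) {i : ℕ} (h1 : 1 ≤ i) (h2 : i ≤ maxBelow B m) :
    ∃ p < m, P p ∧ B p = i := by
  have key : ∀ j ≤ m, i ≤ maxBelow B j → ∃ p < j, P p ∧ B p = i := by
    intro j
    induction j with
    | zero => intro _ hi; simp [maxBelow] at hi; omega
    | succ j ih =>
      intro hj hi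
      by_cases hi' : i ≤ maxBelow B j
      · obtain ⟨p, hp, h⟩ := ih (by omega) hi'
        exact ⟨p, by omega, h⟩
      · rw [maxBelow_succ] at hi
        have hPj : P j := by
          by_contra hP
          rw [h.zero j (by tauto)] at hi
          omega
        have := h.le j hj hPj
        exact ⟨j, by omega, hPj, by omega⟩
  exact key m le_rfl h2

/-- The comparison already holds pointwise. Hence the enumeration starts at the lexicographically
least partition. -/
theorem oneBlock_le (h : IsBlocks m P B) : toLex (Domset.oneBlock m P) ≤ toLex B := by
  refine Pi.toLex_monotone fun p => ?_
  unfold Domset.oneBlock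
  split_ifs with hp
  · exact h.pos p hp.1 hp.2
  · exact Nat.zero_le _

/-- Some numbering has the fibres of a given function as its blocks. -/
theorem exists_fibers {ι : Type*} (m : ℕ) (P : ℕ → Prop) (a : ℕ → ι) :
    ∃ B, IsBlocks m P B ∧ ∀ p < m, ∀ q < m, P p → P q → (B p = B q ↔ a p = a q) := by
  classical
  induction m with
  | zero => exact ⟨fun _ => 0, ⟨by simp, by simp, by simp⟩, by simp⟩
  | succ m ih =>
    obtain ⟨B, hB, hBa⟩ := ih
    by_cases hP : P m
    swap
    · refine ⟨B, ⟨fun p hp hPp => hB.pos p ?_ hPp, fun p hp hPp => hB.le p ?_ hPp, fun p hp =>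
        hB.zero p fun h => hp ⟨by omega, h.2⟩⟩, fun p hp q hq hPp hPq => hBa p ?_ q ?_ hPp hPq⟩ <;>
      exact lt_of_le_of_ne (by omega) (by rintro rfl; contradiction)
    -- The number for position `m` is that of an earlier element with the same value of `a` if there
    -- is one, and otherwise the first unused number.
    obtain ⟨b, hb1, hb2, hb⟩ : ∃ b, 1 ≤ b ∧ b ≤ maxBelow B m + 1 ∧
        ∀ q < m, P q → (B q = b ↔ a q = a m) := by
      by_cases hq : ∃ q < m, P q ∧ a q = a m
      · obtain ⟨q, hq, hPq, haq⟩ := hq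
        exact ⟨B q, hB.pos q hq hPq, (le_maxBelow hq).trans (Nat.le_succ _), fun q' hq' hPq' => by
          rw [hBa q' hq' q hq hPq' hPq, haq]⟩
      · refine ⟨maxBelow B m + 1, by omega, le_rfl, fun q' hq' hPq' => ⟨fun h => ?_, fun h =>
          (hq ⟨q', hq', hPq', h⟩).elim⟩⟩
        have := le_maxBelow (B := B) hq'
        omega
    have hlt : ∀ q < m, Function.update B m b q = B q := fun q hq =>
      Function.update_of_ne hq.ne _ _
    refine ⟨Function.update B m b, ⟨fun p hp hPp => ?_, fun p hp hPp => ?_, fun p hp => ?_⟩,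
      fun p hp q hq hPp hPq => ?_⟩
    · rcases Nat.lt_succ_iff_lt_or_eq.1 hp with h | rfl
      · rw [hlt p h]; exact hB.pos p h hPp
      · simpa using hb1
    · rcases Nat.lt_succ_iff_lt_or_eq.1 hp with h | rfl
      · rw [hlt p h, maxBelow_congr fun q hq => hlt q (hq.trans h)]; exact hB.le p h hPp
      · rw [maxBelow_congr hlt]; simpa using hb2
    · rw [Function.update_of_ne]
      · exact hB.zero p fun h => hp ⟨by omega, h.2⟩
      · rintro rfl; exact hp ⟨by omega, hP⟩
    · rcases Nat.lt_succ_iff_lt_or_eq.1 hp with h | rfl <;>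
        rcases Nat.lt_succ_iff_lt_or_eq.1 hq with h' | rfl
      · rw [hlt p h, hlt q h']; exact hBa p h q h' hPp hPq
      · rw [hlt p h, Function.update_self]; exact hb p h hPp
      · rw [hlt q h', Function.update_self, eq_comm, hb q h' hPq, eq_comm]
      · simp

/-- If all block numbers are as large as possible, then the partition is the last one. -/
theorem le_of_forall_eq (hmax : ∀ q < m, P q → B q = maxBelow B q + 1)
    (hC : IsBlocks m P C) : toLex C ≤ toLex B := by
  by_contra hlt
  obtain ⟨p, hp, hlt⟩ := not_le.1 hlt
  have hlt : B p < C p := hlt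
  have hp : ∀ q < p, B q = C q := hp
  -- At the first difference `p` the maxima over the earlier positions agree, so `C p` is at most
  -- `maxBelow B p + 1 = B p`.
  by_cases hP : p < m ∧ P p
  · have h1 := hC.le p hP.1 hP.2
    have h2 := hmax p hP.1 hP.2
    rw [maxBelow_congr hp] at h2
    omega
  · rw [hC.zero p hP] at hlt; omega

open Classical in
/-- Block `B j` moved to the next number, and all later elements moved to the first block. -/
noncomputable def next (m : ℕ) (P : ℕ → Prop) (B : ℕ → ℕ) (j : ℕ) (q : ℕ) : ℕ :=
  if q < j then B q else if q = j then B j + 1 else Domset.oneBlock m P q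

theorem isBlocks_next {j : ℕ} (h : IsBlocks m P B) (hj : j < m) (hPj : P j)
    (hle : B j ≤ maxBelow B j) : IsBlocks m P (next m P B j) where
  pos p hp hPp := by
    unfold next; split_ifs
    · exact h.pos p hp hPp
    · omega
    · exact (IsBlocks.oneBlock m P).pos p hp hPp
  le p hp hPp := by
    have hlt : ∀ q < j, next m P B j q = B q := fun q hq => if_pos hq
    rcases lt_trichotomy p j with h1 | rfl | h1
    · rw [hlt p h1, maxBelow_congr fun q hq => hlt q (hq.trans h1)]; exact h.le p hp hPp
    · rw [maxBelow_congr hlt]; simp [next]; omega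
    · simp only [next, if_neg h1.not_gt, if_neg h1.ne', Domset.oneBlock, if_pos (And.intro hp hPp)]
      omega
  zero p hp := by
    unfold next; split_ifs with h1 h2
    · exact h.zero p hp
    · subst h2; exact (hp ⟨hj, hPj⟩).elim
    · exact (IsBlocks.oneBlock m P).zero p hp

theorem lt_next {j : ℕ} : toLex B < toLex (next m P B j) :=
  ⟨j, fun q hq => by simp [next, hq], by simp [next]⟩

/-- Beyond `j` the numbers of `B` are maximal, so a larger `C` first exceeds `B` at some `p ≤ j`. If
`p < j`, then `C` also exceeds the successor first at `p`. If `p = j`, then the successor lies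
pointwise below `C`. -/
theorem next_le {j : ℕ} (hmax : ∀ q, j < q → q < m → P q → B q = maxBelow B q + 1)
    (hC : IsBlocks m P C) (hlt : toLex B < toLex C) : toLex (next m P B j) ≤ toLex C := by
  obtain ⟨p, hp, hlt⟩ := hlt
  have hlt : B p < C p := hlt
  have hp : ∀ q < p, B q = C q := hp
  have hP : p < m ∧ P p := by
    by_contra hP
    rw [hC.zero p hP] at hlt; omega
  have hpj : p ≤ j := by
    by_contra hpj
    have h1 := hC.le p hP.1 hP.2
    have h2 := hmax p (by omega) hP.1 hP.2
    rw [maxBelow_congr hp] at h2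
    omega
  rcases hpj.lt_or_eq with hpj | rfl
  · exact le_of_lt ⟨p, fun q hq => by simpa [next, hq.trans hpj] using hp q hq,
      by simpa [next, hpj] using hlt⟩
  · refine Pi.toLex_monotone fun q => ?_
    unfold next; split_ifs with h1 h2
    · exact (hp q h1).le
    · subst h2; exact hlt
    · unfold Domset.oneBlock; split_ifs with h3
      · exact hC.pos q h3.1 h3.2
      · exact Nat.zero_le _


/-- The partitions of `P`. -/
theorem exists_finset (m : ℕ) (P : ℕ → Prop) :
    ∃ F : Finset (Lex (ℕ → ℕ)), F.card ≤ (m + 1) ^ m ∧ ∀ B, toLex B ∈ F ↔ IsBlocks m P B := by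
  classical
  -- Block numbers are at most `m` and vanish from position `m` on, so a partition is determined by
  -- a function on `Fin m`.
  let φ : (Fin m → Fin (m + 1)) → Lex (ℕ → ℕ) :=
    fun b => toLex fun p => if h : p < m then b ⟨p, h⟩ else 0
  refine ⟨(Finset.univ.image φ).filter fun B => IsBlocks m P (ofLex B),
    ((Finset.card_filter_le _ _).trans Finset.card_image_le).trans (by simp), fun B => ?_⟩
  rw [Finset.mem_filter]
  refine ⟨fun h => h.2,
    fun h => ⟨Finset.mem_image.2 ⟨fun p => ⟨B p, ?_⟩, Finset.mem_univ _, ?_⟩, h⟩⟩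
  · exact Nat.lt_succ_of_le (h.le_m p)
  · refine congrArg toLex (funext fun p => ?_)
    split_ifs with hp
    · rfl
    · exact (h.zero p fun h => hp h.1).symm

end IsBlocks

variable {I : Input n} {Λ : Limits n} {σ : Frame} {κ : ℕ} {k : ℕ} {P : ℕ → Prop}

theorem toNat_ind_le (Λ : Limits n) (p : Prop) : (ind p).toNat ≤ Λ.M :=
  (toNat_ind p).trans (le_trans (by norm_num) Λ.two_le)

theorem runs_firstPartition (hσ : σ.Fits Λ) (hk : σ.scalar .k = k)
    (hP : σ.array .P = arr (k + 1) fun p => ind (P p)) (hL : k + 1 ≤ Λ.L) (hK : k + 1 ≤ Λ.K) :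
    Runs I Λ κ firstPartition σ fun τ =>
      τ.array .B = arr (k + 1) fun p => (oneBlock (k + 1) P p : ℕ∞) := by
  unfold firstPartition
  refine Runs.clear_seq hσ fun hσ => ?_
  refine (Runs.forLoop (k + 1) (fun i τ => τ.array .B = arr i fun p => (oneBlock (k + 1) P p : ℕ∞))
    hσ (hL.trans Λ.L_le) hK (fun τ hτ hag => ?_) (by simp) ?_).mono fun τ _ _ h => h.2
  · have := hag.scalar .k rfl
    simp_all [Expr.eval]
  · intro i hi τ hτ hag hp hB
    have hPτ := hag.array .P rfl
    simp only [Frame.setArray_array, reduceCtorEq, if_false, hP] at hPτ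
    have hev : (Expr.get .P (v .p)).eval I τ = (oneBlock (k + 1) P i : ℕ∞) := by
      simp only [Expr.eval, eval_v, hp, ENat.toNat_natCast, hPτ]
      rw [getD_arr _ hi]
      by_cases h : P i <;> simp [ind, oneBlock, h, hi]
    refine Runs.push hτ rfl ?_ ?_ ?_
    · simp [hB]; omega
    · rw [hev, ENat.toNat_natCast]
      refine le_trans ?_ Λ.two_le
      unfold oneBlock; split_ifs <;> simp
    · simp [hev, hB, arr_succ]

theorem natCast_lt_eval_ne_zero {a b : ℕ∞} : (open Classical in if a < b then (1 : ℕ∞) else 0) ≠ 0 ↔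
    a < b := by
  split_ifs with h <;> simp [h]

theorem runs_countBlocks {B : ℕ → ℕ} (hσ : σ.Fits Λ) (hk : σ.scalar .k = k)
    (hB : σ.array .B = arr (k + 1) fun p => (B p : ℕ∞)) (hL : k + 1 ≤ Λ.L) (hK : k + 1 ≤ Λ.K) :
    Runs I Λ κ countBlocks σ fun τ => τ.scalar .l = maxBelow B (k + 1) := by
  unfold countBlocks
  refine Runs.assign_seq' (0 : ℕ) hσ rfl fun hσ => ?_
  refine (Runs.forLoop (k + 1) (fun i τ => τ.scalar .l = maxBelow B i)
    hσ (hL.trans Λ.L_le) hK (fun τ hτ hag => ?_) (by simp [maxBelow]) ?_).mono fun τ _ _ h => h.2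
  · have := hag.scalar .k rfl
    simp_all [Expr.eval]
  · intro i hi τ hτ hag hp hl
    have hBτ := hag.array .B rfl
    simp only [Frame.setScalar_array, hB] at hBτ
    have hev : (Expr.get .B (v .p)).eval I τ = (B i : ℕ) := by
      simp only [Expr.eval, eval_v, hp, ENat.toNat_natCast, hBτ]
      rw [getD_arr _ hi]
    refine Runs.ite (maxBelow B i < B i) hτ ?_ (fun h => ?_) (fun h => ?_)
    · rw [Expr.eval, hev, eval_v, hl, natCast_lt_eval_ne_zero, Nat.cast_lt]
    · refine Runs.assign' hτ hev ?_
      simp [maxBelow_succ, h.le]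
    · refine Runs.skip hτ ?_
      simpa [maxBelow_succ, not_lt.1 h] using hl

/-- The scan runs from the end. The invariant says that the numbers from `j` on were maximal and
that the array has already been reset to the first block there. When a position with room is found,
incrementing it therefore completes `IsBlocks.next`. The second alternative of the invariant
describes the exit forced by setting `p` to `0`. -/
theorem runs_nextPartition {B : ℕ → ℕ} (hσ : σ.Fits Λ) (hk : σ.scalar .k = k)
    (hP : σ.array .P = arr (k + 1) fun p => ind (P p))
    (hB : σ.array .B = arr (k + 1) fun p => (B p : ℕ∞)) (hBP : IsBlocks (k + 1) P B)
    (hL : k + 1 ≤ Λ.L) (hM : k + 1 ≤ Λ.M) (hK : k + 1 ≤ Λ.K) :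
    Runs I Λ κ nextPartition σ fun τ =>
      (τ.scalar .more = 0 ∧ ∀ C, IsBlocks (k + 1) P C → toLex C ≤ toLex B) ∨
      (τ.scalar .more = 1 ∧ ∃ B', IsBlocks (k + 1) P B' ∧
        τ.array .B = arr (k + 1) (fun p => (B' p : ℕ∞)) ∧ toLex B < toLex B' ∧
        ∀ C, IsBlocks (k + 1) P C → toLex B < toLex C → toLex B' ≤ toLex C) := by
  have hN := hL.trans Λ.L_le
  unfold nextPartition
  refine Runs.assign_seq' 0 hσ rfl fun hσ => ?_
  refine Runs.assign_seq ((k + 1 : ℕ) : ℕ∞) hσ (by simp [Expr.eval, hk])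
    (by rwa [ENat.toNat_natCast]) fun hσ => ?_
  refine Runs.loop (fun j τ => τ.scalar .p = j ∧ ((τ.scalar .more = 0 ∧ j ≤ k + 1 ∧
      τ.array .B = arr (k + 1)
        (fun q => ((if q < j then B q else oneBlock (k + 1) P q : ℕ) : ℕ∞)) ∧
      ∀ q, j ≤ q → q < k + 1 → P q → B q = maxBelow B q + 1) ∨
    (j = 0 ∧ τ.scalar .more = 1 ∧ ∃ B', IsBlocks (k + 1) P B' ∧
        τ.array .B = arr (k + 1) (fun p => (B' p : ℕ∞)) ∧ toLex B < toLex B' ∧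
        ∀ C, IsBlocks (k + 1) P C → toLex B < toLex C → toLex B' ≤ toLex C)))
    (k + 1) hK hσ ?_ ?_
  · refine ⟨by simp, .inl ⟨by simp, le_rfl, ?_, fun q h1 h2 => by omega⟩⟩
    simp only [Frame.setScalar_array, hB]
    exact arr_congr fun i hi => by rw [if_pos hi]
  · rintro j τ hτ hag ⟨hp, ⟨hmore, hj, hBτ, hmax⟩ | ⟨rfl, h⟩⟩
    swap
    · exact .inl ⟨by simp [Expr.eval, hp], .inr h⟩
    rcases Nat.eq_zero_or_pos j with rfl | hj0
    · exact .inl ⟨by simp [Expr.eval, hp], .inl ⟨hmore, fun C hC =>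
        IsBlocks.le_of_forall_eq (fun q => hmax q (Nat.zero_le q)) hC⟩⟩
    right
    obtain ⟨j, rfl⟩ : ∃ m', j = m' + 1 := ⟨j - 1, by omega⟩
    have hPτ := hag.array .P rfl
    simp only [Frame.setScalar_array, hP] at hPτ
    refine ⟨by simp [Expr.eval, hp], ?_⟩
    refine Runs.assign_seq' (j : ℕ) hτ ?_ fun hτ => ?_
    · simp only [Expr.eval, eval_v, hp]
      rw [← Nat.cast_one, ← ENat.natCast_sub]; simp
    have hBj : ((arr (k + 1) fun q =>
        ((if q < j + 1 then B q else oneBlock (k + 1) P q : ℕ) : ℕ∞)).getD j 0) = (B j : ℕ) := by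
      rw [getD_arr _ (by omega)]; simp
    refine Runs.ite (P j) hτ ?_ (fun hPj => ?_) (fun hPj => ?_)
    · simp only [Expr.eval, eval_v, Frame.setScalar_array, hPτ, Frame.setScalar_scalar, if_true,
        ENat.toNat_natCast]
      rw [getD_arr _ (by omega), ind_ne_zero]
    · refine Runs.assign_seq' (0 : ℕ) hτ rfl fun hτ => ?_
      refine Runs.seq (Runs.forLoop j (fun i τ => τ.scalar .mx = maxBelow B i) hτ (by omega)
        (by omega) (fun τ hτ hag => ?_) (by simp [maxBelow]) ?_) ?_
      · simpa using hag.scalar .p rfl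
      · intro i hi υ hυ hag' hq hmx
        have hBυ := hag'.array .B rfl
        simp only [Frame.setScalar_array, hBτ] at hBυ
        have hev : (Expr.get .B (v .q)).eval I υ = (B i : ℕ) := by
          simp only [Expr.eval, eval_v, hq, ENat.toNat_natCast, hBυ]
          rw [getD_arr _ (by omega), if_pos (by omega)]
        refine Runs.ite (maxBelow B i < B i) hυ ?_ (fun h => ?_) (fun h => ?_)
        · rw [Expr.eval, hev, eval_v, hmx, natCast_lt_eval_ne_zero, Nat.cast_lt]
        · refine Runs.assign' hυ hev ?_
          simp [maxBelow_succ, h.le]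
        · refine Runs.skip hυ ?_
          simpa [maxBelow_succ, not_lt.1 h] using hmx
      · rintro υ hυ hag' ⟨-, hmx⟩
        have hBυ := hag'.array .B rfl
        simp only [Frame.setScalar_array, hBτ] at hBυ
        have hpυ : υ.scalar .p = (j : ℕ) := by simpa using hag'.scalar .p rfl
        have hmoreυ : υ.scalar .more = 0 := by simpa [hmore] using hag'.scalar .more rfl
        have hev : (Expr.get .B (v .p)).eval I υ = (B j : ℕ) := by
          simp only [Expr.eval, eval_v, hpυ, ENat.toNat_natCast, hBυ]
          exact hBj
        refine Runs.ite (maxBelow B j < B j) hυ ?_ (fun h => ?_) (fun h => ?_)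
        · rw [Expr.eval, hev, eval_v, hmx, natCast_lt_eval_ne_zero, Nat.cast_lt]
        · refine Runs.store hυ rfl ?_ ?_
          · simp [Expr.eval]; exact le_trans (by norm_num) Λ.two_le
          · refine ⟨j, by omega, by simpa using hpυ, .inl ⟨by simpa using hmoreυ, by omega, ?_, ?_⟩⟩
            · simp only [Expr.eval, eval_v, hpυ, ENat.toNat_natCast, hBυ, set_arr,
                Frame.setArray_array, if_true]
              refine arr_congr fun i hi => ?_
              rcases lt_trichotomy i j with h1 | rfl | h1
              · rw [Function.update_of_ne h1.ne, if_pos h1, if_pos (by omega)]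
              · simp [oneBlock, hi, hPj]
              · rw [Function.update_of_ne h1.ne', if_neg (by omega), if_neg (by omega)]
            · intro q h1 h2 hPq
              rcases h1.eq_or_lt with rfl | h1
              · have := hBP.le j h2 hPj
                omega
              · exact hmax q h1 h2 hPq
        · have hBle : B j + 1 ≤ k + 1 := by
            have := hBP.maxBelow_le j
            omega
          have hev' : ((Expr.get .B (v .p)).add (.num 1)).eval I υ = ((B j + 1 : ℕ) : ℕ∞) := by
            rw [Expr.eval, hev]; simp [Expr.eval]
          refine Runs.store_seq _ hυ rfl ?_ fun hυ => ?_
          · rw [hev', ENat.toNat_natCast]; omega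
          refine Runs.assign_seq' 1 hυ rfl fun hυ => ?_
          refine Runs.assign' (x := (0 : ℕ)) hυ rfl ?_
          refine ⟨0, by omega, by simp, .inr ⟨rfl, by simp, IsBlocks.next (k + 1) P B j,
            IsBlocks.isBlocks_next hBP (by omega) hPj (not_lt.1 h), ?_, IsBlocks.lt_next,
            fun C hC hlt => IsBlocks.next_le hmax hC hlt⟩⟩
          rw [hev']
          simp only [eval_v, hpυ, ENat.toNat_natCast, hBυ, set_arr, Frame.setScalar_array,
                Frame.setArray_array, if_true]
          refine arr_congr fun i hi => ?_
          rcases lt_trichotomy i j with h1 | rfl | h1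
          · rw [Function.update_of_ne h1.ne, IsBlocks.next, if_pos h1, if_pos (by omega)]
          · simp [IsBlocks.next]
          · rw [Function.update_of_ne h1.ne', IsBlocks.next, if_neg (by omega), if_neg (by omega),
              if_neg (by omega)]
    · refine Runs.skip hτ ⟨j, by omega, by simp, .inl ⟨by simpa using hmore, by omega, ?_, ?_⟩⟩
      · simp only [Frame.setScalar_array, hBτ]
        refine arr_congr fun i hi => ?_
        rcases lt_trichotomy i j with h1 | rfl | h1
        · rw [if_pos h1, if_pos (by omega)]
        · simp [oneBlock, hPj, hBP.zero i (by tauto)]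
        · rw [if_neg (by omega), if_neg (by omega)]
      · intro q h1 h2 hPq
        rcases h1.eq_or_lt with rfl | h1
        · contradiction
        · exact hmax q h1 h2 hPq

end Domset

namespace Domset

variable {n : ℕ} {I : Input n} {Λ : Limits n} {σ : Frame} {κ l : ℕ}

/-! Tables. -/

/-- The table with `l` rows and columns and the entries `C i j`. -/
def tab (l : ℕ) (C : ℕ → ℕ → ℕ∞) : List ℕ∞ := arr (l * l) fun q => C (q / l) (q % l)

theorem _root_.Nat.mul_add_lt_mul {i j l m : ℕ} (hi : i < m) (hj : j < l) : i * l + j < m * l := by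
  have : (i + 1) * l ≤ m * l := Nat.mul_le_mul_right _ hi
  rw [add_mul] at this; omega

theorem _root_.Nat.mul_add_div_mod {i j l : ℕ} (hj : j < l) :
    (i * l + j) / l = i ∧ (i * l + j) % l = j := by
  constructor
  · rw [Nat.mul_comm, Nat.mul_add_div (by omega), Nat.div_eq_of_lt hj, add_zero]
  · rw [Nat.mul_comm, Nat.mul_add_mod, Nat.mod_eq_of_lt hj]

theorem getD_tab {i j : ℕ} (C : ℕ → ℕ → ℕ∞) (hi : i < l) (hj : j < l) :
    (tab l C).getD (i * l + j) 0 = C i j := by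
  rw [tab, getD_arr _ (Nat.mul_add_lt_mul hi hj)]
  obtain ⟨h1, h2⟩ := Nat.mul_add_div_mod (i := i) hj
  rw [h1, h2]

theorem tab_congr {C C' : ℕ → ℕ → ℕ∞} (h : ∀ i < l, ∀ j < l, C i j = C' i j) :
    tab l C = tab l C' := by
  refine arr_congr fun q hq => ?_
  have hl : 0 < l := by
    by_contra h0
    simp [Nat.eq_zero_of_not_pos h0] at hq
  exact h _ (Nat.div_lt_of_lt_mul hq) _ (Nat.mod_lt _ hl)

theorem set_tab {i j : ℕ} (C : ℕ → ℕ → ℕ∞) (hj : j < l) (x : ℕ∞) :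
    (tab l C).set (i * l + j) x = tab l fun i' j' => if i' = i ∧ j' = j then x else C i' j' := by
  unfold tab
  rw [set_arr]
  refine arr_congr fun q _ => ?_
  obtain ⟨h1, h2⟩ := Nat.mul_add_div_mod (i := i) hj
  rw [Function.update_apply]
  by_cases h : q = i * l + j
  · subst h; rw [if_pos rfl]; simp [h1, h2]
  · rw [if_neg h]
    refine (if_neg ?_).symm
    rintro ⟨rfl, rfl⟩
    exact h (Nat.div_add_mod' q l).symm

theorem runs_initTable {tc tl : Arr} (hne : tc ≠ tl) (hσ : σ.Fits Λ) (hl : σ.scalar .l = l)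
    (hL : l * l ≤ Λ.L) (hlN : l ≤ Λ.N) (hK : l ≤ Λ.K) :
    Runs I Λ κ (initTable tc tl) σ fun τ =>
      τ.array tc = tab l (fun _ _ => ⊤) ∧ τ.array tl = tab l (fun _ _ => 0) := by
  unfold initTable
  refine Runs.clear_seq hσ fun hσ => ?_
  refine Runs.clear_seq hσ fun hσ => ?_
  refine (Runs.forLoop l (fun i τ => τ.array tc = arr (i * l) (fun _ => ⊤) ∧
    τ.array tl = arr (i * l) (fun _ => 0)) hσ hlN hK (fun τ hτ hag => ?_)
    (by simp [hne]) ?_).mono fun τ _ _ h => h.2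
  · simpa [hl] using hag.scalar .l rfl
  · rintro i hi τ hτ hag hiτ ⟨hc, hlab⟩
    refine (Runs.forLoop l (fun j τ => τ.array tc = arr (i * l + j) (fun _ => ⊤) ∧
      τ.array tl = arr (i * l + j) (fun _ => 0)) hτ hlN hK (fun υ hυ hag' => ?_)
      (by simpa using ⟨hc, hlab⟩) ?_).mono fun τ _ _ h => ?_
    · have h1 := hag.scalar .l rfl
      have h2 := hag'.scalar .l rfl
      simpa [hl, h1] using h2
    · rintro j hj υ hυ hag' hjυ ⟨hc, hlab⟩
      have hlt := Nat.mul_add_lt_mul hi hj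
      refine Runs.push_seq _ hυ rfl ?_ (by simp [Expr.eval]) fun hυ => ?_
      · simp [hc]; omega
      refine Runs.push hυ rfl ?_ (by simp [Expr.eval]) ?_
      · simp [hlab, hne.symm]; omega
      · simp [hc, hlab, hne, hne.symm, ← add_assoc, arr_succ, Expr.eval]
    · simpa [add_mul] using h.2

/-- Pigeonhole: `a` different labels in use occupy `a` of the `2 * N` table entries. This bounds
both the fresh label and the length of the search for it. -/
theorem le_two_mul_of_forall_exists {f g : ℕ → ℕ∞} {a N : ℕ}
    (h : ∀ b < a, ∃ q < N, f q = (b : ℕ) ∨ g q = (b : ℕ)) : a ≤ 2 * N := by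
  classical
  have hsub : (Finset.range a).image (fun b : ℕ => (b : ℕ∞)) ⊆
      (Finset.range N).image f ∪ (Finset.range N).image g := by
    intro x hx
    obtain ⟨b, hb, rfl⟩ := Finset.mem_image.1 hx
    obtain ⟨q, hq, h⟩ := h b (Finset.mem_range.1 hb)
    rcases h with h | h
    · exact Finset.mem_union_left _ (Finset.mem_image.2 ⟨q, Finset.mem_range.2 hq, h⟩)
    · exact Finset.mem_union_right _ (Finset.mem_image.2 ⟨q, Finset.mem_range.2 hq, h⟩)
  have h1 := Finset.card_le_card hsub
  rw [Finset.card_image_of_injective _ Nat.cast_injective, Finset.card_range] at h1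
  have h2 := Finset.card_union_le ((Finset.range N).image f) ((Finset.range N).image g)
  have h3 : ((Finset.range N).image f).card ≤ N := Finset.card_image_le.trans (by simp)
  have h4 : ((Finset.range N).image g).card ≤ N := Finset.card_image_le.trans (by simp)
  omega

theorem runs_freshLabel {N : ℕ} {f g : ℕ → ℕ∞} (hσ : σ.Fits Λ)
    (hf : σ.array .label = arr N f) (hg : σ.array .label2 = arr N g)
    (hN : 2 * N + 1 ≤ Λ.N) (hK : 2 * N + 1 ≤ Λ.K) :
    Runs I Λ κ freshLabel σ fun τ => ∃ a ≤ 2 * N, τ.scalar .lab = (a : ℕ) ∧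
      ∀ q < N, f q ≠ (a : ℕ) ∧ g q ≠ (a : ℕ) := by
  unfold freshLabel
  refine Runs.assign_seq' (0 : ℕ) hσ rfl fun hσ => ?_
  refine Runs.assign_seq' (1 : ℕ) hσ rfl fun hσ => ?_
  -- All labels below the candidate `a` are in use. The variant drops with every rejected candidate,
  -- and to `0` once a free label is found.
  refine Runs.loop (fun m τ => ∃ a : ℕ, τ.scalar .lab = (a : ℕ) ∧
    (∀ b < a, ∃ q < N, f q = (b : ℕ) ∨ g q = (b : ℕ)) ∧
    (τ.scalar .used = 1 ∧ m = 2 * N + 1 - a ∨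
      τ.scalar .used = 0 ∧ m = 0 ∧ ∀ q < N, f q ≠ (a : ℕ) ∧ g q ≠ (a : ℕ)))
    (2 * N + 1) hK hσ ⟨0, by simp, by simp, .inl (by simp)⟩ ?_
  rintro m τ hτ hag ⟨a, hlab, hall, ⟨hused, hm⟩ | ⟨hused, hm, hfin⟩⟩
  swap
  · exact .inl ⟨by simp [hused], a, le_two_mul_of_forall_exists hall, hlab, hfin⟩
  right
  have ha := le_two_mul_of_forall_exists hall
  refine ⟨by simp [hused], ?_⟩
  refine Runs.assign_seq' (0 : ℕ) hτ rfl fun hτ => ?_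
  have hfτ := hag.array .label rfl
  have hgτ := hag.array .label2 rfl
  simp only [Frame.setScalar_array, hf, hg] at hfτ hgτ
  refine Runs.seq (Runs.forLoop N
    (fun i τ => τ.scalar .used = ind (∃ q < i, f q = (a : ℕ) ∨ g q = (a : ℕ))) hτ (by omega)
    (by omega) (fun υ hυ hag' => ?_) (by simp [ind]) ?_) ?_
  · have := hag'.array .label rfl
    simp only [Frame.setScalar_array, hfτ] at this
    simp [Expr.eval, this]
  · intro i hi υ hυ hag' hj hu
    have hfυ := hag'.array .label rfl
    have hgυ := hag'.array .label2 rfl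
    have hlabυ : υ.scalar .lab = (a : ℕ) := by simpa [hlab] using hag'.scalar .lab rfl
    simp only [Frame.setScalar_array, hfτ, hgτ] at hfυ hgυ
    have hsplit : (∃ q < i + 1, f q = (a : ℕ) ∨ g q = (a : ℕ)) ↔
        f i = (a : ℕ) ∨ g i = (a : ℕ) ∨ ∃ q < i, f q = (a : ℕ) ∨ g q = (a : ℕ) := by
      constructor
      · rintro ⟨q, hq, h⟩
        rcases Nat.lt_succ_iff_lt_or_eq.1 hq with hq | rfl
        · exact .inr (.inr ⟨q, hq, h⟩)
        · tauto
      · rintro (h | h | ⟨q, hq, h⟩)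
        · exact ⟨i, by omega, .inl h⟩
        · exact ⟨i, by omega, .inr h⟩
        · exact ⟨q, by omega, h⟩
    refine Runs.seq (R := fun τ => τ.scalar .used =
      ind (f i = (a : ℕ) ∨ ∃ q < i, f q = (a : ℕ) ∨ g q = (a : ℕ)))
      (Runs.ite (f i = (a : ℕ)) hυ ?_ (fun h => ?_) (fun h => ?_)) ?_
    · simp only [Expr.eval, eval_v, hj, ENat.toNat_natCast, hfυ, hlabυ]
      rw [getD_arr _ hi]; split_ifs with h <;> simp [h]
    · refine Runs.assign' (x := 1) hυ rfl ?_
      rw [ind_true (.inl h)]; simp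
    · refine Runs.skip hυ ?_
      rw [hu]; simp [h]
    · intro ω hω hag'' hu'
      have hgω := (hag''.array .label2 rfl).trans hgυ
      have hlabω := (hag''.scalar .lab rfl).trans hlabυ
      have hjω := (hag''.scalar .j rfl).trans hj
      refine (Runs.ite (g i = (a : ℕ)) hω ?_ (fun h => ?_) (fun h => ?_))
      · simp only [Expr.eval, eval_v, hjω, ENat.toNat_natCast, hgω, hlabω]
        rw [getD_arr _ hi]; split_ifs with h <;> simp [h]
      · refine Runs.assign' (x := 1) hω rfl ?_
        rw [hsplit, ind_true (.inr (.inl h))]; simp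
      · refine Runs.skip hω ?_
        rw [hsplit]; simp [hu', h]
  · rintro υ hυ hag' ⟨-, hu⟩
    have hlabυ : υ.scalar .lab = (a : ℕ) := by simpa [hlab] using hag'.scalar .lab rfl
    refine Runs.ite _ hυ (by rw [eval_v, hu, ind_ne_zero]) (fun h => ?_) (fun h => ?_)
    · have hall' : ∀ b < a + 1, ∃ q < N, f q = (b : ℕ) ∨ g q = (b : ℕ) := by
        intro b hb
        rcases Nat.lt_succ_iff_lt_or_eq.1 hb with hb | rfl
        · exact hall b hb
        · exact h
      have ha' := le_two_mul_of_forall_exists hall'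
      refine Runs.assign (x := ((a + 1 : ℕ) : ℕ∞)) hυ (by simp [Expr.eval, hlabυ])
        (by rw [ENat.toNat_natCast]; omega) ?_
      exact ⟨2 * N + 1 - (a + 1), by omega, a + 1, by simp, hall',
        .inl ⟨by simp [hu, ind_true h], rfl⟩⟩
    · refine Runs.skip hυ ⟨0, by omega, a, hlabυ, hall, .inr ⟨by rw [hu, ind_false h], rfl,
        fun q hq => ?_⟩⟩
      constructor <;> intro h' <;> exact h ⟨q, hq, by tauto⟩

/-- The row `R` extended by a further entry. -/
def extRow (l : ℕ) (R : ℕ → ℕ∞) (x : ℕ∞) : ℕ → ℕ∞ := Function.update R l x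

/-- The table after the replacement of a row. -/
def replaceRow (C : ℕ → ℕ → ℕ∞) (i : ℕ) (R : ℕ → ℕ∞) : ℕ → ℕ → ℕ∞ := Function.update C i R

/-- Index `l` of the extended row stands for the entry in hand. Exchanging it with column `j`
composes the permutation with a transposition. -/
theorem replaceRow_swap {C : ℕ → ℕ → ℕ∞} {i j : ℕ} {R : ℕ → ℕ∞} {ρ : Equiv.Perm ℕ} (hj : j < l) :
    (tab l fun i' j' => if i' = i ∧ j' = j then R (ρ l) else
      replaceRow C i (fun q => R (ρ q)) i' j') =
    tab l (replaceRow C i fun q => R ((ρ * Equiv.swap j l) q)) := by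
  refine tab_congr fun i' _ j' hj' => ?_
  unfold replaceRow
  rcases eq_or_ne i' i with rfl | hi
  · rcases eq_or_ne j' j with rfl | hjj
    · simp
    · simp [hjj, Equiv.swap_apply_of_ne_of_ne hjj hj'.ne]
  · simp [hi]

/-- After an insertion, the row together with the evicted entry, which has the largest cost, is a
permutation of the old row together with the new entry. -/
theorem runs_insertEntry {tc tl : Arr} {cost : Var} {C B : ℕ → ℕ → ℕ∞} {i : ℕ} {x b : ℕ∞}
    (hne : tc ≠ tl) (hσ : σ.Fits Λ)
    (hl : σ.scalar .l = l) (hrow : σ.scalar .row = ((i * l : ℕ) : ℕ∞)) (hi : i < l)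
    (hc : σ.array tc = tab l C) (hb : σ.array tl = tab l B)
    (hx : σ.scalar cost = x) (hlab : σ.scalar .lab = b)
    (hxM : x.toNat ≤ Λ.M) (hbM : b.toNat ≤ Λ.M) (hlN : l ≤ Λ.N) (hK : l ≤ Λ.K) :
    Runs I Λ κ (insertEntry tc tl cost) σ fun τ => ∃ ρ : Equiv.Perm ℕ,
      (∀ q, l < q → ρ q = q) ∧
      (∀ q < l, extRow l (C i) x (ρ q) ≤ extRow l (C i) x (ρ l)) ∧
      τ.array tc = tab l (replaceRow C i fun q => extRow l (C i) x (ρ q)) ∧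
      τ.array tl = tab l (replaceRow B i fun q => extRow l (B i) b (ρ q)) := by
  unfold insertEntry
  refine Runs.assign_seq' x hσ hx fun hσ => ?_
  refine Runs.assign_seq' b hσ (by simpa using hlab) fun hσ => ?_
  -- The same `ρ` serves costs and labels, which keeps the pairs together. The entry in hand is
  -- always the most expensive one met so far, so the row need not be known to be ordered.
  refine (Runs.forLoop l (fun j τ => ∃ ρ : Equiv.Perm ℕ,
      (∀ q, l < q → ρ q = q) ∧
      (∀ q < j, extRow l (C i) x (ρ q) ≤ extRow l (C i) x (ρ l)) ∧
      τ.scalar .cc = extRow l (C i) x (ρ l) ∧ τ.scalar .cl = extRow l (B i) b (ρ l) ∧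
      (τ.scalar .cc).toNat ≤ Λ.M ∧ (τ.scalar .cl).toNat ≤ Λ.M ∧
      τ.array tc = tab l (replaceRow C i fun q => extRow l (C i) x (ρ q)) ∧
      τ.array tl = tab l (replaceRow B i fun q => extRow l (B i) b (ρ q))) hσ hlN hK
      (fun τ hτ hag => ?_) ?_ ?_).mono ?_
  · simpa [hl] using hag.scalar .l rfl
  · refine ⟨1, by simp, by simp, by simp [extRow], by simp [extRow], by simpa using hxM,
      by simpa using hbM, ?_, ?_⟩
    · simp only [Frame.setScalar_array, hc]
      refine tab_congr fun i' _ j' hj' => ?_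
      rcases eq_or_ne i' i with rfl | h <;> simp [replaceRow, extRow, *, hj'.ne]
    · simp only [Frame.setScalar_array, hb]
      refine tab_congr fun i' _ j' hj' => ?_
      rcases eq_or_ne i' i with rfl | h <;> simp [replaceRow, extRow, *, hj'.ne]
  · rintro j hj τ hτ hag hjτ ⟨ρ, hρ, hmax, hcc, hclv, hccM, hclM, hcτ, hbτ⟩
    have hrowτ : τ.scalar .row = ((i * l : ℕ) : ℕ∞) := by
      simpa [hrow] using hag.scalar .row rfl
    have hidx : ((v .row).add (v .j)).eval I τ = ((i * l + j : ℕ) : ℕ∞) := by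
      simp [Expr.eval, hrowτ, hjτ]
    have hgc : (Expr.get tc ((v .row).add (v .j))).eval I τ = extRow l (C i) x (ρ j) := by
      rw [Expr.eval, hidx, ENat.toNat_natCast, hcτ, getD_tab _ hi hj]; simp [replaceRow]
    have hgb : ∀ υ : Frame, υ.scalar .row = τ.scalar .row → υ.scalar .j = τ.scalar .j →
        υ.array tl = τ.array tl →
        (Expr.get tl ((v .row).add (v .j))).eval I υ = extRow l (B i) b (ρ j) := by
      intro υ h1 h2 h3
      have hidx : ((v .row).add (v .j)).eval I υ = ((i * l + j : ℕ) : ℕ∞) := by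
        simp [Expr.eval, hrowτ, hjτ, h1, h2]
      rw [Expr.eval, hidx, ENat.toNat_natCast, h3, hbτ, getD_tab _ hi hj]; simp [replaceRow]
    have hcM : (extRow l (C i) x (ρ j)).toNat ≤ Λ.M := by
      rw [← hgc]; exact hτ.getD_le _ _
    have hbM : (extRow l (B i) b (ρ j)).toNat ≤ Λ.M := by
      rw [← hgb τ rfl rfl rfl]; exact hτ.getD_le _ _
    refine Runs.ite (extRow l (C i) x (ρ l) < extRow l (C i) x (ρ j)) hτ ?_ (fun h => ?_)
      (fun h => ?_)
    · rw [Expr.eval, hgc, eval_v, hcc, natCast_lt_eval_ne_zero]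
    · refine Runs.assign_seq' (extRow l (C i) x (ρ j)) hτ hgc fun hτ => ?_
      refine Runs.store_seq (tab l (replaceRow C i fun q =>
        extRow l (C i) x ((ρ * Equiv.swap j l) q))) hτ ?_ ?_ fun hτ => ?_
      · have hidx : ((v .row).add (v .j)).eval I (τ.setScalar .tmp (extRow l (C i) x (ρ j))) =
            ((i * l + j : ℕ) : ℕ∞) := by
          simp [Expr.eval, hrowτ, hjτ]
        rw [hidx, ENat.toNat_natCast]
        simp only [Frame.setScalar_array, hcτ, eval_v, Frame.setScalar_scalar, reduceCtorEq,
          if_false, hcc]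
        rw [set_tab _ hj, replaceRow_swap hj]
      · simpa using hccM
      refine Runs.assign_seq' (extRow l (C i) x (ρ j)) hτ (by simp) fun hτ => ?_
      refine Runs.assign_seq' (extRow l (B i) b (ρ j)) hτ (hgb _ (by simp) (by simp)
        (by simp [hne.symm])) fun hτ => ?_
      refine Runs.store_seq (tab l (replaceRow B i fun q =>
        extRow l (B i) b ((ρ * Equiv.swap j l) q))) hτ ?_ ?_ fun hτ => ?_
      · rw [Expr.eval]
        simp only [eval_v, Frame.setScalar_array, Frame.setScalar_scalar, Frame.setArray_array,
          Frame.setArray_scalar, reduceCtorEq, hbτ, hclv, if_neg hne.symm, if_false, hrowτ, hjτ]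
        rw [← Nat.cast_add, ENat.toNat_natCast, set_tab _ hj, replaceRow_swap hj]
      · simpa using hclM
      refine Runs.assign' (x := extRow l (B i) b (ρ j)) hτ (by simp) ?_
      refine ⟨ρ * Equiv.swap j l, fun q hq => ?_, fun q hq => ?_, by simp, by simp,
        by simpa using hcM, by simpa using hbM, by simp [hne], by simp⟩
      · rw [Equiv.Perm.mul_apply, Equiv.swap_apply_of_ne_of_ne (by omega) (by omega), hρ q hq]
      · rw [Equiv.Perm.mul_apply, Equiv.Perm.mul_apply, Equiv.swap_apply_right]
        rcases Nat.lt_succ_iff_lt_or_eq.1 hq with hq | rfl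
        · rw [Equiv.swap_apply_of_ne_of_ne (by omega) (by omega)]
          exact (hmax q hq).trans h.le
        · rw [Equiv.swap_apply_left]; exact h.le
    · refine Runs.skip hτ ⟨ρ, hρ, fun q hq => ?_, by simpa using hcc, by simpa using hclv,
        by simpa using hccM, by simpa using hclM, hcτ, hbτ⟩
      rcases Nat.lt_succ_iff_lt_or_eq.1 hq with hq | rfl
      · exact hmax q hq
      · exact not_lt.1 h
  · rintro τ hτ hag ⟨-, ρ, h1, h2, -, -, -, -, h3, h4⟩
    exact ⟨ρ, h1, h2, h3, h4⟩

end Domset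

namespace Domset

variable {n : ℕ} {I : Input n} {Λ : Limits n} {σ : Frame} {κ l : ℕ}

theorem eq_eval_ne_zero {a b : ℕ∞} : (open Classical in if a = b then (1 : ℕ∞) else 0) ≠ 0 ↔
    a = b := by
  split_ifs with h <;> simp [h]

/-! The search for the best choice of entries. -/

/-- The number with the digits `J 0, …, J (m - 1)` to base `l`. -/
def digitsVal (l m : ℕ) (J : ℕ → ℕ) : ℕ := ∑ i ∈ Finset.range m, J i * l ^ i

theorem digitsVal_succ (l m : ℕ) (J : ℕ → ℕ) :
    digitsVal l (m + 1) J = digitsVal l m J + J m * l ^ m := Finset.sum_range_succ _ _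

theorem digitsVal_lt {m : ℕ} {J : ℕ → ℕ} (h : ∀ i < m, J i < l) : digitsVal l m J < l ^ m := by
  induction m with
  | zero => simp [digitsVal]
  | succ m ih =>
    have h1 := ih fun i hi => h i (by omega)
    have h2 : (J m + 1) * l ^ m ≤ l * l ^ m := Nat.mul_le_mul_right _ (h m (by omega))
    rw [digitsVal_succ, pow_succ]
    nlinarith

theorem digitsVal_inj {m : ℕ} {J J' : ℕ → ℕ} (h : ∀ i < m, J i < l) (h' : ∀ i < m, J' i < l)
    (he : digitsVal l m J = digitsVal l m J') : ∀ i < m, J i = J' i := by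
  induction m with
  | zero => simp
  | succ m ih =>
    have h1 := digitsVal_lt (l := l) (m := m) fun i hi => h i (by omega)
    have h2 := digitsVal_lt (l := l) (m := m) fun i hi => h' i (by omega)
    rw [digitsVal_succ, digitsVal_succ, add_comm, add_comm (digitsVal l m J')] at he
    have e1 := Nat.mul_add_div_mod (i := J m) h1
    have e2 := Nat.mul_add_div_mod (i := J' m) h2
    rw [he] at e1
    intro i hi
    rcases Nat.lt_succ_iff_lt_or_eq.1 hi with hi | rfl
    · exact ih (fun i hi => h i (by omega)) (fun i hi => h' i (by omega))
        (e1.2.symm.trans e2.2) i hi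
    · exact e1.1.symm.trans e2.1

/-- Stated with the old digit on the left-hand side to avoid truncated subtraction. -/
theorem digitsVal_update {m i : ℕ} {J : ℕ → ℕ} (hi : i < m) (a : ℕ) :
    digitsVal l m (Function.update J i a) + J i * l ^ i = digitsVal l m J + a * l ^ i := by
  have hmem := Finset.mem_range.2 hi
  unfold digitsVal
  rw [← Finset.add_sum_erase _ _ hmem, ← Finset.add_sum_erase _ (fun i => J i * l ^ i) hmem,
    Function.update_self]
  have : ∑ x ∈ (Finset.range m).erase i, Function.update J i a x * l ^ x =
      ∑ x ∈ (Finset.range m).erase i, J x * l ^ x :=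
    Finset.sum_congr rfl fun x hx => by rw [Function.update_of_ne (Finset.ne_of_mem_erase hx)]
  rw [this]; omega

/-- Two of the entries in the rows before row `m` that are chosen by `J` have the same label. -/
def Conflict (B : ℕ → ℕ → ℕ∞) (J : ℕ → ℕ) (m : ℕ) : Prop :=
  ∃ i < m, ∃ h < i, B h (J h) = B i (J i)

open Classical in
/-- The cost of the choice `J` of entries in the rows before row `m`. -/
noncomputable def choiceCost (C B : ℕ → ℕ → ℕ∞) (J : ℕ → ℕ) (m : ℕ) : ℕ∞ :=
  if Conflict B J m then ⊤ else ∑ i ∈ Finset.range m, C i (J i)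

theorem choiceCost_congr {C B : ℕ → ℕ → ℕ∞} {J J' : ℕ → ℕ} {m : ℕ} (h : ∀ i < m, J i = J' i) :
    choiceCost C B J m = choiceCost C B J' m := by
  unfold choiceCost
  have h1 : Conflict B J m ↔ Conflict B J' m := by
    constructor <;> rintro ⟨i, hi, k, hk, he⟩ <;> refine ⟨i, hi, k, hk, ?_⟩
    · rwa [← h i hi, ← h k (hk.trans hi)]
    · rwa [h i hi, h k (hk.trans hi)]
  have h2 : ∑ i ∈ Finset.range m, C i (J i) = ∑ i ∈ Finset.range m, C i (J' i) :=
    Finset.sum_congr rfl fun i hi => by rw [h i (Finset.mem_range.1 hi)]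
  by_cases h : Conflict B J m
  · rw [if_pos h, if_pos (h1.1 h)]
  · rw [if_neg h, if_neg (mt h1.2 h), h2]

/-- This mirrors the loop of the program: a conflict sets the sum to `∞`, and `∞` absorbs all later
additions. -/
theorem choiceCost_succ (C B : ℕ → ℕ → ℕ∞) (J : ℕ → ℕ) (m : ℕ) [Decidable
    (∃ h < m, B h (J h) = B m (J m))] :
    choiceCost C B J (m + 1) =
      if ∃ h < m, B h (J h) = B m (J m) then ⊤ else choiceCost C B J m + C m (J m) := by
  unfold choiceCost
  have h1 : Conflict B J (m + 1) ↔ (∃ h < m, B h (J h) = B m (J m)) ∨ Conflict B J m := by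
    constructor
    · rintro ⟨i, hi, h⟩
      rcases Nat.lt_succ_iff_lt_or_eq.1 hi with hi | rfl
      · exact .inr ⟨i, hi, h⟩
      · exact .inl h
    · rintro (h | ⟨i, hi, h⟩)
      · exact ⟨m, by omega, h⟩
      · exact ⟨i, by omega, h⟩
  by_cases ha : ∃ h < m, B h (J h) = B m (J m)
  · rw [if_pos (h1.2 (.inl ha)), if_pos ha]
  · by_cases hb : Conflict B J m
    · rw [if_pos (h1.2 (.inr hb)), if_neg ha, if_pos hb, top_add]
    · rw [if_neg (fun h => (h1.1 h).elim ha hb), if_neg ha, if_neg hb, Finset.sum_range_succ]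

/-- The value `x` is the least cost of a choice. -/
structure IsBestChoice (l : ℕ) (C B : ℕ → ℕ → ℕ∞) (x : ℕ∞) : Prop where
  le : ∀ J : ℕ → ℕ, (∀ i < l, J i < l) → x ≤ choiceCost C B J l
  eq : x = ⊤ ∨ ∃ J : ℕ → ℕ, (∀ i < l, J i < l) ∧ x = choiceCost C B J l

/-- The array `J` is an odometer, read as a number to base `l`. The invariant says that `best` is at
most the cost of every choice with a smaller number, and `l ^ l` minus the current number is the
variant. A finite sum has at most `l` summands of size at most `M`, which keeps the scalars in
range. -/
theorem runs_findMinSolution {tc tl : Arr} {C B : ℕ → ℕ → ℕ∞} (hcJ : tc ≠ .J) (hlJ : tl ≠ .J)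
    (hσ : σ.Fits Λ) (hl : σ.scalar .l = l) (hl0 : 0 < l)
    (hc : σ.array tc = tab l C) (hb : σ.array tl = tab l B)
    (hL : l * l ≤ Λ.L) (hM : l ≤ Λ.M) (hlM : l * Λ.M ≤ Λ.N) (hlK : l ≤ Λ.K) (hK : l ^ l ≤ Λ.K) :
    Runs I Λ κ (findMinSolution tc tl) σ fun τ =>
      IsBestChoice l C B (τ.scalar .best) ∧ (τ.scalar .best).toNat ≤ l * Λ.M := by
  have hlL : l ≤ Λ.L := (Nat.le_mul_self l).trans hL
  have hlN : l ≤ Λ.N := hlL.trans Λ.L_le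
  have hllN : l * l ≤ Λ.N := hL.trans Λ.L_le
  unfold findMinSolution
  refine Runs.assign_seq' ⊤ hσ rfl fun hσ => ?_
  refine Runs.clear_seq hσ fun hσ => ?_
  refine Runs.seq (Runs.forLoop l (fun i τ => τ.array .J = arr i fun _ => ((0 : ℕ) : ℕ∞)) hσ hlN
    hlK (fun τ hτ hag => ?_) (by simp) ?_) ?_
  · simpa [hl] using hag.scalar .l rfl
  · intro i hi τ hτ hag hiτ hJ
    refine Runs.push hτ rfl ?_ (by simp [Expr.eval]) ?_
    · simp [hJ]; omega
    · simp [hJ, arr_succ, Expr.eval]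
  rintro τ hτ hag ⟨-, hJτ⟩
  have hbestτ : τ.scalar .best = ⊤ := by simpa using hag.scalar .best rfl
  have hlτ : τ.scalar .l = l := by simpa [hl] using hag.scalar .l rfl
  have hcτ : τ.array tc = tab l C := by
    simpa [hc, hcJ] using hag.array tc (by simp [Cmd.writesArray, forLoop, hcJ.symm])
  have hbτ : τ.array tl = tab l B := by
    simpa [hb, hlJ] using hag.array tl (by simp [Cmd.writesArray, forLoop, hlJ.symm])
  clear hag
  refine Runs.assign_seq' (0 : ℕ) hτ rfl fun hτ => ?_
  refine Runs.loop (fun m υ => (υ.scalar .best).toNat ≤ l * Λ.M ∧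
    ((υ.scalar .carry = (0 : ℕ) ∧ ∃ J : ℕ → ℕ, (∀ i < l, J i < l) ∧
      υ.array .J = arr l (fun i => (J i : ℕ∞)) ∧ m = l ^ l - digitsVal l l J ∧
      (∀ J' : ℕ → ℕ, (∀ i < l, J' i < l) → digitsVal l l J' < digitsVal l l J →
        υ.scalar .best ≤ choiceCost C B J' l) ∧
      (υ.scalar .best = ⊤ ∨ ∃ J : ℕ → ℕ, (∀ i < l, J i < l) ∧
        υ.scalar .best = choiceCost C B J l)) ∨
    (υ.scalar .carry = (1 : ℕ) ∧ m = 0 ∧ IsBestChoice l C B (υ.scalar .best))))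
    (l ^ l) hK hτ ⟨by simp [hbestτ], .inl ⟨by simp, fun _ => 0, fun i hi => by omega,
      by simpa using hJτ, by simp [digitsVal], by simp [digitsVal], by simp [hbestτ]⟩⟩ ?_
  rintro m υ hυ hag ⟨hbM, ⟨hcar, J, hJl, hJ, hm, hbefore, hbest⟩ | ⟨hcar, hm, hbest⟩⟩
  swap
  · exact .inl ⟨by simp [Expr.eval, hcar], hbest, hbM⟩
  right
  refine ⟨by simp [Expr.eval, hcar], ?_⟩
  have hlυ : υ.scalar .l = l := by simpa [hlτ] using hag.scalar .l rfl
  have hcυ : υ.array tc = tab l C := by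
    simpa [hcτ, hcJ] using hag.array tc (by simp [Cmd.writesArray, forLoop, hcJ.symm])
  have hbυ : υ.array tl = tab l B := by
    simpa [hbτ, hlJ] using hag.array tl (by simp [Cmd.writesArray, forLoop, hlJ.symm])
  clear hag
  refine Runs.assign_seq' (0 : ℕ) hυ rfl fun hυ => ?_
  refine Runs.assign_seq' (0 : ℕ) hυ rfl fun hυ => ?_
  -- the cost of the choice `J`
  refine Runs.seq (R := fun ω => ω.scalar .sum = choiceCost C B J l ∧
    (ω.scalar .sum).toNat ≤ l * Λ.M) ?_ ?_
  · refine (Runs.forLoop l (fun i ω => ω.scalar .row = ((i * l : ℕ) : ℕ∞) ∧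
      ω.scalar .sum = choiceCost C B J i ∧ (ω.scalar .sum).toNat ≤ i * Λ.M) hυ hlN
      hlK (fun τ hτ hag => ?_) (by simp [choiceCost, Conflict]) ?_).mono fun _ _ _ h => h.2.2
    · simpa [hlυ] using hag.scalar .l rfl
    rintro i hi ω hω hag hiω ⟨hrow, hsum, hsM⟩
    have hlω : ω.scalar .l = l := by simpa [hlυ] using hag.scalar .l rfl
    have hJω : ω.array .J = arr l (fun i => (J i : ℕ∞)) := by simpa [hJ] using hag.array .J rfl
    have hcω : ω.array tc = tab l C := by simpa [hcυ] using hag.array tc rfl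
    have hbω : ω.array tl = tab l B := by simpa [hbυ] using hag.array tl rfl
    clear hag
    have hidx : ((v .row).add (.get .J (v .i))).eval I ω = ((i * l + J i : ℕ) : ℕ∞) := by
      simp only [Expr.eval, eval_v, hrow, hiω, ENat.toNat_natCast, hJω]
      rw [getD_arr _ hi, Nat.cast_add]
    have hget : (Expr.get tc ((v .row).add (.get .J (v .i)))).eval I ω = C i (J i) := by
      rw [Expr.eval, hidx, ENat.toNat_natCast, hcω, getD_tab _ hi (hJl i hi)]
    have hCM : (C i (J i)).toNat ≤ Λ.M := by rw [← hget]; exact hω.getD_le _ _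
    have hsM' : (ω.scalar .sum + C i (J i)).toNat ≤ (i + 1) * Λ.M := by
      refine (ENat.toNat_add_le _ _).trans ?_
      rw [add_mul, one_mul]; omega
    have hiM : (i + 1) * Λ.M ≤ l * Λ.M := Nat.mul_le_mul_right _ hi
    refine Runs.assign_seq (choiceCost C B J i + C i (J i)) hω
      (by rw [Expr.eval, hget, eval_v, hsum]) (by rw [← hsum]; omega) fun hω => ?_
    refine Runs.assign_seq' (0 : ℕ) hω rfl fun hω => ?_
    refine Runs.seq (R := fun ψ => ψ.scalar .sum = choiceCost C B J (i + 1) ∧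
      (ψ.scalar .sum).toNat ≤ (i + 1) * Λ.M) ?_ ?_
    · refine (Runs.forLoop i (fun h ψ => ψ.scalar .row2 = ((h * l : ℕ) : ℕ∞) ∧
        ψ.scalar .sum = (open Classical in if ∃ h' < h, B h' (J h') = B i (J i) then ⊤ else
          choiceCost C B J i + C i (J i)) ∧ (ψ.scalar .sum).toNat ≤ (i + 1) * Λ.M) hω (by omega)
        (by omega) (fun τ hτ hag => ?_) ?_ ?_).mono ?_
      · simpa [hiω] using hag.scalar .i rfl
      · rw [hsum] at hsM'
        simpa using hsM'
      · rintro h hh ψ hψ hag hhψ ⟨hrow2, hsumψ, hsMψ⟩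
        have hlψ : ψ.scalar .l = l := by simpa [hlω] using hag.scalar .l rfl
        have hiψ : ψ.scalar .i = i := by simpa [hiω] using hag.scalar .i rfl
        have hrowψ : ψ.scalar .row = ((i * l : ℕ) : ℕ∞) := by
          simpa [hrow] using hag.scalar .row rfl
        have hJψ : ψ.array .J = arr l (fun i => (J i : ℕ∞)) := by simpa [hJω] using hag.array .J rfl
        have hbψ : ψ.array tl = tab l B := by simpa [hbω] using hag.array tl rfl
        have hhl : h < l := hh.trans hi
        have hidx1 : ((v .row2).add (.get .J (v .h))).eval I ψ = ((h * l + J h : ℕ) : ℕ∞) := by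
          simp only [Expr.eval, eval_v, hrow2, hhψ, ENat.toNat_natCast, hJψ]
          rw [getD_arr _ hhl, Nat.cast_add]
        have hidx2 : ((v .row).add (.get .J (v .i))).eval I ψ = ((i * l + J i : ℕ) : ℕ∞) := by
          simp only [Expr.eval, eval_v, hrowψ, hiψ, ENat.toNat_natCast, hJψ]
          rw [getD_arr _ hi, Nat.cast_add]
        have hsplit : (∃ h' < h + 1, B h' (J h') = B i (J i)) ↔
            B h (J h) = B i (J i) ∨ ∃ h' < h, B h' (J h') = B i (J i) := by
          constructor
          · rintro ⟨q, hq, h⟩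
            rcases Nat.lt_succ_iff_lt_or_eq.1 hq with hq | rfl
            · exact .inr ⟨q, hq, h⟩
            · exact .inl h
          · rintro (h' | ⟨q, hq, h'⟩)
            · exact ⟨h, by omega, h'⟩
            · exact ⟨q, by omega, h'⟩
        refine Runs.seq (R := fun ψ => ψ.scalar .sum = (open Classical in
          if ∃ h' < h + 1, B h' (J h') = B i (J i) then ⊤ else
          choiceCost C B J i + C i (J i)) ∧ (ψ.scalar .sum).toNat ≤ (i + 1) * Λ.M)
          (Runs.ite (B h (J h) = B i (J i)) hψ ?_ (fun heq => ?_) (fun heq => ?_)) ?_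
        · rw [Expr.eval, Expr.eval, hidx1, Expr.eval, hidx2, ENat.toNat_natCast,
            ENat.toNat_natCast, hbψ, getD_tab _ hi (hJl i hi), getD_tab _ hhl (hJl h hhl)]
          split_ifs with h <;> simp [h]
        · refine Runs.assign' (x := ⊤) hψ rfl ?_
          rw [if_pos (hsplit.2 (.inl heq))]
          simp
        · refine Runs.skip hψ ?_
          simp only [hsplit, heq, false_or]
          exact ⟨hsumψ, hsMψ⟩
        · rintro φ hφ hag' ⟨h1, h2⟩
          have hlφ := (hag'.scalar .l rfl).trans hlψ
          have hrow2φ := (hag'.scalar .row2 rfl).trans hrow2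
          have hle : (h + 1) * l ≤ l * l := Nat.mul_le_mul_right _ hhl
          refine Runs.assign (x := (((h + 1) * l : ℕ) : ℕ∞)) hφ
            (by simp [Expr.eval, hlφ, hrow2φ, add_mul])
            (by rw [ENat.toNat_natCast]; omega) ?_
          exact ⟨by simp, by simpa using h1, by simpa using h2⟩
      · rintro ψ hψ hag ⟨-, -, h1, h2⟩
        classical
        rw [choiceCost_succ]
        refine ⟨by convert h1, h2⟩
    · rintro ψ hψ hag ⟨h1, h2⟩
      have hlψ : ψ.scalar .l = l := by simpa [hlω] using hag.scalar .l rfl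
      have hrowψ : ψ.scalar .row = ((i * l : ℕ) : ℕ∞) := by
        simpa [hrow] using hag.scalar .row rfl
      have hle : (i + 1) * l ≤ l * l := Nat.mul_le_mul_right _ hi
      refine Runs.assign (x := (((i + 1) * l : ℕ) : ℕ∞)) hψ
        (by simp [Expr.eval, hlψ, hrowψ, add_mul])
        (by rw [ENat.toNat_natCast]; omega) ?_
      exact ⟨by simp, by simpa using h1, by simpa using h2⟩
  rintro ω hω hag ⟨hsum, hsumM⟩
  have hlω : ω.scalar .l = l := by simpa [hlυ] using hag.scalar .l rfl
  have hbestω : ω.scalar .best = υ.scalar .best := by simpa using hag.scalar .best rfl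
  have hJω : ω.array .J = arr l (fun i => (J i : ℕ∞)) := by simpa [hJ] using hag.array .J rfl
  clear hag
  refine Runs.seq (R := fun ω => (ω.scalar .best).toNat ≤ l * Λ.M ∧
    (∀ J' : ℕ → ℕ, (∀ i < l, J' i < l) → digitsVal l l J' ≤ digitsVal l l J →
        ω.scalar .best ≤ choiceCost C B J' l) ∧
      (ω.scalar .best = ⊤ ∨ ∃ J : ℕ → ℕ, (∀ i < l, J i < l) ∧
        ω.scalar .best = choiceCost C B J l)) ?_ ?_
  · have hle : ∀ J' : ℕ → ℕ, (∀ i < l, J' i < l) → digitsVal l l J' ≤ digitsVal l l J →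
        min (choiceCost C B J l) (υ.scalar .best) ≤ choiceCost C B J' l := by
      intro J' hJ' hle
      rcases hle.lt_or_eq with hlt | heq
      · exact (min_le_right _ _).trans (hbefore J' hJ' hlt)
      -- Choices with equal numbers have equal digits below `l`, hence equal costs.
      · rw [choiceCost_congr (digitsVal_inj hJ' hJl heq)]; exact min_le_left _ _
    refine Runs.ite (ω.scalar .sum < ω.scalar .best) hω ?_ (fun h => ?_) (fun h => ?_)
    · simp only [Expr.eval, eval_v]; exact natCast_lt_eval_ne_zero
    · refine Runs.assign' hω (x := ω.scalar .sum) rfl ?_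
      rw [hsum, hbestω] at h
      simp only [Frame.setScalar_scalar, if_true]
      refine ⟨hsumM, fun J' hJ' hle' => ?_, .inr ⟨J, hJl, hsum⟩⟩
      rw [hsum]
      simpa [h.le] using hle J' hJ' hle'
    · refine Runs.skip hω ?_
      rw [hsum, hbestω] at h
      rw [hbestω]
      refine ⟨hbM, fun J' hJ' hle' => ?_, hbest⟩
      simpa [not_lt.1 h] using hle J' hJ' hle'
  rintro ψ hψ hag ⟨hbM', hbefore', hbest'⟩
  have hlψ : ψ.scalar .l = l := (hag.scalar .l rfl).trans hlω
  have hJψ : ψ.array .J = arr l (fun i => (J i : ℕ∞)) := (hag.array .J rfl).trans hJω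
  clear hag
  refine Runs.assign_seq' (1 : ℕ) hψ rfl fun hψ => ?_
  refine Runs.assign_seq' (0 : ℕ) hψ rfl fun hψ => ?_
  -- Addition of one with carry. While the carry is pending at digit `i`, all lower digits are `0`
  -- and the missing amount is `l ^ i`. The carry leaves the last digit exactly when the old number
  -- was `l ^ l - 1`.
  refine (Runs.loop (Q := fun φ =>
      (φ.scalar .carry = (0 : ℕ) ∧ ∃ J' : ℕ → ℕ, (∀ i < l, J' i < l) ∧
      φ.array .J = arr l (fun i => (J' i : ℕ∞)) ∧ digitsVal l l J' = digitsVal l l J + 1) ∨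
      (φ.scalar .carry = (1 : ℕ) ∧ digitsVal l l J + 1 = l ^ l))
    (fun r φ => ∃ J' : ℕ → ℕ, (∀ i < l, J' i < l) ∧
      φ.array .J = arr l (fun i => (J' i : ℕ∞)) ∧
      ((φ.scalar .carry = (0 : ℕ) ∧ r = 0 ∧ digitsVal l l J' = digitsVal l l J + 1) ∨
      (φ.scalar .carry = (1 : ℕ) ∧ ∃ i ≤ l, r = l - i ∧ φ.scalar .i = (i : ℕ) ∧
        (∀ q < i, J' q = 0) ∧ digitsVal l l J' + l ^ i = digitsVal l l J + 1)))
    l hlK hψ ⟨J, hJl, by simpa using hJψ, .inr ⟨by simp, 0, by simp⟩⟩ ?_).mono ?_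
  · rintro r φ hφ hag ⟨J', hJ'l, hJ'φ, ⟨hcar, hr, hval⟩ | ⟨hcar, i, hil, hr, hi, hz, hval⟩⟩
    · refine .inl ⟨?_, .inl ⟨hcar, J', hJ'l, hJ'φ, hval⟩⟩
      by_cases h : φ.scalar .i < φ.scalar .l <;> simp [Expr.eval, hcar, h]
    have hlφ : φ.scalar .l = l := by simpa [hlψ] using hag.scalar .l rfl
    rcases hil.eq_or_lt with rfl | hil
    · left
      refine ⟨by simp [Expr.eval, hcar, hi, hlφ], .inr ⟨hcar, ?_⟩⟩
      have : digitsVal i i J' = 0 := Finset.sum_eq_zero fun q hq => by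
        rw [hz q (Finset.mem_range.1 hq), zero_mul]
      omega
    right
    refine ⟨by simp [Expr.eval, hcar, hi, hlφ, hil]; norm_num, ?_⟩
    have hJi := hJ'l i hil
    refine Runs.store_seq (arr l fun q => (Function.update J' i (J' i + 1) q : ℕ)) hφ ?_ ?_
      fun hφ => ?_
    · simp only [Expr.eval, eval_v, hi, hJ'φ, ENat.toNat_natCast]
      rw [getD_arr _ hil, set_arr]
      refine arr_congr fun q hq => ?_
      simp only [Function.update_apply]; split_ifs <;> simp
    · simp only [Expr.eval, eval_v, hi, hJ'φ, ENat.toNat_natCast]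
      rw [getD_arr _ hil, ← Nat.cast_one, ← Nat.cast_add, ENat.toNat_natCast]; omega
    refine Runs.ite (J' i + 1 = l) hφ ?_ (fun heq => ?_) (fun hneq => ?_)
    · simp only [Expr.eval, eval_v, Frame.setArray_scalar, Frame.setArray_array, if_true, hi, hlφ,
        ENat.toNat_natCast]
      rw [getD_arr _ hil, Function.update_self, eq_eval_ne_zero, Nat.cast_inj]
    · refine Runs.store_seq (arr l fun q => (Function.update J' i 0 q : ℕ)) hφ ?_
        (by simp [Expr.eval]) fun hφ => ?_
      · simp only [Expr.eval, eval_v, Frame.setArray_scalar, Frame.setArray_array, if_true, hi,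
          ENat.toNat_natCast]
        rw [set_arr]
        refine arr_congr fun q hq => ?_
        simp only [Function.update_apply]; split_ifs <;> simp
      · refine Runs.assign (x := ((i + 1 : ℕ) : ℕ∞)) hφ (by simp [Expr.eval, hi])
          (by rw [ENat.toNat_natCast]; omega) ?_
        refine ⟨l - (i + 1), by omega, Function.update J' i 0, fun q hq => ?_, by simp,
          .inr ⟨by simpa using hcar, i + 1, hil, rfl, by simp, fun q hq => ?_, ?_⟩⟩
        · rw [Function.update_apply]; split_ifs; exacts [hl0, hJ'l q hq]
        · rw [Function.update_apply]; split_ifs; exacts [rfl, hz q (by omega)]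
        · have h1 := digitsVal_update (l := l) (J := J') hil 0
          -- The digit overflows when it is `l - 1`: resetting it loses `J' i * l ^ i`, and together
          -- with the pending `l ^ i` this is one unit of the next digit.
          have h2 : l ^ (i + 1) = J' i * l ^ i + l ^ i := by
            rw [pow_succ, mul_comm, ← heq]; ring_nf
          omega
    · refine Runs.assign' (x := (0 : ℕ)) hφ rfl ?_
      refine ⟨0, by omega, Function.update J' i (J' i + 1), fun q hq => ?_, by simp,
        .inl ⟨by simp, rfl, ?_⟩⟩
      · rw [Function.update_apply]; split_ifs; exacts [by omega, hJ'l q hq]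
      · have h1 := digitsVal_update (l := l) (J := J') hil (J' i + 1)
        rw [add_mul, one_mul] at h1
        omega
  · rintro φ hφ hag hφ'
    have hb : φ.scalar .best = ψ.scalar .best := by simpa using hag.scalar .best rfl
    rw [hb]
    have hlt := digitsVal_lt hJl
    rcases hφ' with ⟨hcar, J', hJ'l, hJ', hval⟩ | ⟨hcar, hval⟩
    · refine ⟨l ^ l - digitsVal l l J', by omega, hbM', .inl ⟨hcar, J', hJ'l, hJ', rfl,
        fun J'' h1 h2 => hbefore' J'' h1 (by omega), hbest'⟩⟩
    · refine ⟨0, by omega, hbM', .inr ⟨hcar, rfl, fun J' hJ' => hbefore' J' hJ' ?_, hbest'⟩⟩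
      have := digitsVal_lt hJ'
      omega

end Domset

/-! ### Subtrees of a rooted forest. -/

namespace RootedForest

variable {n : ℕ} (F : RootedForest (Fin n))

open Classical in
/-- The descendants of `x`, including `x`. -/
noncomputable def subtree (x : Fin n) : Finset (Fin n) :=
  Finset.univ.filter fun v => v = x ∨ F.Ancestor x v

variable {F}

theorem mem_subtree {x v : Fin n} : v ∈ F.subtree x ↔ v = x ∨ F.Ancestor x v := by
  simp [subtree]

theorem self_mem_subtree (x : Fin n) : x ∈ F.subtree x := mem_subtree.2 (.inl rfl)

theorem not_ancestor_self (x : Fin n) : ¬ F.Ancestor x x := fun h =>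
  F.acyclic.transGen.irrefl.irrefl x h

theorem mem_subtree_iff {x v : Fin n} :
    v ∈ F.subtree x ↔ v = x ∨ ∃ y, F.parent y = some x ∧ v ∈ F.subtree y := by
  simp only [mem_subtree]
  refine or_congr_right ⟨fun h => ?_, ?_⟩
  · rcases Relation.TransGen.head'_iff.1 h with ⟨y, hy, h⟩
    refine ⟨y, hy, ?_⟩
    rcases Relation.reflTransGen_iff_eq_or_transGen.1 h with h | h
    · exact .inl h
    · exact .inr h
  · rintro ⟨y, hy, rfl | h⟩
    · exact .single hy
    · exact .head hy h

theorem mem_subtree_trans {x y z : Fin n} (h : y ∈ F.subtree x) (h' : z ∈ F.subtree y) :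
    z ∈ F.subtree x := by
  rw [mem_subtree] at *
  rcases h with rfl | h
  · exact h'
  · rcases h' with rfl | h'
    · exact .inr h
    · exact .inr (h.trans h')

/-- Parents are unique, so two nodes with a common descendant lie on one upward path and are
comparable. Two different children of `x` cannot be comparable, as `x` would then be its own proper
ancestor. -/
theorem eq_of_mem_subtree {x y y' v : Fin n} (hy : F.parent y = some x) (hy' : F.parent y' = some x)
    (h : v ∈ F.subtree y) (h' : v ∈ F.subtree y') : y = y' := by
  have key : ∀ z z', F.parent z = some x → F.parent z' = some x →
      Relation.ReflTransGen (fun a b => F.parent b = some a) z z' → z = z' := by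
    intro z z' hz hz' h
    rcases Relation.ReflTransGen.cases_tail h with h | ⟨w, h1, h2⟩
    · exact h.symm
    · rw [hz'] at h2
      obtain rfl : x = w := Option.some.inj h2
      exact (not_ancestor_self x (Relation.TransGen.head' hz h1)).elim
  have conv : ∀ z, v ∈ F.subtree z → Relation.ReflTransGen (fun a b => F.parent b = some a) z v :=
    fun z hz => by
      rcases mem_subtree.1 hz with rfl | hz
      · exact .refl
      · exact hz.to_reflTransGen
  have hU : Relator.RightUnique (Function.swap fun a b : Fin n => F.parent b = some a) :=
    fun a b c hb hc => Option.some.inj (hb.symm.trans hc)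
  rcases Relation.ReflTransGen.total_of_right_unique hU
    (Relation.reflTransGen_swap.2 (conv y h)) (Relation.reflTransGen_swap.2 (conv y' h')) with h | h
  · exact (key _ _ hy' hy (Relation.reflTransGen_swap.1 h)).symm
  · exact key _ _ hy hy' (Relation.reflTransGen_swap.1 h)

theorem not_mem_subtree_child {x y : Fin n} (hy : F.parent y = some x) : x ∉ F.subtree y := by
  intro h
  rcases mem_subtree.1 h with rfl | h
  · exact not_ancestor_self x (.single hy)
  · exact not_ancestor_self x (.head hy h)

end RootedForest

/-! ### Children by index, and the decomposition of a subtree. -/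

namespace Domset

variable {n : ℕ}

/-- The number of children. -/
def Input.deg (I : Input n) (x : Fin n) : ℕ := (I.children x).length

/-- The child with index `c`. -/
def Input.kid (I : Input n) (x : Fin n) (c : ℕ) : Fin n := (I.children x).getD c x

section kid

variable {I : Input n} {x : Fin n}

theorem Input.kid_eq {c : ℕ} (hc : c < I.deg x) : I.kid x c = (I.children x)[c]'hc :=
  List.getD_eq_getElem _ _ hc

theorem Input.degQuery_eq (I : Input n) (x : Fin n) : I.degQuery x = I.deg x := by
  simp [Input.degQuery, Input.deg]

theorem Input.childQuery_eq {c : ℕ} (hc : c < I.deg x) : I.childQuery x c = I.kid x c := by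
  rw [Input.kid_eq hc]
  simp only [Input.deg] at hc
  simp [Input.childQuery, hc]

theorem Input.parent_kid {c : ℕ} (hc : c < I.deg x) : I.forest.parent (I.kid x c) = some x := by
  rw [Input.kid_eq hc, ← I.mem_children]
  exact List.getElem_mem _

theorem Input.exists_kid {y : Fin n} (h : I.forest.parent y = some x) :
    ∃ c < I.deg x, I.kid x c = y := by
  rw [← I.mem_children] at h
  obtain ⟨c, hc, rfl⟩ := List.getElem_of_mem h
  exact ⟨c, hc, Input.kid_eq hc⟩

theorem Input.kid_inj {c c' : ℕ} (hc : c < I.deg x) (hc' : c' < I.deg x)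
    (h : I.kid x c = I.kid x c') : c = c' := by
  rw [Input.kid_eq hc, Input.kid_eq hc'] at h
  exact (I.nodup_children x).getElem_inj_iff.1 h

theorem Input.mem_subtree_iff {v : Fin n} : v ∈ I.forest.subtree x ↔
    v = x ∨ ∃ c < I.deg x, v ∈ I.forest.subtree (I.kid x c) := by
  rw [RootedForest.mem_subtree_iff]
  refine or_congr_right ⟨?_, ?_⟩
  · rintro ⟨y, hy, h⟩
    obtain ⟨c, hc, rfl⟩ := Input.exists_kid hy
    exact ⟨c, hc, h⟩
  · rintro ⟨c, hc, h⟩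
    exact ⟨_, Input.parent_kid hc, h⟩

theorem Input.kid_unique {c c' : ℕ} (hc : c < I.deg x) (hc' : c' < I.deg x) {v : Fin n}
    (h : v ∈ I.forest.subtree (I.kid x c)) (h' : v ∈ I.forest.subtree (I.kid x c')) : c = c' :=
  Input.kid_inj hc hc' (RootedForest.eq_of_mem_subtree (Input.parent_kid hc) (Input.parent_kid hc')
    h h')

theorem Input.not_mem_subtree_kid {c : ℕ} (hc : c < I.deg x) :
    x ∉ I.forest.subtree (I.kid x c) :=
  RootedForest.not_mem_subtree_child (Input.parent_kid hc)

theorem Input.subtree_eq (I : Input n) (x : Fin n) : I.forest.subtree x =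
    insert x ((Finset.range (I.deg x)).biUnion fun c => I.forest.subtree (I.kid x c)) := by
  ext v
  rw [Input.mem_subtree_iff]; simp

/-- The subtree is the disjoint union of `{x}` and the subtrees of the children. This is the source
of the additivity of sizes and of costs. -/
theorem Input.sum_card_inter (I : Input n) (x : Fin n) {X : Finset (Fin n)}
    (hX : X ⊆ I.forest.subtree x) :
    ∑ c ∈ Finset.range (I.deg x), (X ∩ I.forest.subtree (I.kid x c)).card + (X ∩ {x}).card =
      X.card := by
  rw [← Finset.card_biUnion, ← Finset.card_union_of_disjoint]
  · congr 1
    ext v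
    simp only [Finset.mem_union, Finset.mem_biUnion, Finset.mem_range, Finset.mem_inter,
      Finset.mem_singleton]
    constructor
    · rintro (⟨c, hc, h, -⟩ | ⟨h, -⟩) <;> exact h
    · intro h
      rcases Input.mem_subtree_iff.1 (hX h) with h' | ⟨c, hc, h'⟩
      · exact .inr ⟨h, h'⟩
      · exact .inl ⟨c, hc, h, h'⟩
  · rw [Finset.disjoint_left]
    simp only [Finset.mem_biUnion, Finset.mem_range, Finset.mem_inter, Finset.mem_singleton]
    rintro v ⟨c, hc, -, h⟩ ⟨-, rfl⟩
    exact Input.not_mem_subtree_kid hc h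
  · intro c hc c' hc' hne
    rw [Function.onFun, Finset.disjoint_left]
    simp only [Finset.mem_inter]
    rintro v ⟨-, h⟩ ⟨-, h'⟩
    exact hne (Input.kid_unique (Finset.mem_range.1 hc) (Finset.mem_range.1 hc') h h')

theorem Input.card_subtree (I : Input n) (x : Fin n) : (I.forest.subtree x).card =
    ∑ c ∈ Finset.range (I.deg x), (I.forest.subtree (I.kid x c)).card + 1 := by
  have h := I.sum_card_inter x (Finset.Subset.refl (I.forest.subtree x))
  rw [← h]
  congr 1
  · refine Finset.sum_congr rfl fun c hc => ?_
    rw [Finset.inter_eq_right.2]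
    intro v hv
    exact Input.mem_subtree_iff.2 (.inr ⟨c, Finset.mem_range.1 hc, hv⟩)
  · rw [Finset.inter_singleton_of_mem (RootedForest.self_mem_subtree x), Finset.card_singleton]

end kid

/-! The cost of dominating a subtree. -/

/-- The vertex `v` is in the closed neighbourhood of `S`. -/
def Dominates (I : Input n) (S : Set (Fin n)) (v : Fin n) : Prop :=
  ∃ u ∈ S, v = u ∨ I.graph.Adj v u

theorem Dominates.mono {I : Input n} {S S' : Set (Fin n)} {v : Fin n} (h : Dominates I S v)
    (hS : S ⊆ S') : Dominates I S' v :=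
  let ⟨u, hu, h⟩ := h; ⟨u, hS hu, h⟩

/-- The set `X` of descendants of `x` dominates together with `D` the descendants of `x` and the
set `P`. -/
structure Feasible (I : Input n) (x : Fin n) (P D : Set (Fin n)) (X : Finset (Fin n)) : Prop where
  subset : X ⊆ I.forest.subtree x
  dom : ∀ w, w ∈ I.forest.subtree x ∨ w ∈ P → Dominates I (D ∪ X) w

/-- The least size of a feasible set. -/
noncomputable def domCost (I : Input n) (x : Fin n) (P D : Set (Fin n)) : ℕ∞ :=
  sInf {c | ∃ X, Feasible I x P D X ∧ c = (X.card : ℕ)}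

section domCost

variable {I : Input n} {x : Fin n} {P P' D : Set (Fin n)} {X : Finset (Fin n)}

theorem Feasible.domCost_le (h : Feasible I x P D X) : domCost I x P D ≤ X.card :=
  sInf_le ⟨X, h, rfl⟩

/-- Infima of nonempty sets in `ℕ∞` are attained, and the empty set has infimum `⊤`. -/
theorem exists_feasible (h : domCost I x P D ≠ ⊤) :
    ∃ X, Feasible I x P D X ∧ domCost I x P D = X.card := by
  have hne : {c : ℕ∞ | ∃ X, Feasible I x P D X ∧ c = (X.card : ℕ)}.Nonempty := by
    by_contra h0
    rw [Set.not_nonempty_iff_eq_empty] at h0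
    exact h (by rw [domCost, h0, sInf_empty])
  exact csInf_mem hne

theorem domCost_mono (h : P ⊆ P') : domCost I x P D ≤ domCost I x P' D :=
  sInf_le_sInf fun _ ⟨X, hX, hc⟩ => ⟨X, ⟨hX.subset, fun w hw => hX.dom w (hw.imp_right (@h w))⟩, hc⟩

theorem domCost_empty_le : domCost I x ∅ D ≤ (I.forest.subtree x).card :=
  Feasible.domCost_le ⟨Finset.Subset.refl _, fun w hw =>
    ⟨w, .inr (Finset.mem_coe.2 (by simpa using hw)), .inl rfl⟩⟩

theorem toNat_domCost_le : (domCost I x P D).toNat ≤ (I.forest.subtree x).card := by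
  by_cases h : domCost I x P D = ⊤
  · simp [h]
  · obtain ⟨X, hX, he⟩ := exists_feasible h
    rw [he, ENat.toNat_natCast]
    exact Finset.card_le_card hX.subset

/-- Take a cheapest set for the subtree alone and add one dominator for each vertex of `P`. The
bound on the difference does not depend on the size of the subtree, which is why overhead costs fit
into `O(log t)` bits. -/
theorem domCost_le_add {A : Finset (Fin n)} (hA : P ⊆ A) (h : domCost I x P D ≠ ⊤) :
    domCost I x P D ≤ domCost I x ∅ D + A.card := by
  classical
  obtain ⟨X, hX, -⟩ := exists_feasible h
  obtain ⟨X₀, hX₀, he⟩ := exists_feasible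
    (ne_top_of_le_ne_top h (domCost_mono (Set.empty_subset P)))
  choose d hd hd' using fun w : {w // w ∈ P} => hX.dom w (.inr w.2)
  let f : Fin n → Fin n := fun w => if hw : w ∈ P then d ⟨w, hw⟩ else w
  -- Intersecting with `X` drops the dominators that lie in `D` only, so that the new set stays
  -- inside the subtree.
  have hF : Feasible I x P D (X₀ ∪ A.image f ∩ X) := by
    refine ⟨Finset.union_subset hX₀.subset (Finset.inter_subset_right.trans hX.subset), ?_⟩
    rintro w (hw | hw)
    · refine (hX₀.dom w (.inl hw)).mono (Set.union_subset_union_right _ ?_)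
      simp
    · refine ⟨d ⟨w, hw⟩, ?_, hd' ⟨w, hw⟩⟩
      refine (hd ⟨w, hw⟩).imp_right fun h => ?_
      have : d ⟨w, hw⟩ ∈ A.image f := Finset.mem_image.2 ⟨w, hA hw, dif_pos hw⟩
      have h' : d ⟨w, hw⟩ ∈ X := h
      exact Finset.mem_coe.2 (Finset.mem_union_right _ (Finset.mem_inter.2 ⟨this, h'⟩))
  refine hF.domCost_le.trans ?_
  rw [he, ← Nat.cast_add, Nat.cast_le]
  refine (Finset.card_union_le _ _).trans (Nat.add_le_add_left ?_ _)
  exact (Finset.card_le_card Finset.inter_subset_left).trans Finset.card_image_le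

-- The subtree is `{x}`, so the only candidates are `∅` and `{x}`, and in the second case `x`
-- dominates itself.
open Classical in
theorem domCost_leaf (h : I.deg x = 0) : domCost I x P D =
    if ∀ w, w = x ∨ w ∈ P → Dominates I D w then 0
    else if ∀ w ∈ P, Dominates I (D ∪ {x}) w then 1 else ⊤ := by
  have hsub : I.forest.subtree x = {x} := by rw [I.subtree_eq, h]; simp
  split_ifs with h1 h2
  · have : Feasible I x P D ∅ := ⟨by simp, by simpa [hsub] using h1⟩
    simpa using this.domCost_le
  · have : Feasible I x P D {x} := by
      refine ⟨by simp [hsub], fun w hw => ?_⟩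
      rcases hw with hw | hw
      · exact ⟨x, by simp, .inl (by simpa [hsub] using hw)⟩
      · simpa using h2 w hw
    refine le_antisymm (by simpa using this.domCost_le) ?_
    by_contra hlt
    have hlt := not_le.1 hlt
    obtain ⟨X, hX, he⟩ := exists_feasible hlt.ne_top
    rw [he, ← Nat.cast_one, Nat.cast_lt, Nat.lt_one_iff, Finset.card_eq_zero] at hlt
    subst hlt
    exact h1 (by simpa [hsub] using hX.dom)
  · by_contra htop
    obtain ⟨X, hX, -⟩ := exists_feasible htop
    refine h2 fun w hw => (hX.dom w (.inr hw)).mono (Set.union_subset_union_right _ ?_)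
    have := hX.subset
    rw [hsub] at this
    exact_mod_cast this

/-- Feasible sets for the subtrees of the children can be combined. -/
theorem domCost_le_sum {E : Finset (Fin n)} (hE : E ⊆ {x}) {S : ℕ → Set (Fin n)}
    (hS : ∀ w ∈ insert x P, ∃ c < I.deg x, w ∈ S c) :
    domCost I x P D ≤
      ∑ c ∈ Finset.range (I.deg x), domCost I (I.kid x c) (S c) (D ∪ E) + E.card := by
  classical
  -- If one child has infinite cost, the right-hand side is infinite. Otherwise the union of optimal
  -- sets for the children and `E` is feasible.
  by_cases htop : ∃ c ∈ Finset.range (I.deg x), domCost I (I.kid x c) (S c) (D ∪ E) = ⊤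
  · obtain ⟨c, hc, h⟩ := htop
    have : ∑ c ∈ Finset.range (I.deg x), domCost I (I.kid x c) (S c) (D ∪ E) = ⊤ :=
      WithTop.sum_eq_top.2 ⟨c, hc, h⟩
    rw [this, top_add]; exact le_top
  · push Not at htop
    have hex : ∀ c, ∃ X, c ∈ Finset.range (I.deg x) → Feasible I (I.kid x c) (S c) (D ∪ E) X ∧
        domCost I (I.kid x c) (S c) (D ∪ E) = X.card := fun c => by
      by_cases hc : c ∈ Finset.range (I.deg x)
      · obtain ⟨X, hX⟩ := exists_feasible (htop c hc)
        exact ⟨X, fun _ => hX⟩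
      · exact ⟨∅, fun h => (hc h).elim⟩
    choose X hX using hex
    have hF : Feasible I x P D ((Finset.range (I.deg x)).biUnion X ∪ E) := by
      have hdom : ∀ c ∈ Finset.range (I.deg x), ∀ w, w ∈ I.forest.subtree (I.kid x c) ∨ w ∈ S c →
          Dominates I (D ∪ ((Finset.range (I.deg x)).biUnion X ∪ E : Finset (Fin n))) w := by
        intro c hc w hw
        refine ((hX c hc).1.dom w hw).mono ?_
        rintro u ((hu | hu) | hu)
        · exact .inl hu
        · exact .inr (by simp at hu; simp [hu])
        · refine .inr (Finset.mem_coe.2 (Finset.mem_union_left _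
            (Finset.mem_biUnion.2 ⟨c, hc, hu⟩)))
      constructor
      · refine Finset.union_subset (Finset.biUnion_subset.2 fun c hc w hw => ?_) fun w hw => ?_
        · exact Input.mem_subtree_iff.2 (.inr ⟨c, Finset.mem_range.1 hc, (hX c hc).1.subset hw⟩)
        · rw [Finset.mem_singleton.1 (hE hw)]; exact RootedForest.self_mem_subtree x
      · intro w hw
        have hw' : w ∈ insert x P ∨ ∃ c < I.deg x, w ∈ I.forest.subtree (I.kid x c) := by
          rw [Input.mem_subtree_iff] at hw
          rw [Set.mem_insert_iff]; tauto
        rcases hw' with hw | ⟨c, hc, hw⟩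
        · obtain ⟨c, hc, hw⟩ := hS w hw
          exact hdom c (Finset.mem_range.2 hc) w (.inr hw)
        · exact hdom c (Finset.mem_range.2 hc) w (.inl hw)
    refine hF.domCost_le.trans ?_
    rw [Finset.sum_congr rfl fun c hc => (hX c hc).2, ← Nat.cast_sum, ← Nat.cast_add, Nat.cast_le]
    exact (Finset.card_union_le _ _).trans (Nat.add_le_add_right Finset.card_biUnion_le _)

/-- A feasible set can be split, where every vertex of `P` is assigned to a child in whose subtree
it is dominated. -/
theorem exists_sum_le_domCost (htd : I.forest.IsTreedepthDecomposition I.graph)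
    (hdeg : 0 < I.deg x) (hfin : domCost I x P D ≠ ⊤) :
    ∃ E : Finset (Fin n), (E = ∅ ∨ E = {x}) ∧ ∃ a : Fin n → ℕ, (∀ w ∈ insert x P, a w < I.deg x) ∧
      ∑ c ∈ Finset.range (I.deg x),
        domCost I (I.kid x c) {w | w ∈ insert x P ∧ a w = c} (D ∪ E) + E.card ≤
          domCost I x P D := by
  classical
  obtain ⟨X, hX, he⟩ := exists_feasible hfin
  -- A vertex dominated by `D` or by `x` may go to any child. Child `0` is taken, which exists by
  -- `hdeg`.
  have hex : ∀ w, ∃ c, w ∈ insert x P → c < I.deg x ∧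
      Dominates I (D ∪ (X ∩ {x} : Finset (Fin n)) ∪ (X ∩ I.forest.subtree (I.kid x c) :
        Finset (Fin n))) w := by
    intro w
    by_cases hw : w ∈ insert x P
    swap
    · exact ⟨0, fun h => (hw h).elim⟩
    have hw' : w ∈ I.forest.subtree x ∨ w ∈ P := by
      rcases hw with rfl | hw
      · exact .inl (RootedForest.self_mem_subtree w)
      · exact .inr hw
    obtain ⟨u, hu | hu, h⟩ := hX.dom w hw'
    · exact ⟨0, fun _ => ⟨hdeg, u, .inl (.inl hu), h⟩⟩
    · rcases Input.mem_subtree_iff.1 (hX.subset hu) with rfl | ⟨c, hc, hu'⟩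
      · refine ⟨0, fun _ => ⟨hdeg, u, .inl (.inr ?_), h⟩⟩
        have hu : u ∈ X := hu
        simp [hu]
      · refine ⟨c, fun _ => ⟨hc, u, .inr ?_, h⟩⟩
        have hu : u ∈ X := hu
        simp [hu, hu']
  choose a ha using hex
  refine ⟨X ∩ {x}, ?_, a, fun w hw => (ha w hw).1, ?_⟩
  · by_cases hxX : x ∈ X
    · exact .inr (Finset.inter_singleton_of_mem hxX)
    · exact .inl (Finset.inter_singleton_of_notMem hxX)
  · rw [he, ← I.sum_card_inter x hX.subset, Nat.cast_add, Nat.cast_sum]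
    refine add_le_add (Finset.sum_le_sum fun c hc => Feasible.domCost_le
      ⟨Finset.inter_subset_right, ?_⟩) le_rfl
    have hc := Finset.mem_range.1 hc
    rintro w (hw | ⟨hw, rfl⟩)
    swap
    · exact (ha w hw).2
    obtain ⟨u, hu | hu, h⟩ := hX.dom w (.inl (Input.mem_subtree_iff.2 (.inr ⟨c, hc, hw⟩)))
    · exact ⟨u, .inl (.inl hu), h⟩
    have huX : u ∈ X := hu
    rcases Input.mem_subtree_iff.1 (hX.subset hu) with rfl | ⟨c', hc', hu'⟩
    · exact ⟨u, .inl (.inr (by simp [huX])), h⟩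
    · refine ⟨u, .inr ?_, h⟩
      -- Here the treedepth decomposition is used: an edge joins an ancestor and a descendant, so
      -- its ends cannot lie below different children of `x`.
      obtain rfl : c = c' := by
        rcases h with rfl | h
        · exact Input.kid_unique hc hc' hw hu'
        rcases htd w u h with h | h
        · exact Input.kid_unique hc hc'
            (RootedForest.mem_subtree_trans hw (RootedForest.mem_subtree.2 (.inr h))) hu'
        · exact Input.kid_unique hc hc' hw
            (RootedForest.mem_subtree_trans hu' (RootedForest.mem_subtree.2 (.inr h)))
      simp [huX, hu']

end domCost

end Domset

namespace Domset

variable {n : ℕ} {I : Input n} {x : Fin n} {k : ℕ} {π : ℕ → Fin n}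

/-! Paths. -/

namespace IsPath

theorem ancestor (h : IsPath I x k π) {p q : ℕ} (hpq : p < q) (hq : q ≤ k) :
    I.forest.Ancestor (π p) (π q) := by
  induction q, hpq using Nat.le_induction with
  | base => exact .single (h.step p hq)
  | succ q hpq ih => exact (ih (by omega)).tail (h.step q hq)

theorem inj (h : IsPath I x k π) {p q : ℕ} (hp : p ≤ k) (hq : q ≤ k) (he : π p = π q) : p = q := by
  rcases lt_trichotomy p q with hlt | rfl | hlt
  · have := h.ancestor hlt hq
    rw [he] at this
    exact (RootedForest.not_ancestor_self _ this).elim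
  · rfl
  · have := h.ancestor hlt hp
    rw [he] at this
    exact (RootedForest.not_ancestor_self _ this).elim

theorem extend (h : IsPath I x k π) {y : Fin n} (hy : I.forest.parent y = some x) :
    IsPath I y (k + 1) (Function.update π (k + 1) y) where
  last := by simp
  step p hp := by
    rcases Nat.lt_succ_iff_lt_or_eq.1 hp with hp' | rfl
    · rw [Function.update_of_ne (by omega), Function.update_of_ne (by omega)]; exact h.step p hp'
    · rw [Function.update_self, Function.update_of_ne (by omega), hy, h.last]
  root := by rw [Function.update_of_ne (by omega)]; exact h.root

/-- The `k + 1` nodes of the path are distinct, and all of them are `x` or ancestors of `x`. This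
limits the depth of the recursion. -/
theorem lt_height (h : IsPath I x k π) : k + 1 ≤ I.forest.height := by
  classical
  refine le_trans ?_ (Finset.le_sup (f := I.forest.depth) (Finset.mem_univ x))
  have hsub : (((Finset.range (k + 1)).image π : Finset (Fin n)) : Set (Fin n)) ⊆
      {u | u = x ∨ I.forest.Ancestor u x} := by
    intro u hu
    obtain ⟨p, hp, rfl⟩ := Finset.mem_image.1 (Finset.mem_coe.1 hu)
    have hp := Finset.mem_range.1 hp
    rcases (by omega : p = k ∨ p < k) with rfl | hp
    · exact .inl h.last
    · refine .inr ?_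
      rw [← h.last]; exact h.ancestor hp le_rfl
  have := Set.ncard_le_ncard hsub (Set.toFinite _)
  rw [Set.ncard_coe_finset, Finset.card_image_of_injOn, Finset.card_range] at this
  · exact this
  · intro p hp q hq he
    simp at hp hq
    exact h.inj (by omega) (by omega) he

end IsPath

/-! Tables of the cheapest children. -/

/-- The value `x` is the least total cost of an assignment of pairwise distinct children to the
blocks, where `ov i c` is the cost of the child `c` for block `i`. -/
structure IsBestAssignment (l deg : ℕ) (ov : ℕ → ℕ → ℕ∞) (x : ℕ∞) : Prop where
  le : ∀ y : ℕ → ℕ, (∀ i < l, y i < deg) → Set.InjOn y (Set.Iio l) →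
    x ≤ ∑ i ∈ Finset.range l, ov i (y i)
  eq : x = ⊤ ∨ ∃ y : ℕ → ℕ, (∀ i < l, y i < deg) ∧ Set.InjOn y (Set.Iio l) ∧
    x = ∑ i ∈ Finset.range l, ov i (y i)

/-- Row `i` of the table with the costs `C` and the labels `B` contains the cheapest ones of the
first `Y i` children, where `G` are the children to which the entries belong. -/
structure IsTable (l : ℕ) (Y : ℕ → ℕ) (ov C B : ℕ → ℕ → ℕ∞) (G : ℕ → ℕ → ℕ) : Prop where
  mem : ∀ i < l, ∀ j < l, C i j ≠ ⊤ → G i j < Y i ∧ C i j = ov i (G i j)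
  inj : ∀ i < l, ∀ j < l, ∀ j' < l, C i j ≠ ⊤ → C i j' ≠ ⊤ → G i j = G i j' → j = j'
  small : ∀ i < l, ∀ c < Y i, ov i c ≠ ⊤ →
    (∃ j < l, C i j ≠ ⊤ ∧ G i j = c) ∨ ∀ j < l, C i j ≤ ov i c
  label : ∀ i < l, ∀ j < l, ∀ i' < l, ∀ j' < l, C i j ≠ ⊤ → C i' j' ≠ ⊤ →
    (B i j = B i' j' ↔ G i j = G i' j')

section IsTable

variable {l : ℕ} {ov C B : ℕ → ℕ → ℕ∞} {G : ℕ → ℕ → ℕ} {Y : ℕ → ℕ}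

theorem IsTable.empty (l : ℕ) (ov B : ℕ → ℕ → ℕ∞) (G : ℕ → ℕ → ℕ) :
    IsTable l (fun _ => 0) ov (fun _ _ => ⊤) B G where
  mem := by simp
  inj := by simp
  small := by simp
  label := by simp

/-- The insertion of a new child into a row. -/
theorem IsTable.insert (h : IsTable l Y ov C B G) {r : ℕ} (hr : r < l) {b : ℕ∞} {ρ : Equiv.Perm ℕ}
    (hb : ∀ i < l, ∀ j < l, C i j ≠ ⊤ → (B i j = b ↔ G i j = Y r))
    (hρ : ∀ q, l < q → ρ q = q)
    (hmax : ∀ q < l, extRow l (C r) (ov r (Y r)) (ρ q) ≤ extRow l (C r) (ov r (Y r)) (ρ l)) :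
    ∃ G', IsTable l (Function.update Y r (Y r + 1)) ov
        (replaceRow C r fun q => extRow l (C r) (ov r (Y r)) (ρ q))
        (replaceRow B r fun q => extRow l (B r) b (ρ q)) G' ∧
      ∀ i < l, ∀ j < l, replaceRow C r (fun q => extRow l (C r) (ov r (Y r)) (ρ q)) i j ≠ ⊤ →
        (replaceRow B r (fun q => extRow l (B r) b (ρ q)) i j = b ↔ G' i j = Y r) := by
  set C' := replaceRow C r fun q => extRow l (C r) (ov r (Y r)) (ρ q) with hC'
  set B' := replaceRow B r fun q => extRow l (B r) b (ρ q) with hB'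
  set G' : ℕ → ℕ → ℕ := Function.update G r fun q => Function.update (G r) l (Y r) (ρ q) with hG'
  -- An injective map that fixes every index beyond `l` cannot send a smaller index there.
  have hle : ∀ q ≤ l, ρ q ≤ l := fun q hq => by
    by_contra hlt
    have := ρ.injective (hρ _ (not_le.1 hlt))
    omega
  have hlt : ∀ i ≠ r, C' i = C i ∧ B' i = B i ∧ G' i = G i := fun i hi => by
    simp [hC', hB', hG', replaceRow, hi]
  have hCr : ∀ j, C' r j = extRow l (C r) (ov r (Y r)) (ρ j) := fun j => by
    simp [hC', replaceRow]
  -- every entry is an old one or the new one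
  have hent : ∀ i < l, ∀ j < l, C' i j ≠ ⊤ →
      (∃ j' < l, C i j' ≠ ⊤ ∧ C' i j = C i j' ∧ B' i j = B i j' ∧ G' i j = G i j' ∧
        (i = r → j' = ρ j)) ∨
      (i = r ∧ ρ j = l ∧ C' i j = ov r (Y r) ∧ B' i j = b ∧ G' i j = Y r) := by
    intro i hi j hj hfin
    by_cases hir : i = r
    · subst hir
      rcases (hle j hj.le).lt_or_eq with h1 | h1
      · left
        have h2 : C' i j = C i (ρ j) := by rw [hCr]; simp [extRow, h1.ne]
        exact ⟨ρ j, h1, h2 ▸ hfin, h2, by simp [hB', replaceRow, extRow, h1.ne],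
          by simp [hG', h1.ne], fun _ => rfl⟩
      · exact .inr ⟨rfl, h1, by rw [hCr]; simp [extRow, h1],
          by simp [hB', replaceRow, extRow, h1], by simp [hG', h1]⟩
    · obtain ⟨h1, h2, h3⟩ := hlt i hir
      rw [h1, h2, h3]
      rw [h1] at hfin
      exact .inl ⟨j, hj, hfin, rfl, rfl, rfl, fun h => (hir h).elim⟩
  refine ⟨G', ⟨?_, ?_, ?_, ?_⟩, ?_⟩
  · intro i hi j hj hfin
    rcases hent i hi j hj hfin with ⟨j', hj', hf, e1, -, e2, -⟩ | ⟨rfl, -, e1, -, e2⟩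
    · rw [e1, e2]
      obtain ⟨h1, h2⟩ := h.mem i hi j' hj' hf
      refine ⟨?_, h2⟩
      rw [Function.update_apply]; split_ifs with hir
      · subst hir; omega
      · exact h1
    · rw [e1, e2]; simp
  · intro i hi j hj j' hj' hfin hfin' heq
    rcases hent i hi j hj hfin with ⟨q, hq, hf, -, -, e, hir⟩ | ⟨rfl, hρj, -, -, e⟩ <;>
      rcases hent i hi j' hj' hfin' with ⟨q', hq', hf', -, -, e', hir'⟩ | ⟨hir', hρj', -, -, e'⟩
    · have := h.inj i hi q hq q' hq' hf hf' (by rw [← e, ← e', heq])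
      by_cases hi' : i = r
      · rw [hir hi', hir' hi'] at this
        exact ρ.injective this
      · have h3 := (hlt i hi').2.2
        have h1 := (hlt i hi').1
        rw [h3] at heq
        rw [h1] at hfin hfin'
        exact h.inj i hi j hj j' hj' hfin hfin' heq
    -- Old entries belong to children before `Y r`, so they never coincide with the new child.
    · subst hir'
      have := (h.mem i hi q hq hf).1
      omega
    · have := (h.mem i hi q' hq' hf').1
      omega
    · exact ρ.injective (hρj.trans hρj'.symm)
  · intro i hi c hc hov
    by_cases hir : i = r
    swap
    · rw [Function.update_of_ne hir] at hc
      obtain ⟨h1, h2, h3⟩ := hlt i hir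
      rw [h1, h3]
      exact h.small i hi c hc hov
    subst hir
    rw [Function.update_self] at hc
    -- Each child seen so far, including the new one, either has an entry in the extended row or was
    -- already beaten by a whole row of entries that cost no more.
    have key : (∃ q ≤ l, extRow l (C i) (ov i (Y i)) q = ov i c ∧
        Function.update (G i) l (Y i) q = c) ∨ ∀ j < l, C i j ≤ ov i c := by
      rcases Nat.lt_succ_iff_lt_or_eq.1 hc with hc | rfl
      · refine (h.small i hi c hc hov).imp_left ?_
        rintro ⟨j, hj, hf, rfl⟩
        exact ⟨j, hj.le, by simpa [extRow, hj.ne] using (h.mem i hi j hj hf).2, by simp [hj.ne]⟩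
      · exact .inl ⟨l, le_rfl, by simp [extRow], by simp⟩
    rcases key with ⟨q, hq, e1, e2⟩ | hall
    · obtain ⟨j, rfl⟩ := ρ.surjective q
      have hj : j ≤ l := by
        by_contra hj
        rw [hρ j (by omega)] at hq; exact hj hq
      rcases hj.lt_or_eq with hj | rfl
      · exact .inl ⟨j, hj, by rw [hCr, e1]; exact hov, by simpa [hG'] using e2⟩
      · refine .inr fun q hq => ?_
        rw [hCr, ← e1]; exact hmax q hq
    · refine .inr fun j hj => ?_
      rw [hCr]
      rcases (hle j hj.le).lt_or_eq with h1 | h1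
      · simpa [extRow, h1.ne] using hall _ h1
      -- Column `j` holds the new entry, so the evicted one is old. It is bounded by `ov i c`, and
      -- by maximality it bounds the new entry.
      · have h2 : ρ l < l := by
          refine lt_of_le_of_ne (hle l le_rfl) fun h2 => ?_
          have := ρ.injective (h1.trans h2.symm)
          omega
        refine (hmax j hj).trans ?_
        simpa [extRow, h2.ne] using hall _ h2
  · intro i hi j hj i' hi' j' hj' hfin hfin'
    rcases hent i hi j hj hfin with ⟨q, hq, hf, -, e1, e2, -⟩ | ⟨rfl, -, -, e1, e2⟩ <;>
      rcases hent i' hi' j' hj' hfin' with ⟨q', hq', hf', -, e1', e2', -⟩ | ⟨rfl, -, -, e1', e2'⟩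
    · rw [e1, e2, e1', e2']; exact h.label i hi q hq i' hi' q' hq' hf hf'
    · rw [e1, e2, e1', e2']; exact hb i hi q hq hf
    · rw [e1, e2, e1', e2', eq_comm, hb i' hi' q' hq' hf', eq_comm]
    · rw [e1, e2, e1', e2']; simp
  · intro i hi j hj hfin
    rcases hent i hi j hj hfin with ⟨q, hq, hf, -, e1, e2, -⟩ | ⟨rfl, -, -, e1, e2⟩
    · rw [e1, e2]; exact hb i hi q hq hf
    · rw [e1, e2]; simp

/-- The children of an assignment can be exchanged against children in the table. -/
theorem IsTable.exists_exchange {deg : ℕ} (h : IsTable l (fun _ => deg) ov C B G) {y : ℕ → ℕ}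
    (hy : ∀ i < l, y i < deg) (hinj : Set.InjOn y (Set.Iio l)) (hfin : ∀ i < l, ov i (y i) ≠ ⊤)
    (r : ℕ) (hr : r ≤ l) : ∃ y' : ℕ → ℕ, (∀ i < l, y' i < deg) ∧ Set.InjOn y' (Set.Iio l) ∧
      (∀ i < l, ov i (y' i) ≤ ov i (y i)) ∧ ∀ i < r, ∃ j < l, C i j ≠ ⊤ ∧ G i j = y' i := by
  classical
  induction r with
  | zero => exact ⟨y, hy, hinj, fun _ _ => le_rfl, by simp⟩
  | succ r ih =>
    obtain ⟨y', hy', hinj', hle, hmem⟩ := ih (by omega)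
    have hfin' : ov r (y' r) ≠ ⊤ := ne_top_of_le_ne_top (hfin r hr) (hle r hr)
    rcases h.small r hr (y' r) (hy' r hr) hfin' with ⟨j, hj⟩ | hall
    · refine ⟨y', hy', hinj', hle, fun i hi => ?_⟩
      rcases Nat.lt_succ_iff_lt_or_eq.1 hi with hi | rfl
      · exact hmem i hi
      · exact ⟨j, hj⟩
    · have hCfin : ∀ j < l, C r j ≠ ⊤ := fun j hj => ne_top_of_le_ne_top hfin' (hall j hj)
      -- The row is full of finite entries, which belong to `l` different children. The other blocks
      -- use at most `l - 1` of these, so one is free, and it costs no more than the child it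
      -- replaces.
      have hcard : (((Finset.range l).erase r).image y').card <
          ((Finset.range l).image (G r)).card := by
        rw [Finset.card_image_of_injOn (s := Finset.range l)]
        · refine Finset.card_image_le.trans_lt ?_
          rw [Finset.card_erase_of_mem (Finset.mem_range.2 hr), Finset.card_range]; omega
        · intro j hj j' hj' he
          simp at hj hj'
          exact h.inj r hr j hj j' hj' (hCfin j hj) (hCfin j' hj') he
      obtain ⟨c, hc, hnot⟩ := Finset.exists_mem_notMem_of_card_lt_card hcard
      obtain ⟨j, hj, rfl⟩ := Finset.mem_image.1 hc
      have hj := Finset.mem_range.1 hj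
      have hne : ∀ i < l, i ≠ r → y' i ≠ G r j := fun i hi hir he =>
        hnot (Finset.mem_image.2 ⟨i, Finset.mem_erase.2 ⟨hir, Finset.mem_range.2 hi⟩, he⟩)
      obtain ⟨h1, h2⟩ := h.mem r hr j hj (hCfin j hj)
      refine ⟨Function.update y' r (G r j), fun i hi => ?_, fun i hi i' hi' he => ?_,
        fun i hi => ?_, fun i hi => ?_⟩
      · rw [Function.update_apply]; split_ifs; exacts [h1, hy' i hi]
      · rw [Function.update_apply, Function.update_apply] at he
        split_ifs at he with e1 e2 e2
        · rw [e1, e2]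
        · exact (hne i' hi' e2 he.symm).elim
        · exact (hne i hi e1 he).elim
        · exact hinj' hi hi' he
      · rw [Function.update_apply]; split_ifs with e1
        · subst e1
          rw [← h2]; exact (hall j hj).trans (hle i hi)
        · exact hle i hi
      · rw [Function.update_apply]; split_ifs with e1
        · subst e1; exact ⟨j, hj, hCfin j hj, rfl⟩
        · exact hmem i (by omega)

/-- In one direction, an assignment is exchanged into the table and read off as a choice of columns
without conflict. In the other, a choice of finite cost has no conflict, so its labels, and hence
its children, are distinct. -/
theorem IsTable.isBestAssignment {deg : ℕ} (h : IsTable l (fun _ => deg) ov C B G) {z : ℕ∞}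
    (hz : IsBestChoice l C B z) : IsBestAssignment l deg ov z where
  le y hy hinj := by
    by_cases htop : ∑ i ∈ Finset.range l, ov i (y i) = ⊤
    · rw [htop]; exact le_top
    have hfin : ∀ i < l, ov i (y i) ≠ ⊤ := fun i hi he =>
      htop (WithTop.sum_eq_top.2 ⟨i, Finset.mem_range.2 hi, he⟩)
    obtain ⟨y', hy', hinj', hle, hmem⟩ := h.exists_exchange hy hinj hfin l le_rfl
    have hex : ∀ i, ∃ j, i < l → j < l ∧ C i j ≠ ⊤ ∧ G i j = y' i := fun i => by
      by_cases hi : i < l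
      · obtain ⟨j, hj⟩ := hmem i hi
        exact ⟨j, fun _ => hj⟩
      · exact ⟨0, fun h => (hi h).elim⟩
    choose J hJ using hex
    refine (hz.le J fun i hi => (hJ i hi).1).trans ?_
    rw [choiceCost, if_neg]
    · refine Finset.sum_le_sum fun i hi => ?_
      have hi := Finset.mem_range.1 hi
      obtain ⟨h1, h2, h3⟩ := hJ i hi
      rw [(h.mem i hi _ h1 h2).2, h3]; exact hle i hi
    · rintro ⟨i, hi, q, hq, he⟩
      obtain ⟨h1, h2, h3⟩ := hJ i hi
      obtain ⟨h1', h2', h3'⟩ := hJ q (hq.trans hi)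
      rw [h.label q (hq.trans hi) _ h1' i hi _ h1 h2' h2, h3, h3'] at he
      have := hinj' (Set.mem_Iio.2 (hq.trans hi)) (Set.mem_Iio.2 hi) he
      omega
  eq := by
    by_cases htop : z = ⊤
    · exact .inl htop
    right
    obtain ⟨J, hJ, he⟩ := hz.eq.resolve_left htop
    rw [choiceCost] at he
    split_ifs at he with hconf
    · exact (htop he).elim
    have hfin : ∀ i < l, C i (J i) ≠ ⊤ := fun i hi he' =>
      htop (he.trans (WithTop.sum_eq_top.2 ⟨i, Finset.mem_range.2 hi, he'⟩))
    have hmem := fun i (hi : i < l) => h.mem i hi (J i) (hJ i hi) (hfin i hi)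
    have hne : ∀ i < l, ∀ q < i, G q (J q) ≠ G i (J i) := fun i hi q hq he' =>
      hconf ⟨i, hi, q, hq, (h.label q (hq.trans hi) _ (hJ q (hq.trans hi)) i hi _ (hJ i hi)
        (hfin q (hq.trans hi)) (hfin i hi)).2 he'⟩
    refine ⟨fun i => G i (J i), fun i hi => (hmem i hi).1, fun i hi q hq he' => ?_, ?_⟩
    · rcases lt_trichotomy i q with hlt | rfl | hlt
      · exact (hne q hq i hlt he').elim
      · rfl
      · exact (hne i hi q hlt he'.symm).elim
    · rw [he]
      exact Finset.sum_congr rfl fun i hi => (hmem i (Finset.mem_range.1 hi)).2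

end IsTable

/-! The recursion. -/

/-- Write `g c` as `(g c - b c) + b c`, which is valid also at `∞` because `b c ≤ g c`. The
differences vanish off the image of `y`, and the sum over the image is reindexed by injectivity. -/
theorem sum_eq_sum_add_overhead {l deg : ℕ} {g b : ℕ → ℕ∞} {y : ℕ → ℕ} (hy : ∀ i < l, y i < deg)
    (hinj : Set.InjOn y (Set.Iio l)) (hle : ∀ c, b c ≤ g c)
    (heq : ∀ c < deg, (∀ i < l, y i ≠ c) → g c = b c) :
    ∑ c ∈ Finset.range deg, g c =
      ∑ i ∈ Finset.range l, (g (y i) - b (y i)) + ∑ c ∈ Finset.range deg, b c := by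
  classical
  have h1 : ∑ c ∈ Finset.range deg, g c =
      ∑ c ∈ Finset.range deg, (g c - b c) + ∑ c ∈ Finset.range deg, b c := by
    rw [← Finset.sum_add_distrib]
    exact Finset.sum_congr rfl fun c _ => (tsub_add_cancel_of_le (hle c)).symm
  rw [h1]
  congr 1
  rw [← Finset.sum_image (g := y) (f := fun c => g c - b c)]
  · refine (Finset.sum_subset ?_ ?_).symm
    · intro c hc
      obtain ⟨i, hi, rfl⟩ := Finset.mem_image.1 hc
      exact Finset.mem_range.2 (hy i (Finset.mem_range.1 hi))
    · intro c hc hnot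
      rw [heq c (Finset.mem_range.1 hc), tsub_self]
      exact fun i hi he => hnot (Finset.mem_image.2 ⟨i, Finset.mem_range.2 hi, he⟩)
  · intro i hi j hj he
    exact hinj (Finset.mem_range.1 hi) (Finset.mem_range.1 hj) he

/-- Block number `i` of the partition `B` of nodes on a path. -/
def blockSet (π : ℕ → Fin n) (k : ℕ) (B : ℕ → ℕ) (i : ℕ) : Set (Fin n) :=
  {w | ∃ p ≤ k, π p = w ∧ B p = i}

/-- The overhead cost of block number `i + 1` for child `c`. -/
noncomputable def overhead (I : Input n) (x : Fin n) (k : ℕ) (π : ℕ → Fin n) (B : ℕ → ℕ)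
    (D : Set (Fin n)) (i c : ℕ) : ℕ∞ :=
  domCost I (I.kid x c) (blockSet π k B (i + 1)) D - domCost I (I.kid x c) ∅ D

/-- The cost of dominating the subtrees of all children. -/
noncomputable def baseline (I : Input n) (x : Fin n) (D : Set (Fin n)) (m : ℕ) : ℕ∞ :=
  ∑ c ∈ Finset.range m, domCost I (I.kid x c) ∅ D

section recursion

variable {P D : Set (Fin n)}

theorem exists_pos_of_mem (hπ : IsPath I x k π) (hP : P ⊆ {w | ∃ p < k, π p = w}) {w : Fin n}
    (hw : w ∈ insert x P) : ∃ p ≤ k, π p = w := by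
  rcases hw with rfl | hw
  · exact ⟨k, le_rfl, hπ.last⟩
  · obtain ⟨p, hp, h⟩ := hP hw
    exact ⟨p, hp.le, h⟩

/-- Soundness: child `y i` receives block `i + 1`, all other children receive the empty set, and
`domCost_le_sum` combines their solutions. Block numbers start at `1`, hence the shift. -/
theorem domCost_le_assignment (hπ : IsPath I x k π) (hP : P ⊆ {w | ∃ p < k, π p = w})
    {E : Finset (Fin n)} (hE : E ⊆ {x}) {B : ℕ → ℕ}
    (hB : IsBlocks (k + 1) (fun p => π p ∈ insert x P) B) {z : ℕ∞}
    (hz : IsBestAssignment (maxBelow B (k + 1)) (I.deg x) (overhead I x k π B (D ∪ E)) z) :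
    domCost I x P D ≤ z + baseline I x (D ∪ E) (I.deg x) + E.card := by
  classical
  rcases hz.eq with rfl | ⟨y, hy, hinj, he⟩
  · simp
  let S : ℕ → Set (Fin n) := fun c =>
    {w | ∃ i < maxBelow B (k + 1), y i = c ∧ w ∈ blockSet π k B (i + 1)}
  have hSy : ∀ i < maxBelow B (k + 1), S (y i) = blockSet π k B (i + 1) := fun i hi => by
    ext w
    constructor
    · rintro ⟨j, hj, he, hw⟩
      rwa [← hinj hj hi he]
    · exact fun hw => ⟨i, hi, rfl, hw⟩
  refine (domCost_le_sum hE (S := S) fun w hw => ?_).trans (add_le_add_left (le_of_eq ?_) _)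
  · obtain ⟨p, hp, rfl⟩ := exists_pos_of_mem hπ hP hw
    have h1 := hB.pos p (by omega) hw
    have h2 := le_maxBelow (B := B) (show p < k + 1 by omega)
    exact ⟨y (B p - 1), hy _ (by omega), B p - 1, by omega, rfl, p, hp, rfl, by omega⟩
  · rw [sum_eq_sum_add_overhead (b := fun c => domCost I (I.kid x c) ∅ (D ∪ E)) hy hinj
      (fun c => domCost_mono (Set.empty_subset _)) (fun c hc hne => ?_), he, baseline]
    · congr 1
      refine Finset.sum_congr rfl fun i hi => ?_
      rw [hSy i (Finset.mem_range.1 hi), overhead]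
    · have : S c = ∅ := by
        ext w
        simp only [Set.mem_empty_iff_false, iff_false]
        rintro ⟨i, hi, he, -⟩
        exact hne i hi he
      rw [this]

/-- Completeness: the blocks are the fibres of the map `a` that an optimal solution provides.
Different fibres go to different children, so `a` itself induces an admissible assignment, which no
least one can exceed. -/
theorem exists_assignment_le_domCost (htd : I.forest.IsTreedepthDecomposition I.graph)
    (hπ : IsPath I x k π) (hP : P ⊆ {w | ∃ p < k, π p = w}) (hdeg : 0 < I.deg x)
    (hfin : domCost I x P D ≠ ⊤) :
    ∃ E : Finset (Fin n), (E = ∅ ∨ E = {x}) ∧ ∃ B : ℕ → ℕ,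
      IsBlocks (k + 1) (fun p => π p ∈ insert x P) B ∧ ∀ z : ℕ∞,
      IsBestAssignment (maxBelow B (k + 1)) (I.deg x) (overhead I x k π B (D ∪ E)) z →
      z + baseline I x (D ∪ E) (I.deg x) + E.card ≤ domCost I x P D := by
  obtain ⟨E, hE, a, ha, hle⟩ := exists_sum_le_domCost (x := x) (P := P) (D := D) htd hdeg hfin
  obtain ⟨B, hB, hBa⟩ := IsBlocks.exists_fibers (k + 1) (fun p => π p ∈ insert x P) (a ∘ π)
  refine ⟨E, hE, B, hB, fun z hz => le_trans (add_le_add_left ?_ _) hle⟩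
  set l := maxBelow B (k + 1)
  have hex : ∀ i, ∃ p, i < l → p < k + 1 ∧ π p ∈ insert x P ∧ B p = i + 1 := fun i => by
    by_cases hi : i < l
    · obtain ⟨p, h⟩ := hB.exists_eq (by omega) (Nat.succ_le_of_lt hi)
      exact ⟨p, fun _ => h⟩
    · exact ⟨0, fun h => (hi h).elim⟩
  -- `q i` is the position of a representative of block `i + 1`, so the child of this block is `a (π
  -- (q i))`.
  choose q hq using hex
  let S : ℕ → Set (Fin n) := fun c => {w | w ∈ insert x P ∧ a w = c}
  have hy : ∀ i < l, a (π (q i)) < I.deg x := fun i hi => ha _ (hq i hi).2.1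
  have hinj : Set.InjOn (fun i => a (π (q i))) (Set.Iio l) := fun i hi j hj he => by
    obtain ⟨h1, h2, h3⟩ := hq i hi
    obtain ⟨h1', h2', h3'⟩ := hq j hj
    have := (hBa _ h1 _ h1' h2 h2').2 he
    omega
  have hSy : ∀ i < l, S (a (π (q i))) = blockSet π k B (i + 1) := fun i hi => by
    obtain ⟨h1, h2, h3⟩ := hq i hi
    ext w
    constructor
    · rintro ⟨hw, he⟩
      obtain ⟨p, hp, rfl⟩ := exists_pos_of_mem hπ hP hw
      exact ⟨p, hp, rfl, ((hBa p (by omega) _ h1 hw h2).2 he).trans h3⟩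
    · rintro ⟨p, hp, rfl, he⟩
      have hw : π p ∈ insert x P := by
        by_contra hw
        rw [hB.zero p fun h => hw h.2] at he
        omega
      exact ⟨hw, (hBa p (by omega) _ h1 hw h2).1 (he.trans h3.symm)⟩
  refine (add_le_add_left (hz.le _ hy hinj) _).trans (le_of_eq ?_)
  rw [sum_eq_sum_add_overhead (g := fun c => domCost I (I.kid x c) (S c) (D ∪ E))
    (b := fun c => domCost I (I.kid x c) ∅ (D ∪ E)) hy hinj
    (fun c => domCost_mono (Set.empty_subset _)) (fun c hc hne => ?_), baseline]
  · congr 1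
    refine Finset.sum_congr rfl fun i hi => ?_
    rw [hSy i (Finset.mem_range.1 hi), overhead]
  · have : S c = ∅ := by
      ext w
      simp only [Set.mem_empty_iff_false, iff_false]
      rintro ⟨hw, he⟩
      obtain ⟨p, hp, rfl⟩ := exists_pos_of_mem hπ hP hw
      have h1 := hB.pos p (by omega) hw
      have h2 : B p ≤ l := le_maxBelow (B := B) (show p < k + 1 by omega)
      have hi : B p - 1 < l := by omega
      obtain ⟨h1', h2', h3'⟩ := hq _ hi
      refine hne _ hi (((hBa _ h1' p (by omega) h2' hw).1 ?_).trans he)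
      omega
    rw [this]

/-- A block has at most `k + 1` elements, so `domCost_le_add` applies. An infinite overhead has
`toNat` equal to `0`. -/
theorem overhead_toNat_le (B : ℕ → ℕ) (D : Set (Fin n)) (i c : ℕ) :
    (overhead I x k π B D i c).toNat ≤ k + 1 := by
  classical
  unfold overhead
  by_cases htop : domCost I (I.kid x c) (blockSet π k B (i + 1)) D = ⊤
  · rw [htop]
    exact (ENat.toNat_sub_le _ _).trans (by simp)
  · have h := domCost_le_add (A := (Finset.range (k + 1)).image π) (fun w hw => by
      obtain ⟨p, hp, rfl, -⟩ := hw
      exact Finset.mem_coe.2 (Finset.mem_image.2 ⟨p, Finset.mem_range.2 (by omega), rfl⟩)) htop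
    have h1 : ((Finset.range (k + 1)).image π).card ≤ k + 1 :=
      Finset.card_image_le.trans (by simp)
    have h2 : domCost I (I.kid x c) (blockSet π k B (i + 1)) D - domCost I (I.kid x c) ∅ D ≤
        ((k + 1 : ℕ) : ℕ∞) := by
      rw [tsub_le_iff_left]
      exact h.trans (add_le_add_right (Nat.cast_le.2 h1) _)
    exact (ENat.toNat_le_toNat h2 (ENat.natCast_ne_top _)).trans (by rw [ENat.toNat_natCast])

end recursion

end Domset

namespace Domset

variable {n : ℕ} {I : Input n} {Λ : Limits n} {σ : Frame} {κ l : ℕ} {x : Fin n} {k : ℕ}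
  {π : ℕ → Fin n}

/-! The work on one child. -/

/-- The bounds are large enough for calls at depth less than `t`. -/
structure Limits.Admits (Λ : Limits n) (t : ℕ) : Prop where
  L : t * t ≤ Λ.L
  M : 2 * (t * t) + 1 ≤ Λ.M
  N : t * Λ.M + n + 1 ≤ Λ.N
  K : 2 * (t * t) + 1 ≤ Λ.K
  pow : (t + 1) ^ t ≤ Λ.K

theorem Limits.Admits.mono {t t' : ℕ} (h : Λ.Admits t) (h' : t' ≤ t) :
    Λ.Admits t' := by
  have h1 : t' * t' ≤ t * t := Nat.mul_le_mul h' h'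
  have h2 : t' * Λ.M ≤ t * Λ.M := Nat.mul_le_mul_right _ h'
  have h3 : (t' + 1) ^ t' ≤ (t + 1) ^ t :=
    (Nat.pow_le_pow_left (by omega) _).trans (Nat.pow_le_pow_right (by omega) h')
  obtain ⟨a, b, c, d, e⟩ := h
  exact ⟨by omega, by omega, by omega, by omega, by omega⟩

/-- The expression `e` is evaluated anew in each iteration, so its value is required in all frames
that the loop may pass through. -/
theorem runs_selectBlock {e : Expr} {B : ℕ → ℕ} {a : ℕ} (hσ : σ.Fits Λ) (hk : σ.scalar .k = k)
    (hB : σ.array .B = arr (k + 1) fun p => (B p : ℕ∞))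
    (he : ∀ τ, Agree (selectBlock e) σ τ → e.eval I τ = (a : ℕ))
    (hL : k + 1 ≤ Λ.L) (hK : k + 1 ≤ Λ.K) (hs : e.small = true := by rfl)
    (ht : e.time ≤ 20 := by exact Nat.le_of_ble_eq_true rfl) :
    Runs I Λ κ (selectBlock e) σ fun τ => τ.array .S = arr (k + 1) fun p => ind (B p = a) := by
  unfold selectBlock
  refine Runs.clear_seq hσ fun hσ => ?_
  refine (Runs.forLoop (k + 1) (fun i τ => τ.array .S = arr i fun p => ind (B p = a))
    hσ (hL.trans Λ.L_le) hK (fun τ hτ hag => ?_) (by simp) ?_).mono fun τ _ _ h => h.2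
  · have := hag.scalar .k rfl
    simp_all [Expr.eval]
  · intro i hi τ hτ hag hp hS
    have hBτ := hag.array .B rfl
    simp only [Frame.setArray_array, reduceCtorEq, if_false, hB] at hBτ
    have heτ : e.eval I τ = (a : ℕ) := he τ <| by
      refine Agree.trans (τ := σ.setArray .S []) ⟨fun _ _ => rfl, fun b hb => ?_⟩
        (hag.mono (fun s hs => ?_) (fun b hb => ?_))
      · simp only [selectBlock, Cmd.writesArray, Bool.or_eq_false_iff, decide_eq_false_iff_not]
          at hb
        simp [Ne.symm hb.1]
      · simpa [selectBlock, Cmd.writesScalar] using hs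
      · simp only [selectBlock, Cmd.writesArray, Bool.or_eq_false_iff] at hb
        exact hb.2
    have hev : (Expr.eq (.get .B (v .p)) e).eval I τ = ind (B i = a) := by
      simp only [Expr.eval, eval_v, hp, ENat.toNat_natCast, hBτ, heτ]
      rw [getD_arr _ hi]
      by_cases h : B i = a <;> simp [ind, h]
    refine Runs.push hτ rfl ?_ ?_ ?_ (by simpa [Expr.small, v] using hs)
      (by simp only [Expr.time, v]; omega)
    · simp [hS]; omega
    · rw [hev]; exact toNat_ind_le Λ _
    · simp [hev, hS, arr_succ]

/-- The initial frame of a call. -/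
def callFrame (y k : ℕ) (P D : List ℕ∞) : Frame :=
  (((Frame.empty.setArray .P P).setArray .D D).setScalar .x y).setScalar .k k

/-- The call for the node `y` at depth `k` computes `domCost`. -/
def Solves (I : Input n) (y : Fin n) (k : ℕ) (π : ℕ → Fin n) (T S : ℕ) : Prop :=
  ∀ P D : Set (Fin n), P ⊆ {w | ∃ p < k, π p = w} → D ⊆ {w | ∃ p < k, π p = w} →
    ∃ τ T' S', Exec I domset domset (callFrame y k (arr k fun p => ind (π p ∈ P))
      (arr k fun p => ind (π p ∈ D))) τ T' S' ∧ T' ≤ T ∧ S' ≤ S ∧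
      τ.scalar .ret = domCost I y P D

/-- A call sees only the proper ancestors of its node. Hence the path of the parent may stand in for
the path extended by the child. -/
theorem Solves.congr {y : Fin n} {π' : ℕ → Fin n} {T S : ℕ} (h : Solves I y k π T S)
    (hπ : ∀ p < k, π p = π' p) : Solves I y k π' T S := by
  have hset : {w | ∃ p < k, π p = w} = {w | ∃ p < k, π' p = w} := by
    ext w
    constructor <;> rintro ⟨p, hp, he⟩
    · exact ⟨p, hp, (hπ p hp).symm.trans he⟩
    · exact ⟨p, hp, (hπ p hp).trans he⟩
  intro P D hP hD
  have h1 : ∀ A : Set (Fin n), (arr k fun p => ind (π p ∈ A)) = arr k fun p => ind (π' p ∈ A) :=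
    fun A => arr_congr fun p hp => by rw [hπ p hp]
  have := h P D (hset ▸ hP) (hset ▸ hD)
  rwa [h1, h1] at this

/-- The array of the nodes in `D`, with the value `d` at position `k`. -/
noncomputable def nodeArray (k : ℕ) (π : ℕ → Fin n) (D : Set (Fin n)) (d : ℕ∞) : List ℕ∞ :=
  arr (k + 1) fun p => if p = k then d else ind (π p ∈ D)

theorem nodeArray_eq {D D' : Set (Fin n)} {d : ℕ∞} (h : ∀ p < k, π p ∈ D ↔ π p ∈ D')
    (hd : d = ind (π k ∈ D')) : nodeArray k π D d = arr (k + 1) fun p => ind (π p ∈ D') := by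
  refine arr_congr fun p hp => ?_
  split_ifs with hpk
  · rw [hpk, hd]
  · rw [h p (by omega)]

theorem IsPath.self_notMem (hπ : IsPath I x k π) {D : Set (Fin n)}
    (hD : D ⊆ {w | ∃ p < k, π p = w}) : x ∉ D := fun hx => by
  obtain ⟨p, hp, he⟩ := hD hx
  have := hπ.inj hp.le le_rfl (he.trans hπ.last.symm)
  omega

theorem IsPath.ne_self (hπ : IsPath I x k π) {p : ℕ} (hp : p < k) : π p ≠ x := fun he => by
  have := hπ.inj hp.le le_rfl (he.trans hπ.last.symm)
  omega

/-- The call itself costs `2 * k + 11`: copying two arrays of length `k + 1` takes `2 * k + 4`, the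
two scalar arguments take `6`, and one step is for the call. On top of the space of the callee come
the caller's frame, the arguments and the return address. -/
theorem runs_recurse {s : Var} {d : ℕ} {y : Fin n} {A D D' : Set (Fin n)} {d₀ : ℕ∞} {Tc Sc : ℕ}
    (hσ : σ.Fits Λ) (hy : σ.scalar .y = (y : ℕ)) (hk : σ.scalar .k = k)
    (hS : σ.array .S = arr (k + 1) fun p => ind (π p ∈ A))
    (hD : σ.array .D = nodeArray k π D d₀)
    (hπ : IsPath I x k π) (hDsub : D ⊆ {w | ∃ p < k, π p = w})
    (hAsub : A ⊆ {w | ∃ p < k + 1, π p = w})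
    (hd : d = 0 ∧ D' = D ∨ d = 1 ∧ D' = insert x D)
    (hsol : Solves I y (k + 1) π Tc Sc) (hκ : 2 * k + 11 + Tc ≤ κ)
    (hSc : frameBits Λ.N Λ.M Λ.L + exprBits Λ.N + 3 + Sc ≤ Λ.S) :
    Runs I Λ κ (recurse s d) σ fun τ => τ.scalar s = domCost I y A D' ∧
      τ.array .D = nodeArray k π D d := by
  have hD' : nodeArray k π D d = arr (k + 1) fun p => ind (π p ∈ D') := by
    rcases hd with ⟨rfl, rfl⟩ | ⟨rfl, rfl⟩
    · refine nodeArray_eq (fun p _ => Iff.rfl) ?_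
      rw [hπ.last, ind_false (hπ.self_notMem hDsub)]; rfl
    · refine nodeArray_eq (fun p hp => ?_) ?_
      · simp [hπ.ne_self hp]
      · rw [hπ.last, ind_true (Set.mem_insert _ _)]; rfl
  have hD'sub : D' ⊆ {w | ∃ p < k + 1, π p = w} := by
    have h1 : D ⊆ {w | ∃ p < k + 1, π p = w} := fun w hw => by
      obtain ⟨p, hp, he⟩ := hDsub hw
      exact ⟨p, by omega, he⟩
    rcases hd with ⟨-, rfl⟩ | ⟨-, rfl⟩
    · exact h1
    · exact Set.insert_subset ⟨k, by omega, hπ.last⟩ h1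
  have hd2 : d ≤ 1 := by omega
  unfold recurse
  refine Runs.store_seq (nodeArray k π D d) hσ ?_ ?_ (fun hσ => ?_) rfl
    (by simp [Expr.small]; omega)
  · simp only [Expr.eval, eval_v, hk, ENat.toNat_natCast, hD, nodeArray]
    rw [set_arr]
    refine arr_congr fun p hp => ?_
    rw [Function.update_apply]; split_ifs <;> rfl
  · simp only [Expr.eval, ENat.toNat_natCast]
    exact le_trans (by omega) Λ.two_le
  · obtain ⟨τ, T', S', h1, h2, h3, h4⟩ := hsol A D' hAsub hD'sub
    have hframe : calleeFrame I (σ.setArray .D (nodeArray k π D d))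
        [(.x, v .y), (.k, .add (v .k) (.num 1))] [(.P, .S), (.D, .D)] =
        callFrame y (k + 1) (arr (k + 1) fun p => ind (π p ∈ A))
          (arr (k + 1) fun p => ind (π p ∈ D')) := by
      simp [calleeFrame, callFrame, Expr.eval, hy, hk, hS, hD']
    have hfit : ((σ.setArray .D (nodeArray k π D d)).setScalar s (τ.scalar .ret)).Fits Λ :=
      hσ.setScalar (by
        rw [h4]
        refine toNat_domCost_le.trans (le_trans ?_ Λ.n_le)
        exact (Finset.card_le_univ _).trans (by simp))
    have hcall := Exec.call (σ := σ.setArray .D (nodeArray k π D d)) (s := s)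
      (es := [(.x, v .y), (.k, .add (v .k) (.num 1))]) (as := [(.P, .S), (.D, .D)]) (hframe ▸ h1)
    refine ⟨_, _, _, hcall, ?_, ?_, hfit, ?_, ?_⟩
    · simp only [Cmd.cost]
      refine le_trans ?_ hκ
      simp [Expr.time, hS, nodeArray]
      omega
    · refine max_le ?_ hfit.bits_le_S
      have hb := hσ.bits_le
      have e1 := hσ.exprSpace_le I (v .y) rfl 24 (by simp)
      have e2 := hσ.exprSpace_le I (.add (v .k) (.num 1)) rfl 24 (by simp [Expr.time])
      -- There are four call sites, so a return address takes three bits.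
      have hsz : Nat.size domset.callSites = 3 := by decide
      simp only [Expr.time, time_v] at e1 e2
      unfold exprBits at hSc
      rw [hsz]
      simp only [List.map_cons, List.map_nil, List.sum_cons, List.sum_nil]
      omega
    · simp [h4]
    · simp

/-- The state before child `c` is processed: the baseline costs and the tables for the first `c`
children. -/
structure Progress (I : Input n) (x : Fin n) (k : ℕ) (π : ℕ → Fin n) (B : ℕ → ℕ) (D : Set (Fin n))
    (l c : ℕ) (τ : Frame) : Prop where
  arrD : ∃ d, τ.array .D = nodeArray k π D d
  base : τ.scalar .base = baseline I x D c
  base2 : τ.scalar .base2 = baseline I x (insert x D) c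
  table : ∃ C L G, τ.array .cost = tab l C ∧ τ.array .label = tab l L ∧
    IsTable l (fun _ => c) (overhead I x k π B D) C L G
  table2 : ∃ C L G, τ.array .cost2 = tab l C ∧ τ.array .label2 = tab l L ∧
    IsTable l (fun _ => c) (overhead I x k π B (insert x D)) C L G

/-- Every subtree dominates itself, and the subtrees of the children have fewer than `n` vertices in
total. -/
theorem toNat_baseline_le {D : Set (Fin n)} {m : ℕ} (hm : m ≤ I.deg x) :
    (baseline I x D m).toNat ≤ n := by
  have h1 : baseline I x D m ≤
      ((∑ c ∈ Finset.range (I.deg x), (I.forest.subtree (I.kid x c)).card : ℕ) : ℕ∞) := by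
    rw [Nat.cast_sum]
    refine (Finset.sum_le_sum fun c _ => domCost_empty_le).trans ?_
    exact Finset.sum_le_sum_of_subset (Finset.range_subset_range.2 hm)
  refine (ENat.toNat_le_toNat h1 (ENat.natCast_ne_top _)).trans ?_
  rw [ENat.toNat_natCast]
  have h2 := I.card_subtree x
  have h3 : (I.forest.subtree x).card ≤ n := (Finset.card_le_univ _).trans (by simp)
  omega

/-- The part of the state in the loop over the blocks that concerns one of the two tables. -/
def RowProgress (l r c : ℕ) (ov : ℕ → ℕ → ℕ∞) (a : ℕ) (tc tl : Arr) (τ : Frame) : Prop :=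
  ∃ C L G, τ.array tc = tab l C ∧ τ.array tl = tab l L ∧
    IsTable l (fun i => if i < r then c + 1 else c) ov C L G ∧
    ∀ i < l, ∀ j < l, C i j ≠ ⊤ → (L i j = (a : ℕ) ↔ G i j = c)

/-- The effect of the insertion on the arrays is fed into `IsTable.insert`. That the label `a` marks
exactly the finite entries of child `c` survives, so the same label can be used in the next row. -/
theorem runs_insertEntry_rowProgress {tc tl : Arr} {cost : Var} {r c a : ℕ} {ov : ℕ → ℕ → ℕ∞}
    (hne : tc ≠ tl) (hσ : σ.Fits Λ) (hl : σ.scalar .l = l)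
    (hrow : σ.scalar .row = ((r * l : ℕ) : ℕ∞)) (hr : r < l)
    (hx : σ.scalar cost = ov r c) (hlab : σ.scalar .lab = (a : ℕ))
    (hxM : (ov r c).toNat ≤ Λ.M) (haM : a ≤ Λ.M) (hlN : l ≤ Λ.N) (hK : l ≤ Λ.K)
    (h : RowProgress l r c ov a tc tl σ) :
    Runs I Λ κ (insertEntry tc tl cost) σ (RowProgress l (r + 1) c ov a tc tl) := by
  obtain ⟨C, L, G, hC, hL, ht, hf⟩ := h
  refine (runs_insertEntry hne hσ hl hrow hr hC hL hx hlab hxM (by rwa [ENat.toNat_natCast]) hlN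
    hK).mono ?_
  rintro τ - - ⟨ρ, h1, h2, h3, h4⟩
  have hins := ht.insert (b := (a : ℕ)) (ρ := ρ) hr
  simp only [lt_irrefl, if_false] at hins
  obtain ⟨G', g1, g2⟩ := hins hf h1 h2
  have hupd : Function.update (fun i => if i < r then c + 1 else c : ℕ → ℕ) r (c + 1) =
      fun i => if i < r + 1 then c + 1 else c := by
    funext i
    rw [Function.update_apply]
    split_ifs <;> omega
  rw [hupd] at g1
  exact ⟨_, _, G', h3, h4, g1, g2⟩

/-- Each call is replaced by `domCost` through `hsol`. The label is fresh for both tables before the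
first insertion, so throughout the loop over the blocks it identifies the entries of child `c`. -/
theorem runs_processChild {B : ℕ → ℕ} {P : ℕ → Prop} {D : Set (Fin n)} {c Tc Sc : ℕ}
    (hσ : σ.Fits Λ) (hc : c < I.deg x) (hx : σ.scalar .x = (x : ℕ)) (hk : σ.scalar .k = k)
    (hl : σ.scalar .l = l) (hci : σ.scalar .ci = (c : ℕ))
    (hBσ : σ.array .B = arr (k + 1) fun p => (B p : ℕ∞))
    (hlB : l = maxBelow B (k + 1)) (hB : IsBlocks (k + 1) P B) (hl0 : 0 < l)
    (hπ : IsPath I x k π) (hDsub : D ⊆ {w | ∃ p < k, π p = w})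
    (hsol : Solves I (I.kid x c) (k + 1) π Tc Sc) (hκ : 2 * k + 11 + Tc ≤ κ)
    (hSc : frameBits Λ.N Λ.M Λ.L + exprBits Λ.N + 3 + Sc ≤ Λ.S) (hΛ : Λ.Admits (k + 1))
    (h : Progress I x k π B D l c σ) :
    Runs I Λ κ processChild σ (Progress I x k π B D l (c + 1)) := by
  have hlk : l ≤ k + 1 := hlB ▸ hB.maxBelow_le _
  have hΛl := hΛ.mono hlk
  have hkk : k + 1 ≤ (k + 1) * (k + 1) := Nat.le_mul_self _
  have hll : l ≤ l * l := Nat.le_mul_self _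
  obtain ⟨a1, a2, a3, a4, -⟩ := hΛ
  obtain ⟨b1, b2, b3, b4, -⟩ := hΛl
  have hLN := Λ.L_le
  have hMN := Λ.M_le
  have hblock : ∀ i, (arr (k + 1) fun p => ind (B p = i)) =
      arr (k + 1) fun p => ind (π p ∈ blockSet π k B i) := fun i =>
    arr_congr fun p hp => by
      congr 1
      refine propext ⟨fun h => ⟨p, by omega, rfl, h⟩, ?_⟩
      rintro ⟨q, hq, he, h⟩
      rwa [← hπ.inj hq (by omega) he]
  -- Block `l + 1` does not exist, so selecting it yields the empty set that the baseline calls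
  -- need.
  have hempty : (arr (k + 1) fun p => ind (B p = l + 1)) =
      arr (k + 1) fun p => ind (π p ∈ (∅ : Set (Fin n))) := arr_congr fun p hp => by
    have := le_maxBelow (B := B) hp
    rw [ind_false (by omega), ind_false (by simp)]
  have hblocksub : ∀ i, blockSet π k B i ⊆ {w | ∃ p < k + 1, π p = w} := by
    rintro i w ⟨p, hp, he, -⟩
    exact ⟨p, by omega, he⟩
  obtain ⟨⟨d₀, hDσ⟩, hbase, hbase2, ⟨C₁, L₁, G₁, hC₁, hL₁, ht₁⟩, ⟨C₂, L₂, G₂, hC₂, hL₂, ht₂⟩⟩ := h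
  set y := I.kid x c with hydef
  unfold processChild
  refine Runs.assign_seq' (y : ℕ) hσ ?_ fun hσ => ?_
  · simp only [Expr.eval, eval_v, hx, hci, ENat.toNat_natCast, Input.childQuery_eq hc]
    rfl
  -- the baseline costs
  refine Runs.seq (runs_selectBlock (B := B) (a := l + 1) hσ (by simpa using hk)
    (by simpa using hBσ) (fun τ hag => ?_) (by omega) (by omega)) ?_
  · have := hag.scalar .l rfl
    simp [Expr.eval, this, hl]
  intro τ₁ hτ₁ hag₁ hS₁
  rw [hempty] at hS₁
  have hy₁ : τ₁.scalar .y = (y : ℕ) := by simpa using hag₁.scalar .y rfl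
  have hk₁ : τ₁.scalar .k = k := by simpa [hk] using hag₁.scalar .k rfl
  have hl₁ : τ₁.scalar .l = l := by simpa [hl] using hag₁.scalar .l rfl
  have hD₁ : τ₁.array .D = nodeArray k π D d₀ := by simpa [hDσ] using hag₁.array .D rfl
  have hbase₁ : τ₁.scalar .base = baseline I x D c := by simpa [hbase] using hag₁.scalar .base rfl
  have hbase2₁ : τ₁.scalar .base2 = baseline I x (insert x D) c := by
    simpa [hbase2] using hag₁.scalar .base2 rfl
  have hB₁ : τ₁.array .B = _ := (hag₁.array .B rfl).trans hBσ
  replace hC₁ : τ₁.array .cost = _ := (hag₁.array .cost rfl).trans hC₁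
  replace hL₁ : τ₁.array .label = _ := (hag₁.array .label rfl).trans hL₁
  replace hC₂ : τ₁.array .cost2 = _ := (hag₁.array .cost2 rfl).trans hC₂
  replace hL₂ : τ₁.array .label2 = _ := (hag₁.array .label2 rfl).trans hL₂
  clear hag₁
  refine Runs.seq (runs_recurse (s := .b) (d := 0) hτ₁ hy₁ hk₁ hS₁ hD₁ hπ hDsub
    (Set.empty_subset _) (.inl ⟨rfl, rfl⟩) hsol hκ hSc) ?_
  rintro τ₂ hτ₂ hag₂ ⟨hb₂, hD₂⟩
  refine Runs.assign_seq (baseline I x D (c + 1)) hτ₂ ?_ ?_ fun hτ₂ => ?_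
  · simp only [Expr.eval, eval_v, hb₂, hag₂.scalar .base rfl, hbase₁]
    rw [baseline, baseline, Finset.sum_range_succ]
  · exact (toNat_baseline_le hc).trans Λ.n_le
  refine Runs.seq (runs_recurse (s := .b2) (d := 1) (D := D) (A := ∅) (d₀ := (0 : ℕ)) (y := y) hτ₂
    (by simpa [hy₁] using hag₂.scalar .y rfl)
    (by simpa [hk₁] using hag₂.scalar .k rfl)
    (by simpa using (hag₂.array .S rfl).trans hS₁) (by simpa using hD₂) hπ hDsub
    (Set.empty_subset _) (.inr ⟨rfl, rfl⟩) hsol hκ hSc) ?_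
  rintro τ₃ hτ₃ hag₃ ⟨hb2₃, hD₃⟩
  refine Runs.assign_seq (baseline I x (insert x D) (c + 1)) hτ₃ ?_ ?_ fun hτ₃ => ?_
  · have h1 := hag₂.scalar .base2 rfl
    have h2 := hag₃.scalar .base2 rfl
    simp only [Frame.setScalar_scalar, reduceCtorEq, if_false, h1] at h2
    simp only [Expr.eval, eval_v, hb2₃, h2, hbase2₁]
    rw [baseline, baseline, Finset.sum_range_succ]
  · exact (toNat_baseline_le hc).trans Λ.n_le
  have hag₄ : ∀ s, s ≠ .base → s ≠ .base2 → s ≠ .b → s ≠ .b2 → τ₃.scalar s = τ₁.scalar s := by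
    intro s s1 s2 s3 s4
    have h1 := hag₂.scalar s (by simp [recurse, Cmd.writesScalar, s3.symm])
    have h2 := hag₃.scalar s (by simp [recurse, Cmd.writesScalar, s4.symm])
    simpa [s1, s2, h1] using h2
  have harr₄ : ∀ a, a ≠ .D → τ₃.array a = τ₁.array a := by
    intro a ha
    have h1 := hag₂.array a (by simp [recurse, Cmd.writesArray, ha.symm])
    have h2 := hag₃.array a (by simp [recurse, Cmd.writesArray, ha.symm])
    simpa [h1] using h2
  have hb₃ : τ₃.scalar .b = domCost I y ∅ D := by simpa [hb₂] using hag₃.scalar .b rfl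
  have hbase₃ : τ₃.scalar .base = baseline I x D (c + 1) := by simpa using hag₃.scalar .base rfl
  clear hag₂ hag₃
  -- the label
  refine Runs.seq (runs_freshLabel hτ₃
    ((harr₄ .label (by simp)).trans hL₁) ((harr₄ .label2 (by simp)).trans hL₂) (by omega) b4) ?_
  rintro τ₅ hτ₅ hag₅ ⟨a, ha, hlab, hfresh⟩
  have hfr : ∀ i < l, ∀ j < l, L₁ i j ≠ (a : ℕ) ∧ L₂ i j ≠ (a : ℕ) := by
    intro i hi j hj
    have := hfresh _ (Nat.mul_add_lt_mul hi hj)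
    obtain ⟨h1, h2⟩ := Nat.mul_add_div_mod (i := i) hj
    rwa [h1, h2] at this
  refine Runs.assign_seq' (0 : ℕ) hτ₅ rfl fun hτ₅' => ?_
  have hag : ∀ s, s ≠ .base → s ≠ .base2 → s ≠ .b → s ≠ .b2 → s ≠ .lab → s ≠ .used → s ≠ .j →
      τ₅.scalar s = τ₁.scalar s := by
    intro s s1 s2 s3 s4 s5 s6 s7
    rw [← hag₄ s s1 s2 s3 s4]
    simpa [s2] using hag₅.scalar s (by
      simp [freshLabel, forLoop, Cmd.writesScalar, s5.symm, s6.symm, s7.symm])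
  have harr : ∀ a, a ≠ .D → τ₅.array a = τ₁.array a := fun a ha => by
    rw [← harr₄ a ha]
    exact hag₅.array a (by simp [freshLabel, forLoop, Cmd.writesArray])
  have hD₅ : τ₅.array .D = _ := (hag₅.array .D rfl).trans hD₃
  have hb₅ : τ₅.scalar .b = domCost I y ∅ D := by simpa [hb₃] using hag₅.scalar .b rfl
  have hb2₅ : τ₅.scalar .b2 = domCost I y ∅ (insert x D) := by
    simpa [hb2₃] using hag₅.scalar .b2 rfl
  have hbase₅ : τ₅.scalar .base = baseline I x D (c + 1) := by
    simpa [hbase₃] using hag₅.scalar .base rfl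
  have hbase2₅ : τ₅.scalar .base2 = baseline I x (insert x D) (c + 1) := by
    simpa using hag₅.scalar .base2 rfl
  have hy₅ : τ₅.scalar .y = (y : ℕ) := by rw [hag .y] <;> simp [hy₁]
  have hk₅ : τ₅.scalar .k = k := by rw [hag .k] <;> simp [hk₁]
  have hl₅ : τ₅.scalar .l = l := by rw [hag .l] <;> simp [hl₁]
  have hB₅ : τ₅.array .B = _ := (harr .B (by simp)).trans hB₁
  have hC₁₅ := (harr .cost (by simp)).trans hC₁
  have hL₁₅ := (harr .label (by simp)).trans hL₁
  have hC₂₅ := (harr .cost2 (by simp)).trans hC₂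
  have hL₂₅ := (harr .label2 (by simp)).trans hL₂
  clear hag harr hag₄ harr₄ hag₅
  -- the blocks
  refine (Runs.forLoop l (fun r τ => τ.scalar .row = ((r * l : ℕ) : ℕ∞) ∧
    (∃ d, τ.array .D = nodeArray k π D d) ∧
    RowProgress l r c (overhead I x k π B D) a .cost .label τ ∧
    RowProgress l r c (overhead I x k π B (insert x D)) a .cost2 .label2 τ) hτ₅' (by omega)
    (by omega) (fun τ hτ hag => ?_) ?_ ?_).mono ?_
  · simpa [hl₅] using hag.scalar .l rfl
  · refine ⟨by simp, ⟨_, by simpa using hD₅⟩, ⟨C₁, L₁, G₁, by simpa using hC₁₅, by simpa using hL₁₅,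
      by simpa using ht₁, fun i hi j hj hf => ?_⟩, ⟨C₂, L₂, G₂, by simpa using hC₂₅,
      by simpa using hL₂₅, by simpa using ht₂, fun i hi j hj hf => ?_⟩⟩
    -- Initially both sides of the equivalence are false: the label is fresh, and all entries belong
    -- to children before `c`.
    · have h1 := (ht₁.mem i hi j hj hf).1
      exact iff_of_false (hfr i hi j hj).1 (by omega)
    · have h1 := (ht₂.mem i hi j hj hf).1
      exact iff_of_false (hfr i hi j hj).2 (by omega)
  · rintro r hr τ hτ hagτ hi ⟨hrow, ⟨d, hD⟩, ht1, ht2⟩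
    have hy : τ.scalar .y = (y : ℕ) := by simpa [hy₅] using hagτ.scalar .y rfl
    have hk : τ.scalar .k = k := by simpa [hk₅] using hagτ.scalar .k rfl
    have hl : τ.scalar .l = l := by simpa [hl₅] using hagτ.scalar .l rfl
    have hb : τ.scalar .b = domCost I y ∅ D := by simpa [hb₅] using hagτ.scalar .b rfl
    have hb2 : τ.scalar .b2 = domCost I y ∅ (insert x D) := by
      simpa [hb2₅] using hagτ.scalar .b2 rfl
    have hlabτ : τ.scalar .lab = (a : ℕ) := by simpa [hlab] using hagτ.scalar .lab rfl
    have hBτ : τ.array .B = _ := (hagτ.array .B rfl).trans hB₅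
    clear hagτ
    refine Runs.seq (runs_selectBlock (B := B) (a := r + 1) hτ hk hBτ (fun υ hag => ?_) (by omega)
      (by omega)) ?_
    · have := hag.scalar .i rfl
      simp [Expr.eval, this, hi]
    intro υ₁ hυ₁ hag₁ hS₁
    rw [hblock] at hS₁
    refine Runs.seq (runs_recurse (s := .c) (d := 0) hυ₁ ((hag₁.scalar .y rfl).trans hy)
      ((hag₁.scalar .k rfl).trans hk) hS₁ ((hag₁.array .D rfl).trans hD) hπ hDsub
      (hblocksub _) (.inl ⟨rfl, rfl⟩) hsol hκ hSc) ?_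
    rintro υ₂ hυ₂ hag₂ ⟨hc₂, hD₂⟩
    refine Runs.assign_seq' (overhead I x k π B D r c) hυ₂ ?_ fun hυ₂' => ?_
    · simp only [Expr.eval, eval_v, hc₂, hag₂.scalar .b rfl, hag₁.scalar .b rfl, hb]
      rfl
    refine Runs.seq (runs_recurse (s := .c2) (d := 1) (D := D) (d₀ := (0 : ℕ)) (y := y)
      (A := blockSet π k B (r + 1)) hυ₂'
      (by simp [hag₂.scalar .y rfl, hag₁.scalar .y rfl, hy])
      (by simp [hag₂.scalar .k rfl, hag₁.scalar .k rfl, hk])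
      (by simp [hag₂.array .S rfl, hS₁]) (by simpa using hD₂) hπ hDsub
      (hblocksub _) (.inr ⟨rfl, rfl⟩) hsol hκ hSc) ?_
    rintro υ₃ hυ₃ hag₃ ⟨hc₃, hD₃⟩
    refine Runs.assign_seq' (overhead I x k π B (insert x D) r c) hυ₃ ?_ fun hυ₃' => ?_
    · have h3 := hag₃.scalar .b2 rfl
      simp only [Frame.setScalar_scalar, reduceCtorEq, if_false, hag₂.scalar .b2 rfl,
        hag₁.scalar .b2 rfl, hb2] at h3
      simp only [Expr.eval, eval_v, hc₃, h3]
      rfl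
    have hs : ∀ s, s ≠ .p → s ≠ .c → s ≠ .c2 → υ₃.scalar s = τ.scalar s := by
      intro s s1 s2 s3
      have h1 := hag₁.scalar s (by simp [selectBlock, forLoop, Cmd.writesScalar, s1.symm])
      have h2 := hag₂.scalar s (by simp [recurse, Cmd.writesScalar, s2.symm])
      have h3 := hag₃.scalar s (by simp [recurse, Cmd.writesScalar, s3.symm])
      simpa [s2, h1, h2] using h3
    have hA : ∀ a, a ≠ .S → a ≠ .D → υ₃.array a = τ.array a := by
      intro a a1 a2
      have h1 := hag₁.array a (by simp [selectBlock, forLoop, Cmd.writesArray, a1.symm])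
      have h2 := hag₂.array a (by simp [recurse, Cmd.writesArray, a2.symm])
      have h3 := hag₃.array a (by simp [recurse, Cmd.writesArray, a2.symm])
      simpa [h1, h2] using h3
    have hov : υ₃.scalar .c = overhead I x k π B D r c := by simpa using hag₃.scalar .c rfl
    clear hag₁ hag₂ hag₃
    have hcopy : ∀ {ov tc tl} (υ : Frame), υ.array tc = τ.array tc → υ.array tl = τ.array tl →
        RowProgress l r c ov a tc tl τ → RowProgress l r c ov a tc tl υ := by
      rintro ov tc tl υ h1 h2 ⟨C, L, G, g1, g2, g3⟩
      exact ⟨C, L, G, h1.trans g1, h2.trans g2, g3⟩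
    have hrow₃ : υ₃.scalar .row = ((r * l : ℕ) : ℕ∞) := by rw [hs .row] <;> simp [hrow]
    have hl₃ : υ₃.scalar .l = l := by rw [hs .l] <;> simp [hl]
    have hlab₃ : υ₃.scalar .lab = (a : ℕ) := by rw [hs .lab] <;> simp [hlabτ]
    refine Runs.seq (runs_insertEntry_rowProgress (ov := overhead I x k π B D) (c := c) (by simp)
      hυ₃' (by simpa using hl₃) (by simpa using hrow₃) hr (by simpa using hov)
      (by simpa using hlab₃) ((overhead_toNat_le B D r c).trans (by omega)) (by omega) (by omega)
      (by omega)
      (hcopy _ (by simpa using hA .cost (by simp) (by simp))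
        (by simpa using hA .label (by simp) (by simp)) ht1)) ?_
    intro υ₄ hυ₄ hag₄ ht1'
    refine Runs.seq (runs_insertEntry_rowProgress (ov := overhead I x k π B (insert x D)) (c := c)
      (by simp) hυ₄ ((hag₄.scalar .l rfl).trans (by simpa using hl₃))
      ((hag₄.scalar .row rfl).trans (by simpa using hrow₃)) hr
      ((hag₄.scalar .c2 rfl).trans (by simp)) ((hag₄.scalar .lab rfl).trans (by simpa using hlab₃))
      ((overhead_toNat_le B _ r c).trans (by omega)) (by omega) (by omega) (by omega)
      (hcopy _ ((hag₄.array .cost2 rfl).trans (by simpa using hA .cost2 (by simp) (by simp)))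
        ((hag₄.array .label2 rfl).trans (by simpa using hA .label2 (by simp) (by simp))) ht2)) ?_
    intro υ₅ hυ₅ hag₅ ht2'
    have hle : (r + 1) * l ≤ l * l := Nat.mul_le_mul_right _ hr
    refine Runs.assign (x := (((r + 1) * l : ℕ) : ℕ∞)) hυ₅ ?_ ?_ ?_
    · have h1 := (hag₅.scalar .row rfl).trans (hag₄.scalar .row rfl)
      have h2 := (hag₅.scalar .l rfl).trans (hag₄.scalar .l rfl)
      simp only [Frame.setScalar_scalar, reduceCtorEq, if_false, hrow₃, hl₃] at h1 h2
      simp [Expr.eval, h1, h2, add_mul]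
    · rw [ENat.toNat_natCast]; omega
    · refine ⟨by simp, ⟨((1 : ℕ) : ℕ∞), ?_⟩, ?_, ?_⟩
      · simpa [hD₃] using (hag₅.array .D rfl).trans (hag₄.array .D rfl)
      · obtain ⟨C, L, G, g1, g2, g3⟩ := ht1'
        exact ⟨C, L, G, by simpa [g1] using hag₅.array .cost rfl,
          by simpa [g2] using hag₅.array .label rfl, g3⟩
      · exact ht2'
  · rintro τ hτ hag ⟨-, -, hD, ⟨C, L, G, g1, g2, g3, -⟩, ⟨C', L', G', g1', g2', g3', -⟩⟩
    have hY : ∀ {ov C L G}, IsTable l (fun i => if i < l then c + 1 else c) ov C L G →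
        IsTable l (fun _ => c + 1) ov C L G := by
      rintro ov C L G ⟨h1, h2, h3, h4⟩
      exact ⟨fun i hi => by simpa [hi] using h1 i hi, h2, fun i hi => by simpa [hi] using h3 i hi,
        h4⟩
    exact ⟨hD, by simpa [hbase₅] using hag.scalar .base rfl,
      by simpa [hbase2₅] using hag.scalar .base2 rfl, ⟨C, L, G, g1, g2, hY g3⟩,
      ⟨C', L', G', g1', g2', hY g3'⟩⟩

end Domset

namespace Domset

variable {n : ℕ} {I : Input n} {Λ : Limits n} {σ : Frame} {x : Fin n} {k : ℕ} {π : ℕ → Fin n}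

/-! The loop over the partitions. -/

/-- The work on one partition. -/
def tryPartition : Cmd :=
  .seq countBlocks <| .seq (initTable .cost .label) <| .seq (initTable .cost2 .label2) <|
  .seq (.assign .base (.num 0)) <| .seq (.assign .base2 (.num 0)) <|
  .seq (forLoop .ci (.deg (v .x)) processChild) <|
  .seq (findMinSolution .cost .label) <|
  .seq (.ite (.lt (.add (v .best) (v .base)) (v .result))
    (.assign .result (.add (v .best) (v .base))) .skip) <|
  .seq (findMinSolution .cost2 .label2) <|
  .seq (.ite (.lt (.add (.add (v .best) (v .base2)) (.num 1)) (v .result))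
    (.assign .result (.add (.add (v .best) (v .base2)) (.num 1))) .skip) nextPartition

/-- The cost of `tryPartition` without the loop over the children. -/
def tryPartitionCost (K : ℕ) : ℕ :=
  countBlocks.cost K 0 + (initTable .cost .label).cost K 0 + (initTable .cost2 .label2).cost K 0 +
  (findMinSolution .cost .label).cost K 0 + (findMinSolution .cost2 .label2).cost K 0 +
  nextPartition.cost K 0 + 35

theorem runs_updateResult {e : Expr} {z r : ℕ∞} (hσ : σ.Fits Λ) (hr : σ.scalar .result = r)
    (he : e.eval I σ = z) (hz : z.toNat ≤ Λ.N) (hs : e.small = true := by rfl)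
    (ht : e.time ≤ 5 := by exact Nat.le_of_ble_eq_true rfl) :
    RunsIn I Λ (.ite (.lt e (v .result)) (.assign .result e) .skip) σ (2 * e.time + 4)
      fun τ => τ.scalar .result = min r z := by
  refine (RunsIn.ite (z < r) hσ ?_ (fun h => RunsIn.assign (x := z) hσ he hz ?_ hs (by omega))
    (fun h => RunsIn.skip hσ ?_) (by simpa [Expr.small, v] using hs)
    (by simp only [Expr.time, v]; omega)).weaken ?_
  · simp [Expr.eval, he, hr]
  · simp [min_eq_right h.le]
  · simp [hr, min_eq_left (not_lt.1 h)]
  · simp only [Expr.time, v]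
    have : max (e.time + 1) 1 = e.time + 1 := max_eq_left (by omega)
    omega

theorem toNat_add_best_le {z b : ℕ∞} {l c : ℕ} (hz : z.toNat ≤ l * Λ.M) (hb : b.toNat ≤ n)
    (hl : l ≤ k + 1) : (z + b + (c : ℕ)).toNat ≤ (k + 1) * Λ.M + n + c := by
  have h1 := ENat.toNat_add_le (z + b) (c : ℕ)
  have h2 := ENat.toNat_add_le z b
  have h3 : l * Λ.M ≤ (k + 1) * Λ.M := Nat.mul_le_mul_right _ hl
  rw [ENat.toNat_natCast] at h1
  omega

theorem maxBelow_pos {B : ℕ → ℕ} {P : ℕ → Prop} (hB : IsBlocks (k + 1) P B) (hP : P k) :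
    0 < maxBelow B (k + 1) :=
  (hB.pos k (by omega) hP).trans (le_maxBelow (by omega))

theorem Progress.setScalar_ci {B : ℕ → ℕ} {D : Set (Fin n)} {l c : ℕ}
    (h : Progress I x k π B D l c σ) (a : ℕ∞) :
    Progress I x k π B D l c (σ.setScalar .ci a) where
  arrD := h.arrD
  base := by simpa using h.base
  base2 := by simpa using h.base2
  table := h.table
  table2 := h.table2

/-- Stated with `RunsIn`, so that the times of the children appear as a sum. The pieces without
calls use the uniform bound with `κ = 0`. -/
theorem runs_tryPartition {B : ℕ → ℕ} {P : ℕ → Prop} {D : Set (Fin n)} {Tc : ℕ → ℕ} {Sc : ℕ}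
    {r : ℕ∞} (hσ : σ.Fits Λ) (hx : σ.scalar .x = (x : ℕ)) (hk : σ.scalar .k = k)
    (hr : σ.scalar .result = r)
    (hP : σ.array .P = arr (k + 1) fun p => ind (P p))
    (hBσ : σ.array .B = arr (k + 1) fun p => (B p : ℕ∞)) (hD : ∃ d, σ.array .D = nodeArray k π D d)
    (hB : IsBlocks (k + 1) P B) (hPk : P k)
    (hπ : IsPath I x k π) (hDsub : D ⊆ {w | ∃ p < k, π p = w})
    (hsol : ∀ c < I.deg x, Solves I (I.kid x c) (k + 1) π (Tc c) Sc)
    (hSc : frameBits Λ.N Λ.M Λ.L + exprBits Λ.N + 3 + Sc ≤ Λ.S) (hΛ : Λ.Admits (k + 1)) :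
    RunsIn I Λ tryPartition σ
      (tryPartitionCost Λ.K +
        ∑ c ∈ Finset.range (I.deg x), (processChild.cost Λ.K (2 * k + 11 + Tc c) + 9))
      fun τ => (∃ d, τ.array .D = nodeArray k π D d) ∧ (∃ z z',
        IsBestAssignment (maxBelow B (k + 1)) (I.deg x) (overhead I x k π B D) z ∧
        IsBestAssignment (maxBelow B (k + 1)) (I.deg x) (overhead I x k π B (insert x D)) z' ∧
        (z + baseline I x D (I.deg x)).toNat ≤ (k + 1) * Λ.M + n + 1 ∧
        (z' + baseline I x (insert x D) (I.deg x) + 1).toNat ≤ (k + 1) * Λ.M + n + 1 ∧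
        τ.scalar .result = min (min r (z + baseline I x D (I.deg x)))
          (z' + baseline I x (insert x D) (I.deg x) + 1)) ∧
        (τ.scalar .more = 0 ∧ (∀ C, IsBlocks (k + 1) P C → toLex C ≤ toLex B) ∨
        τ.scalar .more = 1 ∧ ∃ B', IsBlocks (k + 1) P B' ∧
          (τ.array .B = arr (k + 1) fun p => (B' p : ℕ∞)) ∧ toLex B < toLex B' ∧
          ∀ C, IsBlocks (k + 1) P C → toLex B < toLex C → toLex B' ≤ toLex C) := by
  obtain ⟨l, hlB⟩ : ∃ l, l = maxBelow B (k + 1) := ⟨_, rfl⟩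
  rw [← hlB]
  have hl0 : 0 < l := hlB ▸ maxBelow_pos hB hPk
  have hlk : l ≤ k + 1 := hlB ▸ hB.maxBelow_le _
  have hΛl := hΛ.mono hlk
  have hkk : k + 1 ≤ (k + 1) * (k + 1) := Nat.le_mul_self _
  have hll : l ≤ l * l := Nat.le_mul_self _
  have hpow : l ^ l ≤ (l + 1) ^ l := Nat.pow_le_pow_left (by omega) _
  have hΛ' := hΛ
  obtain ⟨a1, a2, a3, a4, -⟩ := hΛ'
  obtain ⟨b1, b2, b3, b4, b5⟩ := hΛl
  have hLN := Λ.L_le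
  have hMN := Λ.M_le
  have hdeg : I.deg x ≤ n := by
    have h2 := I.card_subtree x
    have h3 : (I.forest.subtree x).card ≤ n := (Finset.card_le_univ _).trans (by simp)
    have h4 : I.deg x ≤ ∑ c ∈ Finset.range (I.deg x), (I.forest.subtree (I.kid x c)).card := by
      refine le_trans (by simp) (Finset.card_nsmul_le_sum _ _ 1 fun c _ => ?_)
      exact Finset.card_pos.2 ⟨_, RootedForest.self_mem_subtree _⟩
    omega
  -- The constant 35 is `4` for the two assignments, `7` for setting up the loop over the children,
  -- and `10` and `14` for the two updates of the result.
  refine RunsIn.weaken (T₁ := countBlocks.cost Λ.K 0 +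
      ((initTable .cost .label).cost Λ.K 0 + ((initTable .cost2 .label2).cost Λ.K 0 +
      (1 + 1 + (1 + 1 + ((2 + 5 + ∑ c ∈ Finset.range (I.deg x),
        (processChild.cost Λ.K (2 * k + 11 + Tc c) + 9)) +
      ((findMinSolution .cost .label).cost Λ.K 0 + (2 * 3 + 4 +
      ((findMinSolution .cost2 .label2).cost Λ.K 0 + (2 * 5 + 4 +
        nextPartition.cost Λ.K 0)))))))))) ?_
    (by unfold tryPartitionCost; omega)
  refine RunsIn.seq (runs_countBlocks (κ := 0) hσ hk hBσ (by omega) (by omega))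
    fun τ₁ hτ₁ hag₁ hl₁ => ?_
  refine RunsIn.seq (runs_initTable (κ := 0) (l := l) (by simp) hτ₁ (hlB ▸ hl₁) b1
    (by omega) (by omega)) fun τ₂ hτ₂ hag₂ ⟨hC₂, hL₂⟩ => ?_
  refine RunsIn.seq (runs_initTable (κ := 0) (l := l) (by simp) hτ₂
    ((hag₂.scalar .l rfl).trans (hlB ▸ hl₁)) b1 (by omega) (by omega))
    fun τ₃ hτ₃ hag₃ ⟨hC₃, hL₃⟩ => ?_
  refine RunsIn.assign_seq' (0 : ℕ) hτ₃ rfl fun hτ₄ => ?_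
  refine RunsIn.assign_seq' (0 : ℕ) hτ₄ rfl fun hτ₅ => ?_
  have hs : ∀ s, s ≠ .l → s ≠ .p → s ≠ .i → s ≠ .j → s ≠ .base → s ≠ .base2 →
      ((τ₃.setScalar .base (0 : ℕ)).setScalar .base2 (0 : ℕ)).scalar s = σ.scalar s := by
    intro s s1 s2 s3 s4 s5 s6
    have h1 := hag₁.scalar s (by simp [countBlocks, forLoop, Cmd.writesScalar, s1.symm, s2.symm])
    have h2 := hag₂.scalar s (by simp [initTable, forLoop, Cmd.writesScalar, s3.symm, s4.symm])
    have h3 := hag₃.scalar s (by simp [initTable, forLoop, Cmd.writesScalar, s3.symm, s4.symm])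
    simp [s5, s6, h1, h2, h3]
  have hA : ∀ a, a ≠ .cost → a ≠ .label → a ≠ .cost2 → a ≠ .label2 →
      ((τ₃.setScalar .base (0 : ℕ)).setScalar .base2 (0 : ℕ)).array a = σ.array a := by
    intro a s1 s2 s3 s4
    have h1 := hag₁.array a (by simp [countBlocks, forLoop, Cmd.writesArray])
    have h2 := hag₂.array a (by simp [initTable, forLoop, Cmd.writesArray, s1.symm, s2.symm])
    have h3 := hag₃.array a (by simp [initTable, forLoop, Cmd.writesArray, s3.symm, s4.symm])
    simp [h1, h2, h3]
  have hl₅ : ((τ₃.setScalar .base (0 : ℕ)).setScalar .base2 (0 : ℕ)).scalar .l = (l : ℕ) := by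
    simp [hag₃.scalar .l rfl, hag₂.scalar .l rfl, hl₁, hlB]
  have hp0 : Progress I x k π B D l 0 ((τ₃.setScalar .base (0 : ℕ)).setScalar .base2 (0 : ℕ)) := by
    refine ⟨?_, by simp [baseline], by simp [baseline], ⟨_, _, fun _ _ => 0, ?_, ?_,
      IsTable.empty l _ (fun _ _ => 0) _⟩, ⟨_, _, fun _ _ => 0, ?_, ?_,
      IsTable.empty l _ (fun _ _ => 0) _⟩⟩
    · obtain ⟨d, hd⟩ := hD
      exact ⟨d, by rw [hA .D] <;> simp [hd]⟩
    · simpa [hC₂] using hag₃.array .cost rfl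
    · simpa [hL₂] using hag₃.array .label rfl
    · simpa using hC₃
    · simpa using hL₃
  have hx₅ := (hs .x (by simp) (by simp) (by simp) (by simp) (by simp) (by simp)).trans hx
  have hk₅ := (hs .k (by simp) (by simp) (by simp) (by simp) (by simp) (by simp)).trans hk
  have hr₅ := (hs .result (by simp) (by simp) (by simp) (by simp) (by simp) (by simp)).trans hr
  have hB₅ := (hA .B (by simp) (by simp) (by simp) (by simp)).trans hBσ
  have hP₅ := (hA .P (by simp) (by simp) (by simp) (by simp)).trans hP
  clear hs hA hag₁ hag₂ hag₃
  generalize (τ₃.setScalar .base (0 : ℕ)).setScalar .base2 (0 : ℕ) = σ₅ at *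
  refine RunsIn.seq (RunsIn.forLoop (I.deg x) (Progress I x k π B D l)
    (fun c => processChild.cost Λ.K (2 * k + 11 + Tc c)) hτ₅ (hdeg.trans Λ.n_le)
    (fun τ hτ hag => ?_) ?_ ?_) fun τ₆ hτ₆ hag₆ ⟨_, hprog⟩ => ?_
  · have h1 : τ.scalar .x = (x : ℕ) := (hag.scalar .x rfl).trans hx₅
    simp [Expr.eval, h1, Input.degQuery_eq]
  · exact hp0.setScalar_ci _
  · intro c hc τ hτ hag hci hpr
    refine RunsIn.mono (runs_processChild hτ hc ((hag.scalar .x rfl).trans hx₅)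
      ((hag.scalar .k rfl).trans hk₅) ((hag.scalar .l rfl).trans hl₅) hci
      ((hag.array .B rfl).trans hB₅) hlB hB hl0 hπ hDsub (hsol c hc) le_rfl hSc hΛ hpr) le_rfl
      fun τ' _ _ h => h.setScalar_ci _
  obtain ⟨⟨d, hd⟩, hbase, hbase2, ⟨C, L, G, hC, hL, ht⟩, ⟨C', L', G', hC', hL', ht'⟩⟩ := hprog
  have hl₆ := (hag₆.scalar .l rfl).trans hl₅
  refine RunsIn.seq (runs_findMinSolution (κ := 0) (by simp) (by simp) hτ₆ hl₆ hl0 hC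
    hL b1 (by omega) (by omega) (by omega) (by omega)) fun τ₇ hτ₇ hag₇ ⟨hz, hzM⟩ => ?_
  set z := τ₇.scalar .best
  have hbl := toNat_add_best_le (b := baseline I x D (I.deg x)) (c := 0) hzM
    (toNat_baseline_le (D := D) le_rfl) hlk
  rw [Nat.cast_zero, add_zero] at hbl
  refine RunsIn.seq (runs_updateResult (r := r)
    (z := z + baseline I x D (I.deg x)) hτ₇
    ((hag₇.scalar .result rfl).trans ((hag₆.scalar .result rfl).trans hr₅)) ?_ (by omega))
    fun τ₈ hτ₈ hag₈ hr₈ => ?_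
  · simp [Expr.eval, z, hag₇.scalar .base rfl, hbase]
  refine RunsIn.seq (runs_findMinSolution (κ := 0) (l := l) (C := C') (B := L')
    (by simp) (by simp) hτ₈
    ((hag₈.scalar .l rfl).trans ((hag₇.scalar .l rfl).trans hl₆)) hl0
    ((hag₈.array .cost2 rfl).trans ((hag₇.array .cost2 rfl).trans hC'))
    ((hag₈.array .label2 rfl).trans ((hag₇.array .label2 rfl).trans hL')) b1 (by omega)
    (by omega) (by omega) (by omega)) fun τ₉ hτ₉ hag₉ ⟨hz', hzM'⟩ => ?_
  set z' := τ₉.scalar .best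
  have hbl' := toNat_add_best_le (b := baseline I x (insert x D) (I.deg x)) (c := 1) hzM'
    (toNat_baseline_le (D := insert x D) le_rfl) hlk
  rw [Nat.cast_one] at hbl'
  refine RunsIn.seq (runs_updateResult
    (z := z' + baseline I x (insert x D) (I.deg x) + 1) hτ₉
    ((hag₉.scalar .result rfl).trans hr₈) ?_ (by omega))
    fun τ₁₀ hτ₁₀ hag₁₀ hr₁₀ => ?_
  · simp [Expr.eval, z', hag₉.scalar .base2 rfl, hag₈.scalar .base2 rfl, hag₇.scalar .base2 rfl,
      hbase2]
  have hA : ∀ a, a ≠ .J → τ₁₀.array a = τ₆.array a := fun a ha => by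
    rw [hag₁₀.array a rfl,
      hag₉.array a (by simp [findMinSolution, forLoop, Cmd.writesArray, ha.symm]),
      hag₈.array a rfl, hag₇.array a (by simp [findMinSolution, forLoop, Cmd.writesArray, ha.symm])]
  refine RunsIn.mono (runs_nextPartition (κ := 0) (k := k) (P := P) (B := B) hτ₁₀ ?_ ?_ ?_ hB
    (by omega) (by omega) (by omega)) le_rfl fun τ hτ hag h => ⟨⟨d, ?_⟩,
      ⟨z, z', ht.isBestAssignment hz, ht'.isBestAssignment hz', by omega, hbl',
        (hag.scalar .result rfl).trans hr₁₀⟩, h⟩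
  · rw [hag₁₀.scalar .k rfl, hag₉.scalar .k rfl, hag₈.scalar .k rfl, hag₇.scalar .k rfl,
      hag₆.scalar .k rfl, hk₅]
  · rw [hA .P (by simp), hag₆.array .P rfl, hP₅]
  · rw [hA .B (by simp), hag₆.array .B rfl, hB₅]
  · rw [hag.array .D rfl, hA .D (by simp), hd]

/-- `r` is at most the cost that the procedure computes for the partition `B`. -/
def Tried (I : Input n) (x : Fin n) (k : ℕ) (π : ℕ → Fin n) (D : Set (Fin n)) (B : ℕ → ℕ)
    (r : ℕ∞) : Prop :=
  ∃ z z', IsBestAssignment (maxBelow B (k + 1)) (I.deg x) (overhead I x k π B D) z ∧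
    IsBestAssignment (maxBelow B (k + 1)) (I.deg x) (overhead I x k π B (insert x D)) z' ∧
    r ≤ z + baseline I x D (I.deg x) ∧ r ≤ z' + baseline I x (insert x D) (I.deg x) + 1

theorem Tried.mono {D : Set (Fin n)} {B : ℕ → ℕ} {r r' : ℕ∞} (h : Tried I x k π D B r)
    (hr : r' ≤ r) : Tried I x k π D B r' := by
  obtain ⟨z, z', h1, h2, h3, h4⟩ := h
  exact ⟨z, z', h1, h2, hr.trans h3, hr.trans h4⟩

/-- Some partition and some decision `E` about `x` attain the optimum. The cases `E = ∅` and `E =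
{x}` correspond to the values `z` and `z'`. -/
theorem le_domCost_of_tried {P D : Set (Fin n)} {r : ℕ∞}
    (htd : I.forest.IsTreedepthDecomposition I.graph) (hπ : IsPath I x k π)
    (hP : P ⊆ {w | ∃ p < k, π p = w}) (hdeg : 0 < I.deg x)
    (h : ∀ B, IsBlocks (k + 1) (fun p => π p ∈ insert x P) B → Tried I x k π D B r) :
    r ≤ domCost I x P D := by
  by_cases hfin : domCost I x P D = ⊤
  · simp [hfin]
  obtain ⟨E, hE, B, hB, hle⟩ := exists_assignment_le_domCost htd hπ hP hdeg hfin
  obtain ⟨z, z', h1, h2, h3, h4⟩ := h B hB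
  rcases hE with rfl | rfl
  · simp only [Finset.coe_empty, Set.union_empty, Finset.card_empty, Nat.cast_zero, add_zero] at hle
    exact h3.trans (hle z h1)
  · simp only [Finset.coe_singleton, Set.union_singleton, Finset.card_singleton, Nat.cast_one]
      at hle
    exact h4.trans (hle z' h2)

theorem domCost_le_of_isBestAssignment {P D : Set (Fin n)} {B : ℕ → ℕ} {z z' : ℕ∞}
    (hπ : IsPath I x k π) (hP : P ⊆ {w | ∃ p < k, π p = w})
    (hB : IsBlocks (k + 1) (fun p => π p ∈ insert x P) B)
    (h : IsBestAssignment (maxBelow B (k + 1)) (I.deg x) (overhead I x k π B D) z)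
    (h' : IsBestAssignment (maxBelow B (k + 1)) (I.deg x) (overhead I x k π B (insert x D)) z') :
    domCost I x P D ≤ z + baseline I x D (I.deg x) ∧
      domCost I x P D ≤ z' + baseline I x (insert x D) (I.deg x) + 1 := by
  constructor
  · have := domCost_le_assignment (D := D) hπ hP (Finset.empty_subset _) hB (z := z)
    simp only [Finset.coe_empty, Set.union_empty, Finset.card_empty, Nat.cast_zero, add_zero]
      at this
    exact this h
  · have := domCost_le_assignment (D := D) hπ hP (Finset.Subset.refl _) hB (z := z')
    simp only [Finset.coe_singleton, Set.union_singleton, Finset.card_singleton, Nat.cast_one]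
      at this
    exact this h'

/-- The result never drops below `domCost`, since each partition yields a feasible solution. When
the enumeration ends, every partition has been tried, which gives the other inequality. The variant
is the number of partitions from the current one on. -/
theorem runs_innerCase {P D : Set (Fin n)} {Tc : ℕ → ℕ} {Sc : ℕ} (hσ : σ.Fits Λ)
    (htd : I.forest.IsTreedepthDecomposition I.graph) (hdeg : 0 < I.deg x)
    (hx : σ.scalar .x = (x : ℕ)) (hk : σ.scalar .k = k)
    (hPσ : σ.array .P = arr k fun p => ind (π p ∈ P))
    (hDσ : σ.array .D = arr k fun p => ind (π p ∈ D))
    (hπ : IsPath I x k π) (hP : P ⊆ {w | ∃ p < k, π p = w}) (hD : D ⊆ {w | ∃ p < k, π p = w})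
    (hsol : ∀ c < I.deg x, Solves I (I.kid x c) (k + 1) π (Tc c) Sc)
    (hSc : frameBits Λ.N Λ.M Λ.L + exprBits Λ.N + 3 + Sc ≤ Λ.S) (hΛ : Λ.Admits (k + 1)) :
    RunsIn I Λ innerCase σ (10 + firstPartition.cost Λ.K 0 +
      (Λ.K + 1) * (2 + (tryPartitionCost Λ.K +
        ∑ c ∈ Finset.range (I.deg x), (processChild.cost Λ.K (2 * k + 11 + Tc c) + 9))))
      fun τ => τ.scalar .ret = domCost I x P D := by
  have hkk : k + 1 ≤ (k + 1) * (k + 1) := Nat.le_mul_self _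
  obtain ⟨a1, a2, a3, a4, a5⟩ := hΛ
  set T := tryPartitionCost Λ.K +
        ∑ c ∈ Finset.range (I.deg x), (processChild.cost Λ.K (2 * k + 11 + Tc c) + 9) with hT
  set P' : ℕ → Prop := fun p => π p ∈ insert x P with hP'
  have hPk : P' k := .inl hπ.last
  obtain ⟨F, hFcard, hF⟩ := IsBlocks.exists_finset (k + 1) P'
  have hFK : F.card ≤ Λ.K := hFcard.trans a5
  refine RunsIn.weaken (T₁ := 1 + 1 + (1 + 1 + (1 + 1 + (firstPartition.cost Λ.K 0 + (1 + 1 +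
    ((F.card + 1) * (1 + 1 + T) + (1 + 1))))))) ?_ ?_
  · refine RunsIn.assign_seq' ⊤ hσ rfl fun hσ => ?_
    refine RunsIn.push_seq (arr (k + 1) fun p => ind (P' p)) hσ ?_ (by simp; omega)
      (by simp [Expr.eval]; omega) fun hσ => ?_
    · rw [arr_succ, ind_true hPk]
      refine congrArg₂ _ (hPσ.trans (arr_congr fun p hp => ?_)) rfl
      simp [hP', hπ.ne_self hp]
    refine RunsIn.push_seq (nodeArray k π D (0 : ℕ)) hσ ?_ (by simp [nodeArray]; omega)
      (by simp [Expr.eval]) fun hσ => ?_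
    · have h : nodeArray k π D (0 : ℕ) = (arr k fun p => if p = k then ((0 : ℕ) : ℕ∞) else
          ind (π p ∈ D)) ++ [((0 : ℕ) : ℕ∞)] := by rw [nodeArray, arr_succ, if_pos rfl]
      rw [h]
      refine congrArg₂ _ (Eq.trans (by simpa using hDσ) (arr_congr fun p hp => ?_)) rfl
      rw [if_neg (by omega)]
    refine RunsIn.seq (runs_firstPartition (κ := 0) (P := P') hσ (by simpa using hk) (by simp)
      (by omega) (by omega)) fun τ₁ hτ₁ hag₁ hB₁ => ?_
    refine RunsIn.assign_seq' (1 : ℕ) hτ₁ rfl fun hτ₂ => ?_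
    refine RunsIn.seq (RunsIn.loop (e := v .more) (c := tryPartition)
      (Q := fun τ => τ.scalar .result = domCost I x P D) (fun m τ =>
      (∃ d, τ.array .D = nodeArray k π D d) ∧ domCost I x P D ≤ τ.scalar .result ∧
      (τ.scalar .result).toNat ≤ (k + 1) * Λ.M + n + 1 ∧
      (τ.scalar .more = 0 ∧ (∀ B, IsBlocks (k + 1) P' B → Tried I x k π D B (τ.scalar .result)) ∨
      τ.scalar .more = 1 ∧ ∃ B, IsBlocks (k + 1) P' B ∧
        τ.array .B = (arr (k + 1) fun p => (B p : ℕ∞)) ∧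
        (∀ C, IsBlocks (k + 1) P' C → toLex C < toLex B → Tried I x k π D C (τ.scalar .result)) ∧
        (F.filter (toLex B ≤ ·)).card ≤ m)) F.card hτ₂ ?_ ?_) fun τ₃ hτ₃ hag₃ hr => ?_
    · have hD₁ := hag₁.array .D rfl
      have hr₁ := hag₁.scalar .result rfl
      simp only [Frame.setArray_scalar, Frame.setScalar_scalar, if_true] at hr₁
      refine ⟨⟨(0 : ℕ), by simpa using hD₁⟩, by simp [hr₁], by simp [hr₁], .inr ⟨by simp, _,
        IsBlocks.oneBlock _ _, by simpa using hB₁, fun C hC hlt => ?_, Finset.card_filter_le _ _⟩⟩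
      exact absurd (hC.oneBlock_le) hlt.not_ge
    · rintro m τ hτ hag ⟨hDτ, hle, hbd, ⟨hmore, htr⟩ | ⟨hmore, B, hB, hBτ, htr, hm⟩⟩
      · refine .inl ⟨hmore, le_antisymm ?_ hle⟩
        exact le_domCost_of_tried htd hπ hP hdeg htr
      refine .inr ⟨by simp [hmore], ?_⟩
      refine RunsIn.mono (runs_tryPartition (P := P') hτ ?_ ?_ rfl ?_ hBτ hDτ hB hPk hπ hD hsol hSc
        ⟨a1, a2, a3, a4, a5⟩) le_rfl ?_
      · simpa [hag₁.scalar .x rfl, hx] using hag.scalar .x rfl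
      · simpa [hag₁.scalar .k rfl, hk] using hag.scalar .k rfl
      · simpa [hag₁.array .P rfl] using hag.array .P rfl
      rintro υ - - ⟨hDυ, ⟨z, z', hz, hz', hb, hb', hr⟩, hnext⟩
      obtain ⟨hu, hu'⟩ := domCost_le_of_isBestAssignment hπ hP hB hz hz'
      have hmono : υ.scalar .result ≤ τ.scalar .result := by
        rw [hr]; exact (min_le_left _ _).trans (min_le_left _ _)
      have htB : Tried I x k π D B (υ.scalar .result) := ⟨z, z', hz, hz',
        by rw [hr]; exact (min_le_left _ _).trans (min_le_right _ _),
        by rw [hr]; exact min_le_right _ _⟩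
      have hle' : domCost I x P D ≤ υ.scalar .result := by
        rw [hr]; exact le_min (le_min hle hu) hu'
      have hbd' : (υ.scalar .result).toNat ≤ (k + 1) * Λ.M + n + 1 := by
        rw [hr]
        rcases min_choice (min (τ.scalar .result) (z + baseline I x D (I.deg x)))
          (z' + baseline I x (insert x D) (I.deg x) + 1) with h | h
        · rw [h]
          rcases min_choice (τ.scalar .result) (z + baseline I x D (I.deg x)) with h | h
          · rwa [h]
          · rwa [h]
        · rwa [h]
      have hpos : 0 < m := lt_of_lt_of_le (Finset.card_pos.2 ⟨toLex B, by simp [hF, hB]⟩) hm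
      have htried : ∀ C, IsBlocks (k + 1) P' C → toLex C ≤ toLex B →
          Tried I x k π D C (υ.scalar .result) := fun C hC hCB => by
        rcases hCB.eq_or_lt with h | h
        · rwa [toLex.injective h]
        · exact (htr C hC h).mono hmono
      rcases hnext with ⟨hm0, hlast⟩ | ⟨hm1, B', hB', hBυ, hlt, hnext⟩
      · exact ⟨0, hpos, hDυ, hle', hbd', .inl ⟨hm0, fun C hC => htried C hC (hlast C hC)⟩⟩
      · refine ⟨_, lt_of_lt_of_le ?_ hm, hDυ, hle', hbd', .inr ⟨hm1, B', hB', hBυ,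
          fun C hC hlt' => htried C hC ?_, le_rfl⟩⟩
        -- The partition `B` itself is no longer among the remaining ones, so the variant drops
        -- strictly.
        · refine Finset.card_lt_card ⟨fun C hC => ?_, fun h => ?_⟩
          · rw [Finset.mem_filter] at hC ⊢
            exact ⟨hC.1, hlt.le.trans hC.2⟩
          · have : toLex B ∈ F.filter (toLex B' ≤ ·) := h (by simp [hF, hB])
            exact absurd (Finset.mem_filter.1 this).2 hlt.not_ge
        · by_contra h
          exact absurd (hnext C hC (not_le.1 h)) hlt'.not_ge
    · refine RunsIn.assign (x := domCost I x P D) hτ₃ hr ?_ (by simp)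
      rw [← hr]
      exact hτ₃.scalar _
  · have : (F.card + 1) * (1 + 1 + T) ≤ (Λ.K + 1) * (2 + T) := Nat.mul_le_mul (by omega) le_rfl
    omega

theorem dominatedAt_iff_dominates {D : Set (Fin n)} {Q : ℕ → Prop} {p : ℕ}
    (h : ∀ w, w ∈ D ↔ ∃ q ≤ k, Q q ∧ π q = w) :
    DominatedAt I k π Q p ↔ Dominates I D (π p) := by
  constructor
  · rintro ⟨q, hq, hQ, hd⟩
    exact ⟨π q, (h _).2 ⟨q, hq, hQ, rfl⟩, hd⟩
  · rintro ⟨u, hu, hd⟩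
    obtain ⟨q, hq, hQ, rfl⟩ := (h u).1 hu
    exact ⟨q, hq, hQ, hd⟩

theorem runs_leafCase_domCost {P D : Set (Fin n)} (hσ : σ.Fits Λ) (hdeg : I.deg x = 0)
    (hx : σ.scalar .x = (x : ℕ)) (hk : σ.scalar .k = k)
    (hPσ : σ.array .P = arr k fun p => ind (π p ∈ P))
    (hDσ : σ.array .D = arr k fun p => ind (π p ∈ D))
    (hπ : IsPath I x k π) (hP : P ⊆ {w | ∃ p < k, π p = w}) (hD : D ⊆ {w | ∃ p < k, π p = w})
    (hL : k + 1 ≤ Λ.L) (hK : k + 1 ≤ Λ.K) :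
    Runs I Λ 0 leafCase σ fun τ => τ.scalar .ret = domCost I x P D := by
  refine (runs_leafCase hπ hσ hx hk hPσ hDσ hL hK).mono fun τ _ _ hret => ?_
  classical
  rw [domCost_leaf hdeg]
  have h1 : ∀ p, DominatedAt I k π (fun q => q < k ∧ π q ∈ D) p ↔ Dominates I D (π p) := fun p => by
    refine dominatedAt_iff_dominates fun w => ⟨fun hw => ?_, ?_⟩
    · obtain ⟨q, hq, rfl⟩ := hD hw
      exact ⟨q, hq.le, ⟨hq, hw⟩, rfl⟩
    · rintro ⟨q, -, ⟨-, hq⟩, rfl⟩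
      exact hq
  have h2 : ∀ p, DominatedAt I k π (fun q => q = k ∨ q < k ∧ π q ∈ D) p ↔
      Dominates I (D ∪ {x}) (π p) := fun p => by
    refine dominatedAt_iff_dominates fun w => ⟨?_, ?_⟩
    · rintro (hw | rfl)
      · obtain ⟨q, hq, rfl⟩ := hD hw
        exact ⟨q, hq.le, .inr ⟨hq, hw⟩, rfl⟩
      · exact ⟨k, le_rfl, .inl rfl, hπ.last⟩
    · rintro ⟨q, -, rfl | ⟨-, hq⟩, rfl⟩
      · exact .inr hπ.last
      · exact .inl hq
  have h3 : (∀ p ≤ k, p = k ∨ p < k ∧ π p ∈ P → Dominates I D (π p)) ↔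
      ∀ w, w = x ∨ w ∈ P → Dominates I D w := by
    constructor
    · rintro h w (rfl | hw)
      · rw [← hπ.last]
        exact h k le_rfl (.inl rfl)
      · obtain ⟨q, hq, rfl⟩ := hP hw
        exact h q hq.le (.inr ⟨hq, hw⟩)
    · rintro h p - (rfl | ⟨-, hp⟩)
      · exact h _ (.inl hπ.last)
      · exact h _ (.inr hp)
  have h4 : (∀ p ≤ k, p < k ∧ π p ∈ P → Dominates I (D ∪ {x}) (π p)) ↔
      ∀ w ∈ P, Dominates I (D ∪ {x}) w := by
    constructor
    · rintro h w hw
      obtain ⟨q, hq, rfl⟩ := hP hw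
      exact h q hq.le ⟨hq, hw⟩
    · rintro h p - ⟨-, hp⟩
      exact h _ hp
  refine hret.trans (if_congr ((forall₃_congr fun p _ _ => h1 p).trans h3) rfl
    (if_congr ((forall₃_congr fun p _ _ => h2 p).trans h4) rfl rfl))

theorem fits_callFrame {P D : Set (Fin n)} (hL : k ≤ Λ.L) :
    (callFrame x k (arr k fun p => ind (π p ∈ P)) (arr k fun p => ind (π p ∈ D))).Fits Λ := by
  have h0 : Frame.empty.Fits Λ := ⟨by simp [Frame.empty], by simp [Frame.empty],
    by simp [Frame.empty]⟩
  have h1 : ∀ A : Set (Fin n), ∀ a ∈ arr k fun p => ind (π p ∈ A), a.toNat ≤ Λ.M := fun A a ha => by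
    simp only [arr, List.mem_map] at ha
    obtain ⟨p, -, rfl⟩ := ha
    exact toNat_ind_le Λ _
  refine Frame.Fits.setScalar (Frame.Fits.setScalar (Frame.Fits.setArray (Frame.Fits.setArray h0
    (by simpa using hL) (h1 P)) (by simpa using hL) (h1 D)) ?_) ?_
  · rw [ENat.toNat_natCast]
    exact x.2.le.trans Λ.n_le
  · rw [ENat.toNat_natCast]
    exact hL.trans Λ.L_le

/-- The time bound for one call, where `Tc c` bounds the times of the calls for child `c`. -/
def callCost (K k deg : ℕ) (Tc : ℕ → ℕ) : ℕ :=
  5 + (leafCase.cost K 0 + (10 + firstPartition.cost K 0 + (K + 1) * (2 + (tryPartitionCost K +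
    ∑ c ∈ Finset.range deg, (processChild.cost K (2 * k + 11 + Tc c) + 9)))))

/-- One level of the recursion. The two cases of the body are covered by the sum of their costs, and
the hypothesis `hSc` makes room for the calls to the children. -/
theorem solves_domset {Tc : ℕ → ℕ} {Sc : ℕ} (htd : I.forest.IsTreedepthDecomposition I.graph)
    (hπ : IsPath I x k π) (hsol : ∀ c < I.deg x, Solves I (I.kid x c) (k + 1) π (Tc c) Sc)
    (hSc : frameBits Λ.N Λ.M Λ.L + exprBits Λ.N + 3 + Sc ≤ Λ.S) (hΛ : Λ.Admits (k + 1)) :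
    Solves I x k π (callCost Λ.K k (I.deg x) Tc) Λ.S := by
  intro P D hP hD
  have hkk : k + 1 ≤ (k + 1) * (k + 1) := Nat.le_mul_self _
  have hL := hΛ.L
  have hK := hΛ.K
  have hσ : (callFrame x k (arr k fun p => ind (π p ∈ P)) (arr k fun p => ind (π p ∈ D))).Fits Λ :=
    fits_callFrame (by omega)
  have hrun : RunsIn I Λ domset (callFrame x k (arr k fun p => ind (π p ∈ P))
      (arr k fun p => ind (π p ∈ D))) (callCost Λ.K k (I.deg x) Tc)
      fun τ => τ.scalar .ret = domCost I x P D := by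
    refine (RunsIn.ite (I.deg x = 0) hσ ?_
      (fun h => runs_leafCase_domCost (π := π) hσ h ?_ ?_ ?_ ?_ hπ hP hD (by omega) (by omega))
      (fun h => runs_innerCase (π := π) hσ htd (by omega) ?_ ?_ ?_ ?_ hπ hP hD hsol hSc
        hΛ)).weaken ?_
    · simp [Expr.eval, callFrame, Input.degQuery_eq]
    any_goals simp [callFrame]
    unfold callCost
    simp only [Expr.time, v]
    generalize 10 + firstPartition.cost Λ.K 0 + _ = a
    generalize leafCase.cost Λ.K 0 = b
    omega
  obtain ⟨τ, T', S', h1, h2, h3, -, h4⟩ := hrun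
  exact ⟨τ, T', S', h1, h2, h3, h4⟩

end Domset

namespace Domset

variable {n : ℕ} {I : Input n} {x : Fin n} {k : ℕ} {π : ℕ → Fin n}

/-! Time and space. -/

/-- The number of steps of a command that runs every loop at most once. -/
def Cmd.weight : Cmd → ℕ
  | .skip | .clear _ | .call _ _ _ => 1
  | .assign _ e | .push _ e => e.time + 1
  | .store _ e f => e.time + f.time + 1
  | .seq c d => c.weight + d.weight
  | .ite e c d => e.time + 1 + (c.weight + d.weight)
  | .loop e c => e.time + 1 + c.weight

/-- The nesting depth of the loops of a command. -/
def Cmd.nesting : Cmd → ℕ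
  | .seq c d | .ite _ c d => max c.nesting d.nesting
  | .loop _ c => c.nesting + 1
  | _ => 0

/-- Each level of nesting contributes a factor `K + 1`, and a call contributes `κ` linearly. The
structural data of a concrete program are then found by evaluation. -/
theorem Cmd.cost_le (K κ : ℕ) (c : Cmd) {d : ℕ} (h : c.nesting ≤ d) :
    c.cost K κ ≤ c.weight * ((K + 1) ^ d * (κ + 1)) := by
  induction c generalizing d with
  | seq a b iha ihb =>
    simp only [nesting, max_le_iff] at h
    simp only [cost, weight, add_mul]
    exact Nat.add_le_add (iha h.1) (ihb h.2)
  | ite e a b iha ihb =>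
    simp only [nesting, max_le_iff] at h
    have h1 := iha h.1
    have h2 := ihb h.2
    have h3 : e.time + 1 ≤ (e.time + 1) * ((K + 1) ^ d * (κ + 1)) :=
      Nat.le_mul_of_pos_right _ (by positivity)
    simp only [cost, weight]
    rw [add_mul (e.time + 1), add_mul a.weight]
    omega
  | loop e a iha =>
    simp only [nesting] at h
    obtain ⟨d, rfl⟩ : ∃ d', d = d' + 1 := ⟨d - 1, by omega⟩
    have h1 := iha (d := d) (by omega)
    have h3 : e.time + 1 ≤ (e.time + 1) * ((K + 1) ^ d * (κ + 1)) :=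
      Nat.le_mul_of_pos_right _ (by positivity)
    simp only [cost, weight]
    calc (K + 1) * (e.time + 1 + a.cost K κ)
        ≤ (K + 1) * ((e.time + 1 + a.weight) * ((K + 1) ^ d * (κ + 1))) :=
          Nat.mul_le_mul_left _ (by rw [add_mul (e.time + 1)]; omega)
      _ = _ := by ring
  | call s es as =>
    simp only [cost, weight, one_mul]
    have : 1 ≤ (K + 1) ^ d := Nat.one_le_pow _ _ (by omega)
    nlinarith
  | skip | clear | assign | push | store =>
    simp only [cost, weight]
    exact Nat.le_mul_of_pos_right _ (by positivity)

/-- The exponent is `3` for the loops inside the pieces, one more for absorbing `2 * k + 11` into a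
multiple of `K + 1`, and one more for the loop over the partitions. -/
theorem callCost_le {K deg : ℕ} {Tc : ℕ → ℕ} (hK : k ≤ K) :
    callCost K k deg Tc ≤ 3000 * (K + 1) ^ 5 * (1 + ∑ c ∈ Finset.range deg, (Tc c + 1)) := by
  -- The numerals are the values of `Cmd.weight`. None of the commands nests loops more than three
  -- deep.
  have h1 : leafCase.cost K 0 ≤ 154 * ((K + 1) ^ 3 * (0 + 1)) := Cmd.cost_le K 0 _ (by decide)
  have h2 : firstPartition.cost K 0 ≤ 16 * ((K + 1) ^ 3 * (0 + 1)) := Cmd.cost_le K 0 _ (by decide)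
  have h3 : countBlocks.cost K 0 ≤ 23 * ((K + 1) ^ 3 * (0 + 1)) := Cmd.cost_le K 0 _ (by decide)
  have h4 : nextPartition.cost K 0 ≤ 57 * ((K + 1) ^ 3 * (0 + 1)) := Cmd.cost_le K 0 _ (by decide)
  have h5 : (findMinSolution .cost .label).cost K 0 ≤ 117 * ((K + 1) ^ 3 * (0 + 1)) :=
    Cmd.cost_le K 0 _ (by decide)
  have h6 : (findMinSolution .cost2 .label2).cost K 0 ≤ 117 * ((K + 1) ^ 3 * (0 + 1)) :=
    Cmd.cost_le K 0 _ (by decide)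
  have h7 : (initTable .cost .label).cost K 0 ≤ 26 * ((K + 1) ^ 3 * (0 + 1)) :=
    Cmd.cost_le K 0 _ (by decide)
  have h8 : (initTable .cost2 .label2).cost K 0 ≤ 26 * ((K + 1) ^ 3 * (0 + 1)) :=
    Cmd.cost_le K 0 _ (by decide)
  have h9 : ∀ κ, processChild.cost K κ ≤ 225 * ((K + 1) ^ 3 * (κ + 1)) := fun κ =>
    Cmd.cost_le K κ _ (by decide)
  have hq3 : 1 ≤ (K + 1) ^ 3 := Nat.one_le_pow _ _ (by omega)
  have hq4 : (K + 1) ^ 3 * (K + 1) = (K + 1) ^ 4 := by ring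
  have hq4' : (K + 1) ^ 3 ≤ (K + 1) ^ 4 := Nat.pow_le_pow_right (by omega) (by omega)
  have hq5 : (K + 1) * (K + 1) ^ 4 = (K + 1) ^ 5 := by ring
  have hq5' : (K + 1) ^ 4 ≤ (K + 1) ^ 5 := Nat.pow_le_pow_right (by omega) (by omega)
  -- `2709 = 225 * 12 + 9`.
  have hchild : ∀ c, processChild.cost K (2 * k + 11 + Tc c) + 9 ≤
      2709 * (K + 1) ^ 4 * (Tc c + 1) := fun c => by
    have h10 : 2 * k + 11 + Tc c + 1 ≤ 12 * ((K + 1) * (Tc c + 1)) := by nlinarith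
    have h11 : (K + 1) ^ 3 * (2 * k + 11 + Tc c + 1) ≤ 12 * ((K + 1) ^ 4 * (Tc c + 1)) :=
      (Nat.mul_le_mul_left _ h10).trans (le_of_eq (by ring))
    have h12 : 1 ≤ (K + 1) ^ 4 * (Tc c + 1) := Nat.one_le_iff_ne_zero.2 (by positivity)
    have := h9 (2 * k + 11 + Tc c)
    rw [mul_assoc]
    omega
  have hsum : ∑ c ∈ Finset.range deg, (processChild.cost K (2 * k + 11 + Tc c) + 9) ≤
      2709 * (K + 1) ^ 4 * ∑ c ∈ Finset.range deg, (Tc c + 1) := by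
    rw [Finset.mul_sum]
    exact Finset.sum_le_sum fun c _ => hchild c
  set s := ∑ c ∈ Finset.range deg, (Tc c + 1)
  have htry : tryPartitionCost K ≤ 401 * (K + 1) ^ 4 := by
    unfold tryPartitionCost
    omega
  have hin : (K + 1) * (2 + (tryPartitionCost K +
      ∑ c ∈ Finset.range deg, (processChild.cost K (2 * k + 11 + Tc c) + 9))) ≤
      403 * (K + 1) ^ 5 + 2709 * ((K + 1) ^ 5 * s) := by
    calc _ ≤ (K + 1) * (403 * (K + 1) ^ 4 + 2709 * (K + 1) ^ 4 * s) :=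
          Nat.mul_le_mul_left _ (by omega)
      _ = _ := by ring
  have hfin : 3000 * (K + 1) ^ 5 * (1 + s) = 3000 * (K + 1) ^ 5 + 3000 * ((K + 1) ^ 5 * s) := by
    ring
  rw [hfin]
  unfold callCost
  omega

/-- The bound on the loop iterations for trees of height `t`. -/
def iterBound (t : ℕ) : ℕ := 2 * (t * t) + 1 + (t + 1) ^ t

/-- The bound on the entries of arrays for trees of height `t`. -/
def entryBound (t : ℕ) : ℕ := 2 * (t * t) + 1

/-- The bound on the scalars for graphs with `n` vertices and trees of height `t`. -/
def scalarBound (n t : ℕ) : ℕ := t * entryBound t + (t * t) + n + 1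

/-- The bits that one active call needs. -/
def callBits (n t : ℕ) : ℕ :=
  frameBits (scalarBound n t) (entryBound t) (t * t) + exprBits (scalarBound n t) + 3

/-- The limits for a call for which `d + 1` calls fit on the stack. -/
def limits (n t d : ℕ) (ht : 0 < t) : Limits n where
  N := scalarBound n t
  M := entryBound t
  L := t * t
  S := (d + 1) * callBits n t
  K := iterBound t
  n_le := by unfold scalarBound; omega
  M_le := by
    have := Nat.le_mul_of_pos_left (entryBound t) ht
    unfold scalarBound; omega
  L_le := by unfold scalarBound; omega
  two_le := by
    have : 0 < t * t := Nat.mul_pos ht ht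
    unfold entryBound; omega
  space := by
    have : callBits n t ≤ (d + 1) * callBits n t := Nat.le_mul_of_pos_left _ (by omega)
    unfold callBits at *; omega

theorem admits_limits {t d : ℕ} (ht : 0 < t) : (limits n t d ht).Admits t :=
  ⟨le_rfl, le_rfl, by simp only [limits, scalarBound]; omega,
    by simp only [limits, iterBound]; omega, by simp only [limits, iterBound]; omega⟩

/-- The factor by which the time bound grows from one level of the tree to the next one. -/
def levelFactor (t : ℕ) : ℕ := 6000 * (iterBound t + 1) ^ 5

/-- Induction on the number `d` of levels below `x`. The times of the children add up to a multiple
of the size of the subtree without `x`, so each level costs only a factor. Calls to different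
children reuse the same space, so each level adds `callBits` once. -/
theorem solves_of_isPath (htd : I.forest.IsTreedepthDecomposition I.graph) {d : ℕ}
    (hd : k + 1 + d = I.forest.height) (hπ : IsPath I x k π) :
    Solves I x k π (levelFactor I.forest.height ^ (d + 1) * (I.forest.subtree x).card)
      ((d + 1) * callBits n I.forest.height) := by
  induction d using Nat.strong_induction_on generalizing x k π with
  | _ d ih =>
    set t := I.forest.height
    have ht : 0 < t := by omega
    have hβ : 0 < levelFactor t := by unfold levelFactor; positivity
    have hkK : k ≤ iterBound t := by
      have : t ≤ t * t := Nat.le_mul_self t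
      unfold iterBound; omega
    have hch : ∀ c < I.deg x, Solves I (I.kid x c) (k + 1) π
        (levelFactor t ^ d * (I.forest.subtree (I.kid x c)).card) (d * callBits n t) := by
      intro c hc
      have hπ' := hπ.extend (I.parent_kid hc)
      have hlt := hπ'.lt_height
      -- A child extends the path by one node, which must still fit into the height. Hence `d` is
      -- positive.
      obtain ⟨d, rfl⟩ : ∃ d', d = d' + 1 := ⟨d - 1, by omega⟩
      exact (ih d (by omega) (by omega) hπ').congr fun p hp =>
        Function.update_of_ne (by omega) _ _
    have hsol := solves_domset (Λ := limits n t d ht) htd hπ hch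
      (by simp only [limits, callBits]; rw [add_mul, one_mul]; omega)
      ((admits_limits ht).mono (by omega))
    intro P D hP hD
    obtain ⟨τ, T', S', h1, h2, h3, h4⟩ := hsol P D hP hD
    refine ⟨τ, T', S', h1, h2.trans ?_, h3, h4⟩
    refine (callCost_le hkK).trans ?_
    -- Every summand is at least `1`, so the additional `1` at most doubles it. This is why
    -- `levelFactor` has `6000` in place of `3000`.
    have hs : ∑ c ∈ Finset.range (I.deg x),
        (levelFactor t ^ d * (I.forest.subtree (I.kid x c)).card + 1) ≤
        2 * levelFactor t ^ d *
          ∑ c ∈ Finset.range (I.deg x), (I.forest.subtree (I.kid x c)).card := by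
      rw [Finset.mul_sum]
      refine Finset.sum_le_sum fun c _ => ?_
      have h5 : 1 ≤ levelFactor t ^ d * (I.forest.subtree (I.kid x c)).card :=
        Nat.mul_pos (by positivity) (Finset.card_pos.2 ⟨_, RootedForest.self_mem_subtree _⟩)
      rw [mul_assoc]
      omega
    rw [I.card_subtree x]
    set s := ∑ c ∈ Finset.range (I.deg x), (I.forest.subtree (I.kid x c)).card
    have h6 : 1 ≤ levelFactor t ^ d := Nat.one_le_pow _ _ hβ
    calc _ ≤ 3000 * (iterBound t + 1) ^ 5 * (1 + 2 * levelFactor t ^ d * s) :=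
          Nat.mul_le_mul_left _ (by omega)
      _ ≤ 3000 * (iterBound t + 1) ^ 5 * (2 * levelFactor t ^ d * (s + 1)) :=
          Nat.mul_le_mul_left _ (by rw [mul_add]; omega)
      _ = levelFactor t ^ (d + 1) * (s + 1) := by rw [pow_succ]; unfold levelFactor; ring

/-! ### The call at the root. -/

theorem isPath_root {r : Fin n} (hr : I.forest.IsTreeWithRoot r) :
    IsPath I r 0 fun _ => r :=
  ⟨rfl, by simp, (hr r).2 rfl⟩

/-- Walking up from any vertex ends at a node without parent, and `r` is the only one. -/
theorem subtree_root {r : Fin n} (hr : I.forest.IsTreeWithRoot r) :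
    I.forest.subtree r = Finset.univ := by
  refine Finset.eq_univ_of_forall fun v => ?_
  induction v using I.forest.acyclic.induction with
  | _ v ih =>
    cases hv : I.forest.parent v with
    | none => rw [(hr v).1 hv]; exact RootedForest.self_mem_subtree r
    | some u =>
      refine RootedForest.mem_subtree_trans (ih u hv) ?_
      exact RootedForest.mem_subtree.2 (.inr (.single hv))

theorem height_le : I.forest.height ≤ n :=
  Finset.sup_le fun v _ => (Set.ncard_le_card _).trans (by simp)

theorem feasible_root_iff {r : Fin n} (hr : I.forest.IsTreeWithRoot r) {X : Finset (Fin n)} :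
    Feasible I r ∅ ∅ X ↔ IsDominatingSet I.graph X := by
  constructor
  · intro h v
    obtain ⟨u, hu, rfl | huv⟩ := h.dom v (.inl (by simp [subtree_root hr]))
    · exact .inl (by simpa using hu)
    · exact .inr ⟨u, by simpa using hu, huv.symm⟩
  · refine fun h => ⟨by simp [subtree_root hr], fun w _ => ?_⟩
    rcases h w with hw | ⟨u, hu, huw⟩
    · exact ⟨w, by simpa using hw, .inl rfl⟩
    · exact ⟨u, by simpa using hu, .inr huw.symm⟩

theorem exists_isDominationNumber {r : Fin n} (hr : I.forest.IsTreeWithRoot r) :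
    ∃ m : ℕ, domCost I r ∅ ∅ = m ∧ IsDominationNumber I.graph m := by
  have huniv : Feasible I r ∅ ∅ Finset.univ :=
    (feasible_root_iff hr).2 fun v => .inl (Finset.mem_univ v)
  have hle : ∀ X, Feasible I r ∅ ∅ X → domCost I r ∅ ∅ ≤ X.card := fun X hX =>
    sInf_le ⟨X, hX, rfl⟩
  obtain ⟨X, hX, he⟩ := exists_feasible (ne_top_of_le_ne_top (ENat.natCast_ne_top _) (hle _ huniv))
  refine ⟨X.card, he, ⟨X, (feasible_root_iff hr).1 hX, rfl⟩, ?_⟩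
  rintro m ⟨Y, hY, rfl⟩
  have := hle Y ((feasible_root_iff hr).2 hY)
  rw [he] at this
  exact_mod_cast this

/-! ### Closed forms of the bounds. -/

/-- From `t = 2` on, `t + 1 ≤ t ^ 2`. For `t = 1` every power of `t` is `1`, so that case needs the
outer constant of the time bound. -/
theorem iterBound_lt {t : ℕ} (ht : 2 ≤ t) : iterBound t + 1 ≤ t ^ (3 * t) := by
  have h1 : (t + 1) ^ t ≤ t ^ (2 * t) := by
    rw [pow_mul]
    exact Nat.pow_le_pow_left (by nlinarith) _
  have h2 : 2 * (t * t) + 2 ≤ t ^ (2 * t) := by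
    calc 2 * (t * t) + 2 ≤ t ^ 4 := by nlinarith [Nat.mul_le_mul ht ht]
      _ ≤ t ^ (2 * t) := Nat.pow_le_pow_right (by omega) (by omega)
  calc iterBound t + 1 ≤ t ^ (2 * t) * 2 := by unfold iterBound; omega
    _ ≤ t ^ (2 * t) * t := Nat.mul_le_mul_left _ ht
    _ = t ^ (2 * t + 1) := (pow_succ _ _).symm
    _ ≤ t ^ (3 * t) := Nat.pow_le_pow_right (by omega) (by omega)

theorem levelFactor_pow_le {t : ℕ} (ht : 2 ≤ t) : levelFactor t ^ t ≤ t ^ (28 * t ^ 2) := by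
  have h1 : 6000 ≤ t ^ (13 * t) :=
    calc 6000 ≤ 2 ^ 13 := by norm_num
      _ ≤ t ^ 13 := Nat.pow_le_pow_left ht _
      _ ≤ t ^ (13 * t) := Nat.pow_le_pow_right (by omega) (by omega)
  -- The exponent is `28 = 13 + 3 * 5`: the constant `6000` is below `2 ^ 13`, and `iterBound t + 1`
  -- enters with the fifth power.
  calc levelFactor t ^ t ≤ (t ^ (13 * t) * (t ^ (3 * t)) ^ 5) ^ t :=
        Nat.pow_le_pow_left (Nat.mul_le_mul h1 (Nat.pow_le_pow_left (iterBound_lt ht) _)) _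
    _ = t ^ (28 * t ^ 2) := by
        rw [← pow_mul, ← pow_add, ← pow_mul]
        congr 1
        ring

theorem size_le_logb {m : ℕ} (hm : 0 < m) : (Nat.size m : ℝ) ≤ Real.logb 2 m + 1 := by
  have hs : 0 < Nat.size m := Nat.size_pos.2 hm
  have h1 : 2 ^ (Nat.size m - 1) ≤ m := Nat.lt_size.1 (by omega)
  have h2 : ((Nat.size m - 1 : ℕ) : ℝ) ≤ Real.logb 2 m := by
    rw [Real.le_logb_iff_rpow_le (by norm_num) (by exact_mod_cast hm), Real.rpow_natCast]
    exact_mod_cast h1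
  rw [Nat.cast_sub hs] at h2
  push_cast at h2
  linarith

/-- Table entries are polynomial in `t` and scalars polynomial in `n`, so a frame takes `O(t ^ 2)`
entries of `O(log t)` bits and a bounded number of values of `O(log n)` bits. The constants are
generous. -/
theorem callBits_le {t : ℕ} (ht : 1 ≤ t) (htn : t ≤ n) :
    ((t * callBits n t : ℕ) : ℝ) ≤
      10000 * ((t : ℝ) ^ 3 * Real.logb 2 t + t * Real.logb 2 n + 1) := by
  have hn : 1 ≤ n := ht.trans htn
  have hn0 : (0 : ℝ) < n := by exact_mod_cast hn
  have ht0 : (0 : ℝ) < t := by exact_mod_cast ht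
  have ht1 : (1 : ℝ) ≤ t := by exact_mod_cast ht
  have hLt : 0 ≤ Real.logb 2 t := Real.logb_nonneg (by norm_num) ht1
  have hLn : 0 ≤ Real.logb 2 n := Real.logb_nonneg (by norm_num) (by exact_mod_cast hn)
  have hN : 0 < scalarBound n t := by unfold scalarBound; omega
  have hNle : 24 * scalarBound n t ≤ 2 ^ 8 * n ^ 3 := by
    have h1 : t * t ≤ n * n := Nat.mul_le_mul htn htn
    have h2 : t * entryBound t ≤ n * (2 * (n * n) + 1) :=
      Nat.mul_le_mul htn (by unfold entryBound; omega)
    have h3 : n * n ≤ n * n * n := Nat.le_mul_of_pos_right _ hn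
    have h4 : n ≤ n * n := Nat.le_mul_self n
    have h5 : n * (2 * (n * n) + 1) = 2 * (n * n * n) + n := by ring
    have h6 : n ^ 3 = n * n * n := by ring
    unfold scalarBound
    omega
  have hsN : (Nat.size (24 * scalarBound n t) : ℝ) ≤ 9 + 3 * Real.logb 2 n := by
    refine (size_le_logb (by omega)).trans ?_
    have h1 : Real.logb 2 (24 * scalarBound n t : ℕ) ≤ Real.logb 2 ((2 : ℝ) ^ 8 * n ^ 3) :=
      Real.logb_le_logb_of_le (by norm_num)
        (by exact_mod_cast (by omega : 0 < 24 * scalarBound n t)) (by exact_mod_cast hNle)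
    rw [Real.logb_mul (by norm_num) (by positivity), Real.logb_pow, Real.logb_pow,
      Real.logb_self_eq_one (by norm_num)] at h1
    push_cast at h1 ⊢
    linarith
  have hsM : (Nat.size (entryBound t) : ℝ) ≤ 3 + 2 * Real.logb 2 t := by
    have h0 : entryBound t ≤ 2 ^ 2 * t ^ 2 := by unfold entryBound; nlinarith
    refine (size_le_logb (by unfold entryBound; omega)).trans ?_
    have h1 : Real.logb 2 (entryBound t : ℕ) ≤ Real.logb 2 ((2 : ℝ) ^ 2 * t ^ 2) :=
      Real.logb_le_logb_of_le (by norm_num)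
        (by exact_mod_cast (by unfold entryBound; omega : 0 < entryBound t)) (by exact_mod_cast h0)
    rw [Real.logb_mul (by norm_num) (by positivity), Real.logb_pow, Real.logb_pow,
      Real.logb_self_eq_one (by norm_num)] at h1
    push_cast at h1
    linarith
  have hsN' : (Nat.size (scalarBound n t) : ℝ) ≤ 9 + 3 * Real.logb 2 n := by
    refine le_trans ?_ hsN
    exact_mod_cast Nat.size_le_size (by omega)
  -- There are `34 + 24 = 58` values of at most `11 + 3 * logb 2 n` bits, `9 * t ^ 2` entries of at
  -- most `5 + 2 * logb 2 t` bits, and three bits for the return address.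
  have hcb : (callBits n t : ℝ) ≤
      641 + 174 * Real.logb 2 n + 45 * (t : ℝ) ^ 2 + 18 * ((t : ℝ) ^ 2 * Real.logb 2 t) := by
    have h1 := mul_le_mul_of_nonneg_left hsM (sq_nonneg (t : ℝ))
    unfold callBits frameBits exprBits
    push_cast
    nlinarith
  -- The terms without logarithm are absorbed: for `t ≥ 2` the logarithm is at least `1`, and for `t
  -- = 1` the summand `1` does it.
  have hcube : (t : ℝ) ^ 3 ≤ (t : ℝ) ^ 3 * Real.logb 2 t + 1 := by
    rcases ht.eq_or_lt with rfl | h2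
    · simp
    · have h3 : 1 ≤ Real.logb 2 t := by
        rw [Real.le_logb_iff_rpow_le (by norm_num) ht0, Real.rpow_one]
        exact_mod_cast h2
      have := mul_le_mul_of_nonneg_left h3 (pow_nonneg ht0.le 3)
      linarith
  have ht3 : (t : ℝ) ≤ (t : ℝ) ^ 3 := le_self_pow₀ ht1 (by norm_num)
  have h1 := mul_le_mul_of_nonneg_left hcb ht0.le
  have h2 : 0 ≤ (t : ℝ) ^ 3 * Real.logb 2 t := by positivity
  have h3 : 0 ≤ (t : ℝ) * Real.logb 2 n := by positivity
  have h4 : (t : ℝ) * (641 + 174 * Real.logb 2 n + 45 * (t : ℝ) ^ 2 +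
      18 * ((t : ℝ) ^ 2 * Real.logb 2 t)) = 641 * t + 174 * (t * Real.logb 2 n) + 45 * (t : ℝ) ^ 3 +
      18 * ((t : ℝ) ^ 3 * Real.logb 2 t) := by ring
  rw [Nat.cast_mul]
  linarith

end Domset

/-! ### The theorem. -/

theorem mainTheorem3 :
    ∃ C : ℕ, ∀ (n : ℕ) (I : Domset.Input n) (r : Fin n),
      I.forest.IsTreedepthDecomposition I.graph →
      I.forest.IsTreeWithRoot r →
      ∃ (τ : Domset.Frame) (m T S : ℕ),
        Domset.Exec I Domset.domset Domset.domset (Domset.initialFrame r) τ T S ∧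
        τ.scalar Domset.Var.ret = m ∧
        IsDominationNumber I.graph m ∧
        T ≤ C * I.forest.height ^ (C * I.forest.height ^ 2) * n ∧
        (S : ℝ) ≤ C * ((I.forest.height : ℝ) ^ 3 * Real.logb 2 I.forest.height
          + I.forest.height * Real.logb 2 n + 1) := by
  -- `levelFactor 1` is the time factor in the case of height one, and `10000` is needed for the
  -- space. The latter also exceeds the `28` in the exponent of the time bound.
  obtain ⟨C, hC, hC'⟩ : ∃ C, Domset.levelFactor 1 ≤ C ∧ 10000 ≤ C :=
    ⟨_, le_max_left _ _, le_max_right _ _⟩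
  refine ⟨C, fun n I r htd hr => ?_⟩
  have hπ := Domset.isPath_root hr
  have ht := hπ.lt_height
  have hsol := Domset.solves_of_isPath htd (d := I.forest.height - 1) (by omega) hπ
  have htn := Domset.height_le (I := I)
  obtain ⟨m, hm, hdom⟩ := Domset.exists_isDominationNumber hr
  obtain ⟨τ, T, S, h1, h2, h3, h4⟩ := hsol ∅ ∅ (Set.empty_subset _) (Set.empty_subset _)
  have hframe : Domset.callFrame r 0 (Domset.arr 0 fun _ => Domset.ind (r ∈ (∅ : Set (Fin n))))
      (Domset.arr 0 fun _ => Domset.ind (r ∈ (∅ : Set (Fin n)))) = Domset.initialFrame r := by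
    ext s
    · by_cases hs : s = .k
      · simp [Domset.callFrame, Domset.initialFrame, Domset.Frame.empty, Domset.Frame.setScalar,
          Domset.Frame.setArray, hs]
      · simp [Domset.callFrame, Domset.initialFrame, hs, Domset.Frame.empty]
    · simp [Domset.callFrame, Domset.initialFrame, Domset.arr, Domset.Frame.empty]
  rw [hframe] at h1
  rw [Domset.subtree_root hr, Finset.card_univ, Fintype.card_fin] at h2
  rw [Nat.sub_add_cancel (by omega)] at h2 h3
  refine ⟨τ, m, T, S, h1, h4.trans hm, hdom, h2.trans (Nat.mul_le_mul_right _ ?_), ?_⟩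
  -- For height one the power of the height is `1`, and the outer factor `C` alone has to bound
  -- `levelFactor 1`.
  · rcases (by omega : I.forest.height = 1 ∨ 2 ≤ I.forest.height) with h | h
    · rwa [h, pow_one, one_pow, mul_one]
    · refine (Domset.levelFactor_pow_le h).trans (le_trans ?_ (Nat.le_mul_of_pos_left _ (by omega)))
      exact Nat.pow_le_pow_right (by omega) (Nat.mul_le_mul_right _ (by omega))
  · have hS : (S : ℝ) ≤ ((I.forest.height * Domset.callBits n I.forest.height : ℕ) : ℝ) := by
      exact_mod_cast h3
    have ht1 : (1 : ℝ) ≤ I.forest.height := by exact_mod_cast ht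
    have hn1 : (1 : ℝ) ≤ n := by exact_mod_cast (show 1 ≤ n by omega)
    have hLt : 0 ≤ Real.logb 2 I.forest.height := Real.logb_nonneg (by norm_num) ht1
    have hLn : 0 ≤ Real.logb 2 n := Real.logb_nonneg (by norm_num) hn1
    refine hS.trans ((Domset.callBits_le (by omega) htn).trans ?_)
    refine mul_le_mul_of_nonneg_right ?_ (by positivity)
    exact_mod_cast hC'
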